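/- **Conventions.** Groupoids are small, a simplicial groupoid is a functor $\mathcal X\colon\Delta^{\mathrm{op}}\to\mathrm{Grpd}$, $\mathcal X_n=\mathcal X_{[n]}$, and for $S\subseteq[n]$ we write $\mathcal X_n\to\mathcal X_S$ for the induced restriction. A morphism $\Phi\colon\mathcal Y\to\mathcal X$ of simplicial groupoids is the same as a *relative simplicial groupoid* $\Phi^{\geqslant}$ with value $\mathcal X_n$ on $\{0<\dots<n\}$ and $\mathcal Y_n$ on $\{0<\dots<n<+\infty\}$; placing $\mathcal Y_n$ on $\{-\infty<0<\dots<n\}$ instead gives $\Phi^{\leqslant}$. $\mathcal X$ is *2-Segal* (unitality included) if for all $0\le i<j\le n$ the square $\mathcal X_n\simeq\mathcal X_{\{0,\dots,i,j,\dots,n\}}\times_{\mathcal X_{\{i,j\}}}\mathcal X_{\{i,\dots,j\}}$ is a 2-pullback, and for all $0\le i\le n$ the square $\mathcal X_n\simeq\mathcal X_{n+1}\times_{\mathcal X_{\{i,i+1\}}}\mathcal X_{0}$, given by the $i$-th degeneracy, is a 2-pullback. $\Phi$ is *2-Segal* if $\Phi^{\geqslant}$ is, i.e. if $\mathcal X$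 is 2-Segal and the following squares are 2-pullbacks: $\mathcal Y_n\simeq\mathcal Y_{\{0,\dots,i,j,\dots,n\}}\times_{\mathcal X_{\{i,j\}}}\mathcal X_{\{i,\dots,j\}}$ for $0\le i<j\le n$; $\mathcal Y_n\simeq\mathcal Y_{n+1}\times_{\mathcal X_{\{i,i+1\}}}\mathcal X_0$ for $0\le i\le n$; and $\mathcal Y_n\simeq\mathcal Y_{\{0,\dots,i\}}\times_{\mathcal Y_{\{i\}}}\mathcal Y_{\{i,\dots,n\}}$ for $0\le i\le n$. A *componentwise cocontinuous left monoidal derivator of groupoids* $\mathcal V$ assigns, pseudofunctorially, to each groupoid $A$ a monoidal category $\mathcal V(A)$, to each functor $f\colon A\to B$ a strong monoidal functor $f^*\colon\mathcal V(B)\to\mathcal V(A)$ and to each natural transformation a monoidal transformation, such that left Kan extensions $f_!$ (left adjoint to $f^*$) exist, satisfy base change along all 2-pullback squares of groupoids, and are preserved in each variable by the external product $\mathcal V(A)\times\mathcal V(B)\to\mathcal V(A\times B)$. **Theorem.** Let $\Phi\colon\mathcal Y\to\mathcal X$ be a 2-Segal morphism of simplicial groupoids. (1) Let $\mathcal V$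 be a componentwise cocontinuous left monoidal derivator of groupoids. * The *Hall monoidal category* $\mathrm{Hall}_{\mathcal V}(\mathcal X)$ exists: it is a monoidal structure on $\mathcal V(\mathcal X_1)$ for which $F\otimes G$ is the left Kan extension along $\mathcal X_2\to\mathcal X_{\{0,2\}}$ of $F|_{\{1,2\}}\otimes G|_{\{0,1\}}\in\mathcal V(\mathcal X_2)$, the unit object is the left Kan extension along the degeneracy $\mathcal X_0\to\mathcal X_1$ of the unit of $\mathcal V(\mathcal X_0)$, and tensor products of morphisms, the associator and the unitors are those induced by the ones of $\mathcal V(\mathcal X_2)$, $\mathcal V(\mathcal X_3)$ and $\mathcal V(\mathcal X_1)$. * The *categorical right Hall module* $\mathrm{Hall}_{\mathcal V}(\Phi^{\geqslant})$ exists: it is a right action of the monoidal category $\mathrm{Hall}_{\mathcal V}(\mathcal X)$ on the category $\mathcal V(\mathcal Y_0)$ for which $M\cdot F$ is the left Kan extension along $\mathcal Y_1\to\mathcal Y_{\{0\}}$ (the edge $\{0,+\infty\}$) of $M|_{\{1\}}\otimes F|_{\{0,1\}}\in\mathcal V(\mathcal Y_1)$ (restrictions to the edges $\{1,+\infty\}$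 and $\{0,1\}$), with the action on morphisms and the associativity and unit isomorphisms induced by the tensor products of $\mathcal V(\mathcal Y_1)$, $\mathcal V(\mathcal Y_2)$ and $\mathcal V(\mathcal Y_0)$. * The *categorical left Hall module* $\mathrm{Hall}_{\mathcal V}(\Phi^{\leqslant})$ exists: it is a left action of $\mathrm{Hall}_{\mathcal V}(\mathcal X)$ on the same category $\mathcal V(\mathcal Y_0)$ for which $F\cdot M$ is the left Kan extension along $\mathcal Y_1\to\mathcal Y_{\{1\}}$ (the edge $\{-\infty,1\}$) of $F|_{\{0,1\}}\otimes M|_{\{0\}}\in\mathcal V(\mathcal Y_1)$, with the induced action on morphisms, associativity and unit isomorphisms. (2) If $\mathcal V$ is a cocomplete monoidal category whose monoidal product is cocontinuous in each variable, then $A\mapsto[A,\mathcal V]$, with the pointwise monoidal product, is a componentwise cocontinuous left monoidal derivator of groupoids. So (1) applies to it and gives the Hall monoidal category on $[\mathcal X_1,\mathcal V]$ and the right and left Hall modules on $[\mathcal Y_0,\mathcal V]$. -/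

import Mathlib

open CategoryTheory MonoidalCategory Simplicial Opposite Limits

universe w z w' z' u

/-! ### Monoidal derivators of groupoids -/

/-- A monoidal prederivator of groupoids: a pseudofunctor `A ↦ obj A`, `f ↦ pull f`, contravariant
on functors of small groupoids and covariant on natural transformations, with values in monoidal
categories, strong monoidal functors and monoidal natural transformations. -/
structure MonoidalPrederivator where
  /-- The category of coefficient systems on a groupoid. -/
  obj : Grpd.{u, u} → Type w
  [category : ∀ A, Category.{z} (obj A)]
  [monoidal : ∀ A, MonoidalCategory (obj A)]
  /-- Restriction `f^*` along a functor `f`. -/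
  pull {A B : Grpd.{u, u}} (f : A ⥤ B) : obj B ⥤ obj A
  [pullMonoidal : ∀ {A B : Grpd.{u, u}} (f : A ⥤ B), (pull f).Monoidal]
  /-- The action on natural transformations. -/
  pull₂ {A B : Grpd.{u, u}} {f g : A ⥤ B} (a : f ⟶ g) : pull f ⟶ pull g
  /-- Restriction along an identity. -/
  pullId (A : Grpd.{u, u}) : pull (𝟭 A) ≅ 𝟭 (obj A)
  /-- Restriction along a composite. -/
  pullComp {A B C : Grpd.{u, u}} (f : A ⥤ B) (g : B ⥤ C) : pull (f ⋙ g) ≅ pull g ⋙ pull f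
  pull₂_isMonoidal {A B : Grpd.{u, u}} {f g : A ⥤ B} (a : f ⟶ g) :
    NatTrans.IsMonoidal (pull₂ a)
  pullId_isMonoidal (A : Grpd.{u, u}) : NatTrans.IsMonoidal (pullId A).hom
  pullComp_isMonoidal {A B C : Grpd.{u, u}} (f : A ⥤ B) (g : B ⥤ C) :
    NatTrans.IsMonoidal (pullComp f g).hom
  pull₂_id {A B : Grpd.{u, u}} (f : A ⥤ B) : pull₂ (𝟙 f) = 𝟙 (pull f)
  pull₂_comp {A B : Grpd.{u, u}} {f g h : A ⥤ B} (a : f ⟶ g) (b : g ⟶ h) :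
    pull₂ (a ≫ b) = pull₂ a ≫ pull₂ b
  pull₂_whiskerLeft {A B C : Grpd.{u, u}} (f : A ⥤ B) {g g' : B ⥤ C} (a : g ⟶ g') :
    pull₂ (Functor.whiskerLeft f a) ≫ (pullComp f g').hom =
      (pullComp f g).hom ≫ Functor.whiskerRight (pull₂ a) (pull f)
  pull₂_whiskerRight {A B C : Grpd.{u, u}} {f f' : A ⥤ B} (a : f ⟶ f') (g : B ⥤ C) :
    pull₂ (Functor.whiskerRight a g) ≫ (pullComp f' g).hom =
      (pullComp f g).hom ≫ Functor.whiskerLeft (pull g) (pull₂ a)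
  pull_assoc {A B C E : Grpd.{u, u}} (f : A ⥤ B) (g : B ⥤ C) (h : C ⥤ E) (M : obj E) :
    (pullComp (f ⋙ g) h).hom.app M ≫ (pullComp f g).hom.app ((pull h).obj M) =
      (pull₂ (Functor.associator f g h).hom).app M ≫
        (pullComp f (g ⋙ h)).hom.app M ≫ (pull f).map ((pullComp g h).hom.app M)
  pull_leftUnitor {A B : Grpd.{u, u}} (f : A ⥤ B) (M : obj B) :
    (pullComp (𝟭 A) f).hom.app M ≫ (pullId A).hom.app ((pull f).obj M) =
      (pull₂ f.leftUnitor.hom).app M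
  pull_rightUnitor {A B : Grpd.{u, u}} (f : A ⥤ B) (M : obj B) :
    (pullComp f (𝟭 B)).hom.app M ≫ (pull f).map ((pullId B).hom.app M) =
      (pull₂ f.rightUnitor.hom).app M

attribute [instance] MonoidalPrederivator.category MonoidalPrederivator.monoidal
  MonoidalPrederivator.pullMonoidal

/-- The square of groupoids formed by `p`, `q`, `f`, `g`, which commutes up to the isomorphism `α`,
is a 2-pullback (homotopy pullback): the induced functor from `P` to the category of triples
`(a, c, f a ≅ g c)` is an equivalence. -/
def IsTwoPullback {P A B C : Grpd.{u, u}} (p : P ⥤ A) (q : P ⥤ C) (f : A ⥤ B) (g : C ⥤ B)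
    (α : p ⋙ f ≅ q ⋙ g) : Prop :=
  ((CategoricalPullback.CatCommSqOver.toFunctorToCategoricalPullback f g P).obj
    ⟨p, q, α⟩).IsEquivalence

namespace MonoidalPrederivator

section

variable (D : MonoidalPrederivator.{w, z, u})

/-- `η : M ⟶ f^* N` exhibits `N` as the left Kan extension `f_! M` of `M` along `f`. -/
def IsLan {A B : Grpd.{u, u}} (f : A ⥤ B) {M : D.obj A} {N : D.obj B}
    (η : M ⟶ (D.pull f).obj N) : Prop :=
  ∀ K : D.obj B, Function.Bijective (fun k : N ⟶ K => η ≫ (D.pull f).map k)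

/-- The isomorphism `h^* ≅ p^* f^*` for a factorization `h = f ∘ p`. -/
def pullFac {P A B : Grpd.{u, u}} (p : P ⥤ A) (f : A ⥤ B) {h : P ⥤ B} (e : h = p ⋙ f) :
    D.pull h ≅ D.pull f ⋙ D.pull p :=
  eqToIso (congrArg D.pull e) ≪≫ D.pullComp p f

/-- Restriction along `p` of a morphism `f^* F ⊗ g^* G ⟶ h^* K`. -/
def pullMul {P A B₁ B₂ B₃ : Grpd.{u, u}} (p : P ⥤ A) {f : A ⥤ B₁} {g : A ⥤ B₂} {h : A ⥤ B₃}
    {f' : P ⥤ B₁} {g' : P ⥤ B₂} {h' : P ⥤ B₃}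
    (ef : f' = p ⋙ f) (eg : g' = p ⋙ g) (eh : h' = p ⋙ h)
    {F : D.obj B₁} {G : D.obj B₂} {K : D.obj B₃}
    (m : (D.pull f).obj F ⊗ (D.pull g).obj G ⟶ (D.pull h).obj K) :
    (D.pull f').obj F ⊗ (D.pull g').obj G ⟶ (D.pull h').obj K :=
  ((D.pullFac p f ef).hom.app F ⊗ₘ (D.pullFac p g eg).hom.app G) ≫
    Functor.LaxMonoidal.μ (D.pull p) _ _ ≫ (D.pull p).map m ≫ (D.pullFac p h eh).inv.app K

/-- Restriction along `p` of a morphism `𝟙 ⟶ s^* U`. -/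
def pullUnit {P A B : Grpd.{u, u}} (p : P ⥤ A) {s : A ⥤ B} {s' : P ⥤ B} (e : s' = p ⋙ s)
    {U : D.obj B} (t : 𝟙_ (D.obj A) ⟶ (D.pull s).obj U) :
    𝟙_ (D.obj P) ⟶ (D.pull s').obj U :=
  Functor.LaxMonoidal.ε (D.pull p) ≫ (D.pull p).map t ≫ (D.pullFac p s e).inv.app U

/-- Base change of `η : M ⟶ f^* N` along a square: the composite
`p^* M ⟶ p^* f^* N ≅ q^* g^* N`. -/
def baseChange {P A B C : Grpd.{u, u}} (p : P ⥤ A) (q : P ⥤ C) (f : A ⥤ B) (g : C ⥤ B)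
    (α : p ⋙ f ≅ q ⋙ g) {M : D.obj A} {N : D.obj B} (η : M ⟶ (D.pull f).obj N) :
    (D.pull p).obj M ⟶ (D.pull q).obj ((D.pull g).obj N) :=
  (D.pull p).map η ≫ (D.pullComp p f).inv.app N ≫ (D.pull₂ α.hom).app N ≫
    (D.pullComp q g).hom.app N

/-- The external tensor product `M ⊠ N` on `A × B`. -/
def extTensor {A B : Grpd.{u, u}} (M : D.obj A) (N : D.obj B) : D.obj (Grpd.of (A × B)) :=
  (D.pull (A := Grpd.of (A × B)) (CategoryTheory.Prod.fst A B)).obj M ⊗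
    (D.pull (A := Grpd.of (A × B)) (CategoryTheory.Prod.snd A B)).obj N

/-- The functor `f × g` of groupoids. -/
def prodMap {A B A' B' : Grpd.{u, u}} (f : A ⥤ A') (g : B ⥤ B') :
    Grpd.of (A × B) ⥤ Grpd.of (A' × B') :=
  Functor.prod f g

/-- The morphism `M ⊠ N ⟶ (f × g)^* (M' ⊠ N')` induced by `M ⟶ f^* M'` and `N ⟶ g^* N'`. -/
def extMap {A B A' B' : Grpd.{u, u}} (f : A ⥤ A') (g : B ⥤ B')
    {M : D.obj A} {N : D.obj B} {M' : D.obj A'} {N' : D.obj B'}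
    (η : M ⟶ (D.pull f).obj M') (θ : N ⟶ (D.pull g).obj N') :
    D.extTensor M N ⟶ (D.pull (prodMap f g)).obj (D.extTensor M' N') :=
  (D.baseChange (P := Grpd.of (A × B)) (C := Grpd.of (A' × B')) (CategoryTheory.Prod.fst A B)
      (prodMap f g) f (CategoryTheory.Prod.fst A' B') (Iso.refl _) η ⊗ₘ
    D.baseChange (P := Grpd.of (A × B)) (C := Grpd.of (A' × B')) (CategoryTheory.Prod.snd A B)
      (prodMap f g) g (CategoryTheory.Prod.snd A' B') (Iso.refl _) θ) ≫
    Functor.LaxMonoidal.μ (D.pull (prodMap f g)) _ _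

/-- `D` is a componentwise cocontinuous left monoidal derivator: left Kan extensions along all
functors of groupoids exist, they satisfy base change (Beck--Chevalley) for all 2-pullback squares,
and the external tensor product preserves them in each variable. (The derivator axioms about
coproducts and about detecting isomorphisms on objects are not needed and not imposed.) -/
structure IsCocontinuousLeftDerivator : Prop where
  exists_lan {A B : Grpd.{u, u}} (f : A ⥤ B) (M : D.obj A) :
    ∃ (N : D.obj B) (η : M ⟶ (D.pull f).obj N), D.IsLan f η
  isLan_baseChange {P A B C : Grpd.{u, u}} (p : P ⥤ A) (q : P ⥤ C) (f : A ⥤ B) (g : C ⥤ B)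
    (α : p ⋙ f ≅ q ⋙ g) (h : IsTwoPullback p q f g α) {M : D.obj A} {N : D.obj B}
    (η : M ⟶ (D.pull f).obj N) (hη : D.IsLan f η) : D.IsLan q (D.baseChange p q f g α η)
  isLan_ext_left {A A' B : Grpd.{u, u}} (f : A ⥤ A') {M : D.obj A} {M' : D.obj A'}
    (η : M ⟶ (D.pull f).obj M') (hη : D.IsLan f η) (N : D.obj B) :
    D.IsLan (prodMap f (𝟭 B)) (D.extMap f (𝟭 B) η ((D.pullId B).inv.app N))
  isLan_ext_right {A B B' : Grpd.{u, u}} (g : B ⥤ B') {N : D.obj B} {N' : D.obj B'}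
    (θ : N ⟶ (D.pull g).obj N') (hθ : D.IsLan g θ) (M : D.obj A) :
    D.IsLan (prodMap (𝟭 A) g) (D.extMap (𝟭 A) g ((D.pullId A).inv.app M) θ)

end

/-- The monoidal prederivator `A ↦ [A, V]` represented by a monoidal category `V`, with the
pointwise tensor product on `[A, V]` and restriction given by precomposition. -/
def functors (V : Type w') [Category.{z'} V] [MonoidalCategory V] :
    MonoidalPrederivator.{max u z' w', max u z', u} where
  obj A := A ⥤ V
  pull f := (Functor.whiskeringLeft _ _ V).obj f
  pull₂ a := (Functor.whiskeringLeft _ _ V).map a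
  pullId A := Iso.refl _
  pullComp f g := Iso.refl _
  pull₂_isMonoidal a := { unit := by ext; simp, tensor := fun F G => by ext; simp }
  pullId_isMonoidal A := { unit := by ext; simp, tensor := fun F G => by ext; simp }
  pullComp_isMonoidal f g := { unit := by ext; simp, tensor := fun F G => by ext; simp }
  pull₂_id f := by simp
  pull₂_comp a b := by simp
  pull₂_whiskerLeft f _ _ a := by ext; simp
  pull₂_whiskerRight a g := by ext; simp
  pull_assoc f g h M := by ext; simp
  pull_leftUnitor f M := by ext; simp
  pull_rightUnitor f M := by ext; simp

end MonoidalPrederivator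

/-! ### 2-Segal simplicial groupoids and 2-Segal morphisms -/

section Segal

variable (X : SimplicialObject Grpd.{u, u})

/-- The functor `X_n ⥤ X_m` of groupoids induced by `[m] ⟶ [n]`. -/
def simplicialMap {m n : ℕ} (f : ⦋m⦌ ⟶ ⦋n⦌) : X _⦋n⦌ ⥤ X _⦋m⦌ := X.map f.op

/-- Restriction `X_n ⥤ X_1` to the edge `{i, j}`. -/
def edge {n : ℕ} (i j : Fin (n + 1)) (h : i ≤ j) : X _⦋n⦌ ⥤ X _⦋1⦌ :=
  simplicialMap X (SimplexCategory.mkOfLe i j h)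

/-- Restriction `X_n ⥤ X_2` to the triangle `{i, j, k}`. -/
def triangle {n : ℕ} (i j k : Fin (n + 1)) (hij : i ≤ j) (hjk : j ≤ k) : X _⦋n⦌ ⥤ X _⦋2⦌ :=
  simplicialMap X (SimplexCategory.mkOfLeComp i j k hij hjk)

/-- Restriction `X_n ⥤ X_0` to the vertex `i`. -/
def vertex {n : ℕ} (i : Fin (n + 1)) : X _⦋n⦌ ⥤ X _⦋0⦌ :=
  simplicialMap X (SimplexCategory.const ⦋0⦌ ⦋n⦌ i)

/-- The map `[a + 1 + c] ⟶ [a + b + c]` onto `{0, …, a} ∪ {a + b, …, a + b + c}`; for `b = 0` it is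
the degeneracy which takes the value `a` twice. -/
def outer (a b c : ℕ) : ⦋a + 1 + c⦌ ⟶ ⦋a + b + c⦌ :=
  SimplexCategory.mkHom
    { toFun := fun k => ⟨if k.val ≤ a then k.val else k.val + b - 1, by
        have := k.isLt
        split_ifs <;> omega⟩
      monotone' := fun k l h => by
        have h' : k.val ≤ l.val := h
        change (if k.val ≤ a then k.val else k.val + b - 1) ≤
          (if l.val ≤ a then l.val else l.val + b - 1)
        split_ifs <;> omega }

/-- The inclusion `[b] ⟶ [a + b + c]` onto `{a, …, a + b}`. -/
def inner (a b c : ℕ) : ⦋b⦌ ⟶ ⦋a + b + c⦌ :=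
  SimplexCategory.mkHom
    { toFun := fun k => ⟨a + k.val, by
        have := k.isLt
        omega⟩
      monotone' := fun k l h => by
        have h' : k.val ≤ l.val := h
        change a + k.val ≤ a + l.val
        omega }

/-- The inclusion `[a] ⟶ [a + c]` onto `{0, …, a}`. -/
def initialPart (a c : ℕ) : ⦋a⦌ ⟶ ⦋a + c⦌ :=
  SimplexCategory.mkHom
    { toFun := fun k => ⟨k.val, by
        have := k.isLt
        omega⟩
      monotone' := fun k l h => h }

/-- The inclusion `[c] ⟶ [a + c]` onto `{a, …, a + c}`. -/
def finalPart (a c : ℕ) : ⦋c⦌ ⟶ ⦋a + c⦌ :=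
  SimplexCategory.mkHom
    { toFun := fun k => ⟨a + k.val, by
        have := k.isLt
        omega⟩
      monotone' := fun k l h => by
        have h' : k.val ≤ l.val := h
        change a + k.val ≤ a + l.val
        omega }

lemma simplicialMap_comp {l m n : ℕ} (f : ⦋l⦌ ⟶ ⦋m⦌) (g : ⦋m⦌ ⟶ ⦋n⦌) :
    simplicialMap X (f ≫ g) = simplicialMap X g ⋙ simplicialMap X f :=
  X.map_comp g.op f.op

lemma simplicialMap_eq {l m n : ℕ} {f : ⦋l⦌ ⟶ ⦋m⦌} {g : ⦋m⦌ ⟶ ⦋n⦌} {h : ⦋l⦌ ⟶ ⦋n⦌}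
    (w : h = f ≫ g) : simplicialMap X h = simplicialMap X g ⋙ simplicialMap X f := by
  rw [w, simplicialMap_comp]

lemma triangle_edge₀₁ {n : ℕ} (i j k : Fin (n + 1)) (hij : i ≤ j) (hjk : j ≤ k) :
    edge X i j hij = triangle X i j k hij hjk ⋙ edge X 0 1 (by decide) :=
  simplicialMap_eq X (SimplexCategory.Hom.ext_one_left _ _)

lemma triangle_edge₁₂ {n : ℕ} (i j k : Fin (n + 1)) (hij : i ≤ j) (hjk : j ≤ k) :
    edge X j k hjk = triangle X i j k hij hjk ⋙ edge X 1 2 (by decide) :=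
  simplicialMap_eq X (SimplexCategory.Hom.ext_one_left _ _)

lemma triangle_edge₀₂ {n : ℕ} (i j k : Fin (n + 1)) (hij : i ≤ j) (hjk : j ≤ k) :
    edge X i k (hij.trans hjk) = triangle X i j k hij hjk ⋙ edge X 0 2 (by decide) :=
  simplicialMap_eq X (SimplexCategory.Hom.ext_one_left _ _)

lemma edge_vertex₀ {n : ℕ} (i j : Fin (n + 1)) (h : i ≤ j) :
    vertex X i = edge X i j h ⋙ vertex X 0 :=
  simplicialMap_eq X (by ext k; fin_cases k; rfl)

lemma edge_vertex₁ {n : ℕ} (i j : Fin (n + 1)) (h : i ≤ j) :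
    vertex X j = edge X i j h ⋙ vertex X 1 :=
  simplicialMap_eq X (by ext k; fin_cases k; rfl)

lemma vertex_degenerate {n : ℕ} (i : Fin (n + 1)) :
    edge X i i le_rfl = vertex X i ⋙ edge X (n := 0) 0 0 le_rfl :=
  simplicialMap_eq X (SimplexCategory.Hom.ext_one_left _ _)

lemma outer_edge_le (a c : ℕ) :
    (⟨a, by omega⟩ : Fin (a + 1 + c + 1)) ≤ ⟨a + 1, by omega⟩ :=
  Nat.le_succ a

lemma segal_comm (a b c : ℕ) :
    simplicialMap X (outer a b c) ⋙ edge X _ _ (outer_edge_le a c) =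
      simplicialMap X (inner a b c) ⋙ edge X 0 (Fin.last b) (Fin.zero_le _) := by
  unfold edge
  rw [← simplicialMap_comp, ← simplicialMap_comp]
  congr 1
  refine SimplexCategory.Hom.ext_one_left _ _ ?_ ?_
  · apply Fin.ext
    change (if a ≤ a then a else a + b - 1) = a + 0
    simp
  · apply Fin.ext
    change (if a + 1 ≤ a then a + 1 else a + 1 + b - 1) = a + b
    split_ifs <;> omega

lemma pathSegal_comm (a c : ℕ) :
    simplicialMap X (initialPart a c) ⋙ vertex X (Fin.last a) =
      simplicialMap X (finalPart a c) ⋙ vertex X 0 := by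
  unfold vertex
  rw [← simplicialMap_comp, ← simplicialMap_comp]
  congr 1

/-- `X` is a (unital) 2-Segal simplicial groupoid. For `b ≥ 1` the square says that the polygon
`{0, …, n}`, `n = a + b + c`, is cut along its diagonal `{a, a + b}`:
`X_n ≃ X_{0, …, a, a + b, …, n} ×_{X_{a, a + b}} X_{a, …, a + b}`.
For `b = 0` it is unitality: `X_n ≃ X_{n + 1} ×_{X_1} X_0`, where `X_n ⥤ X_{n + 1}` is the `a`-th
degeneracy and `X_{n + 1} ⥤ X_1` is the edge `{a, a + 1}`. -/
def IsTwoSegal : Prop :=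
  ∀ a b c : ℕ, IsTwoPullback
    (simplicialMap X (outer a b c)) (simplicialMap X (inner a b c))
    (edge X _ _ (outer_edge_le a c)) (edge X 0 (Fin.last b) (Fin.zero_le _))
    (eqToIso (segal_comm X a b c))

end Segal

section Morphism

variable {X Y : SimplicialObject Grpd.{u, u}} (Φ : Y ⟶ X)

/-- The functor `Y_n ⥤ X_n`. -/
def component (n : ℕ) : Y _⦋n⦌ ⥤ X _⦋n⦌ := Φ.app (op ⦋n⦌)

lemma component_naturality {m n : ℕ} (f : ⦋m⦌ ⟶ ⦋n⦌) :
    simplicialMap Y f ⋙ component Φ m = component Φ n ⋙ simplicialMap X f :=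
  Φ.naturality f.op

lemma relative_comm (a b c : ℕ) :
    simplicialMap Y (outer a b c) ⋙ component Φ _ ⋙ edge X _ _ (outer_edge_le a c) =
      (component Φ _ ⋙ simplicialMap X (inner a b c)) ⋙
        edge X 0 (Fin.last b) (Fin.zero_le _) := by
  rw [← Functor.assoc, component_naturality, Functor.assoc, Functor.assoc, segal_comm]

/-- The morphism `Φ : Y ⟶ X` is 2-Segal: the relative simplicial groupoid `Φ^≥` with values `X_n` on
`{0 < … < n}` and `Y_n` on `{0 < … < n < +∞}` (the restriction from the latter to the former being
`Φ`) satisfies the (unital) 2-Segal conditions. These are the conditions for the polygons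
`{0, …, n}`, and, for the polygons `{0, …, n, +∞}`, the ones for the diagonals `{a, a + b}` and for
the diagonals `{a, +∞}`. With `Y_n` placed on `{-∞ < 0 < … < n}` instead, one obtains the relative
simplicial groupoid `Φ^≤`, whose 2-Segal conditions are the same. -/
structure IsTwoSegalMorphism : Prop where
  base : IsTwoSegal X
  /-- `Y_n ≃ Y_{0, …, a, a + b, …, n} ×_{X_{a, a + b}} X_{a, …, a + b}` with `n = a + b + c`; for
  `b = 0` this is unitality `Y_n ≃ Y_{n + 1} ×_{X_1} X_0`. -/
  relative (a b c : ℕ) : IsTwoPullback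
    (simplicialMap Y (outer a b c)) (component Φ _ ⋙ simplicialMap X (inner a b c))
    (component Φ _ ⋙ edge X _ _ (outer_edge_le a c)) (edge X 0 (Fin.last b) (Fin.zero_le _))
    (eqToIso (relative_comm Φ a b c))
  /-- `Y_{a + c} ≃ Y_{0, …, a} ×_{Y_{a}} Y_{a, …, a + c}`. -/
  path (a c : ℕ) : IsTwoPullback
    (simplicialMap Y (initialPart a c)) (simplicialMap Y (finalPart a c))
    (vertex Y (Fin.last a)) (vertex Y 0)
    (eqToIso (pathSegal_comm Y a c))

end Morphism

/-! ### The Hall monoidal category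

The order of the factors in `F|_{12} ⊗ G|_{01}` is the one for which the relative simplicial groupoid
`Φ^≥`, with the additional vertex `+∞` on the right, yields a right module. -/

section Hall

variable (D : MonoidalPrederivator.{w, z, u}) (X : SimplicialObject Grpd.{u, u})

/-- The underlying category of the Hall monoidal category: the category of coefficient systems
on `X_1` (a type synonym, since that category already carries the pointwise tensor product). -/
def HallCat : Type w := D.obj (X _⦋1⦌)

instance : Category.{z} (HallCat D X) := inferInstanceAs (Category.{z} (D.obj (X _⦋1⦌)))

/-- Restriction `F ↦ F|_{ij}` along `X_n ⥤ X_1`, the edge `{i, j}`. -/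
def resEdge {n : ℕ} (i j : Fin (n + 1)) (h : i ≤ j) : HallCat D X ⥤ D.obj (X _⦋n⦌) :=
  D.pull (edge X i j h)

variable {D X}

/-- A multiplication map `F|_{12} ⊗ G|_{01} ⟶ K|_{02}` on `X_2` restricted along the triangle
`{i, j, k}` to a map `F|_{jk} ⊗ G|_{ij} ⟶ K|_{ik}` on `X_n`. -/
def resMul {F G K : HallCat D X}
    (m : (resEdge D X (n := 2) 1 2 (by decide)).obj F ⊗ (resEdge D X 0 1 (by decide)).obj G ⟶
      (resEdge D X 0 2 (by decide)).obj K)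
    {n : ℕ} (i j k : Fin (n + 1)) (hij : i ≤ j) (hjk : j ≤ k) :
    (resEdge D X j k hjk).obj F ⊗ (resEdge D X i j hij).obj G ⟶
      (resEdge D X i k (hij.trans hjk)).obj K :=
  D.pullMul (triangle X i j k hij hjk) (triangle_edge₁₂ X i j k hij hjk)
    (triangle_edge₀₁ X i j k hij hjk) (triangle_edge₀₂ X i j k hij hjk) m

/-- A unit map `𝟙 ⟶ U|_{00}` on `X_0` restricted along the vertex `i` to a map `𝟙 ⟶ U|_{ii}` on
`X_n`. -/
def resUnit {U : HallCat D X}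
    (t : 𝟙_ (D.obj (X _⦋0⦌)) ⟶ (resEdge D X (n := 0) 0 0 le_rfl).obj U)
    {n : ℕ} (i : Fin (n + 1)) :
    𝟙_ (D.obj (X _⦋n⦌)) ⟶ (resEdge D X i i le_rfl).obj U :=
  D.pullUnit (vertex X i) (vertex_degenerate X i) t

variable (D X)

/-- The data and properties which express that a monoidal structure on `HallCat D X` is the Hall
monoidal structure: `F ⊗ G` is the left Kan extension along the edge `{0, 2}` of the pointwise
tensor product `F|_{12} ⊗ G|_{01}` on `X_2`, the unit is the left Kan extension along the degeneracy
`X_0 ⥤ X_1` of the pointwise unit, and tensor products of morphisms, the associator (on `X_3`)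
and the unitors (on `X_1`) are the ones induced by those of the pointwise tensor product. -/
structure HallStructure [MonoidalCategory (HallCat D X)] where
  mul (F G : HallCat D X) :
    (resEdge D X (n := 2) 1 2 (by decide)).obj F ⊗ (resEdge D X 0 1 (by decide)).obj G ⟶
      (resEdge D X 0 2 (by decide)).obj (F ⊗ G)
  mul_isLan (F G : HallCat D X) : D.IsLan (edge X 0 2 (by decide)) (mul F G)
  unit : 𝟙_ (D.obj (X _⦋0⦌)) ⟶ (resEdge D X (n := 0) 0 0 le_rfl).obj (𝟙_ (HallCat D X))
  unit_isLan : D.IsLan (edge X (n := 0) 0 0 le_rfl) unit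
  mul_naturality {F F' G G' : HallCat D X} (f : F ⟶ F') (g : G ⟶ G') :
    ((resEdge D X (n := 2) 1 2 (by decide)).map f ⊗ₘ (resEdge D X 0 1 (by decide)).map g) ≫
        mul F' G' =
      mul F G ≫ (resEdge D X 0 2 (by decide)).map (f ⊗ₘ g)
  mul_assoc (F G H : HallCat D X) :
    (resMul (mul F G) (n := 3) 1 2 3 (by decide) (by decide) ▷
          (resEdge D X 0 1 (by decide)).obj H) ≫
        resMul (mul (F ⊗ G) H) 0 1 3 (by decide) (by decide) ≫
          (resEdge D X 0 3 (by decide)).map (α_ F G H).hom =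
      (α_ _ _ _).hom ≫
        ((resEdge D X 2 3 (by decide)).obj F ◁
          resMul (mul G H) (n := 3) 0 1 2 (by decide) (by decide)) ≫
          resMul (mul F (G ⊗ H)) 0 2 3 (by decide) (by decide)
  unit_mul (F : HallCat D X) :
    (resUnit unit (n := 1) 1 ▷ (resEdge D X 0 1 (by decide)).obj F) ≫
        resMul (mul (𝟙_ _) F) 0 1 1 (by decide) (by decide) ≫
          (resEdge D X 0 1 (by decide)).map (λ_ F).hom =
      (λ_ _).hom
  mul_unit (F : HallCat D X) :
    ((resEdge D X 0 1 (by decide)).obj F ◁ resUnit unit (n := 1) 0) ≫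
        resMul (mul F (𝟙_ _)) 0 0 1 (by decide) (by decide) ≫
          (resEdge D X 0 1 (by decide)).map (ρ_ F).hom =
      (ρ_ _).hom

end Hall

/-! ### Hall modules -/

section Modules

variable (D : MonoidalPrederivator.{w, z, u}) {X Y : SimplicialObject Grpd.{u, u}} (Φ : Y ⟶ X)

lemma component_edge {n : ℕ} (i j : Fin (n + 1)) (h : i ≤ j) :
    component Φ n ⋙ edge X i j h = edge Y i j h ⋙ component Φ 1 :=
  (component_naturality Φ _).symm

lemma edge_edge {n : ℕ} (i j : Fin (n + 1)) (h : i ≤ j) :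
    edge X i j h = edge X i j h ⋙ edge X 0 1 (by decide) :=
  simplicialMap_eq X (SimplexCategory.Hom.ext_one_left _ _)

lemma component_edge_fac {n : ℕ} (i j : Fin (n + 1)) (h : i ≤ j) :
    component Φ n ⋙ edge X i j h =
      edge Y i j h ⋙ component Φ 1 ⋙ edge X 0 1 (by decide) := by
  rw [← Functor.assoc, ← component_edge, Functor.assoc, ← edge_edge]

/-- Restriction `F ↦ F|_{ij}` along `Y_n ⥤ X_n ⥤ X_1`, the edge `{i, j}`. -/
def relEdge {n : ℕ} (i j : Fin (n + 1)) (h : i ≤ j) : HallCat D X ⥤ D.obj (Y _⦋n⦌) :=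
  D.pull (component Φ n ⋙ edge X i j h)

variable (Y) in
/-- Restriction `M ↦ M|_i` along `Y_n ⥤ Y_0`, the vertex `i`. In terms of `Φ^≥` this is the edge
`{i, +∞}`, in terms of `Φ^≤` the edge `{-∞, i}`. -/
def relVertex {n : ℕ} (i : Fin (n + 1)) : D.obj (Y _⦋0⦌) ⥤ D.obj (Y _⦋n⦌) :=
  D.pull (vertex Y i)

variable {D}

/-- A multiplication map on `X_2` restricted along `Y_n ⥤ X_n ⥤ X_2`, the triangle `{i, j, k}`. -/
def relMul {F G K : HallCat D X}
    (m : (resEdge D X (n := 2) 1 2 (by decide)).obj F ⊗ (resEdge D X 0 1 (by decide)).obj G ⟶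
      (resEdge D X 0 2 (by decide)).obj K)
    {n : ℕ} (i j k : Fin (n + 1)) (hij : i ≤ j) (hjk : j ≤ k) :
    (relEdge D Φ j k hjk).obj F ⊗ (relEdge D Φ i j hij).obj G ⟶
      (relEdge D Φ i k (hij.trans hjk)).obj K :=
  D.pullMul (component Φ n ⋙ triangle X i j k hij hjk)
    (congrArg (component Φ n ⋙ ·) (triangle_edge₁₂ X i j k hij hjk))
    (congrArg (component Φ n ⋙ ·) (triangle_edge₀₁ X i j k hij hjk))
    (congrArg (component Φ n ⋙ ·) (triangle_edge₀₂ X i j k hij hjk)) m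

/-- A unit map on `X_0` restricted along `Y_n ⥤ X_n ⥤ X_0`, the vertex `i`. -/
def relUnit {U : HallCat D X}
    (t : 𝟙_ (D.obj (X _⦋0⦌)) ⟶ (resEdge D X (n := 0) 0 0 le_rfl).obj U)
    {n : ℕ} (i : Fin (n + 1)) :
    𝟙_ (D.obj (Y _⦋n⦌)) ⟶ (relEdge D Φ i i le_rfl).obj U :=
  D.pullUnit (component Φ n ⋙ vertex X i)
    (congrArg (component Φ n ⋙ ·) (vertex_degenerate X i)) t

/-- A map `M|_1 ⊗ F|_{01} ⟶ N|_0` on `Y_1` restricted along the edge `{i, j}` to a map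
`M|_j ⊗ F|_{ij} ⟶ N|_i` on `Y_n`. -/
def resRightAct {M N : D.obj (Y _⦋0⦌)} {F : HallCat D X}
    (m : (relVertex D Y (n := 1) 1).obj M ⊗ (relEdge D Φ 0 1 (by decide)).obj F ⟶
      (relVertex D Y 0).obj N)
    {n : ℕ} (i j : Fin (n + 1)) (hij : i ≤ j) :
    (relVertex D Y j).obj M ⊗ (relEdge D Φ i j hij).obj F ⟶ (relVertex D Y i).obj N :=
  D.pullMul (edge Y i j hij) (edge_vertex₁ Y i j hij) (component_edge_fac Φ i j hij)
    (edge_vertex₀ Y i j hij) m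

/-- A map `F|_{01} ⊗ M|_0 ⟶ N|_1` on `Y_1` restricted along the edge `{i, j}` to a map
`F|_{ij} ⊗ M|_i ⟶ N|_j` on `Y_n`. -/
def resLeftAct {M N : D.obj (Y _⦋0⦌)} {F : HallCat D X}
    (m : (relEdge D Φ (n := 1) 0 1 (by decide)).obj F ⊗ (relVertex D Y 0).obj M ⟶
      (relVertex D Y 1).obj N)
    {n : ℕ} (i j : Fin (n + 1)) (hij : i ≤ j) :
    (relEdge D Φ i j hij).obj F ⊗ (relVertex D Y i).obj M ⟶ (relVertex D Y j).obj N :=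
  D.pullMul (edge Y i j hij) (component_edge_fac Φ i j hij) (edge_vertex₀ Y i j hij)
    (edge_vertex₁ Y i j hij) m

open scoped MonoidalRightAction MonoidalLeftAction

variable [MonoidalCategory (HallCat D X)] (H : HallStructure D X)

/-- The data and properties which express that a right action of the Hall monoidal category on the
category of coefficient systems on `Y_0` is the right Hall module of `Φ^≥`: `M ⊙ᵣ F` is the left Kan
extension along `{0, +∞}` of `M|_{1,+∞} ⊗ F|_{01}` on `Y_1` (the value of `Φ^≥` at `{0, 1, +∞}`),
and the action on morphisms, the associativity isomorphism (on `Y_2`) and the unit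
isomorphism (on `Y_0`) are the ones induced by the pointwise tensor product. -/
structure HallRightModule [MonoidalRightAction (HallCat D X) (D.obj (Y _⦋0⦌))] where
  act (M : D.obj (Y _⦋0⦌)) (F : HallCat D X) :
    (relVertex D Y (n := 1) 1).obj M ⊗ (relEdge D Φ 0 1 (by decide)).obj F ⟶
      (relVertex D Y 0).obj (M ⊙ᵣ F)
  act_isLan (M : D.obj (Y _⦋0⦌)) (F : HallCat D X) :
    D.IsLan (vertex Y (n := 1) 0) (act M F)
  act_naturality {M M' : D.obj (Y _⦋0⦌)} {F F' : HallCat D X} (f : M ⟶ M') (g : F ⟶ F') :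
    ((relVertex D Y (n := 1) 1).map f ⊗ₘ (relEdge D Φ 0 1 (by decide)).map g) ≫ act M' F' =
      act M F ≫ (relVertex D Y 0).map (f ⊙ᵣₘ g)
  act_assoc (M : D.obj (Y _⦋0⦌)) (F G : HallCat D X) :
    ((relVertex D Y (n := 2) 2).obj M ◁
          relMul Φ (H.mul F G) 0 1 2 (by decide) (by decide)) ≫
        resRightAct Φ (act M (F ⊗ G)) 0 2 (by decide) ≫
          (relVertex D Y 0).map (αᵣ M F G).hom =
      (α_ _ _ _).inv ≫
        (resRightAct Φ (act M F) (n := 2) 1 2 (by decide) ▷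
          (relEdge D Φ 0 1 (by decide)).obj G) ≫
          resRightAct Φ (act (M ⊙ᵣ F) G) 0 1 (by decide)
  act_unit (M : D.obj (Y _⦋0⦌)) :
    ((relVertex D Y (n := 0) 0).obj M ◁ relUnit Φ H.unit 0) ≫
        resRightAct Φ (act M (𝟙_ (HallCat D X))) 0 0 le_rfl ≫
          (relVertex D Y 0).map (MonoidalRightActionStruct.actionUnitIso M).hom =
      (ρ_ _).hom

/-- The data and properties which express that a left action of the Hall monoidal category on the
category of coefficient systems on `Y_0` is the left Hall module of `Φ^≤`: `F ⊙ₗ M` is the left Kan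
extension along `{-∞, 1}` of `F|_{01} ⊗ M|_{-∞,0}` on `Y_1` (the value of `Φ^≤` at `{-∞, 0, 1}`),
and the action on morphisms, the associativity isomorphism (on `Y_2`) and the unit
isomorphism (on `Y_0`) are the ones induced by the pointwise tensor product. -/
structure HallLeftModule [MonoidalLeftAction (HallCat D X) (D.obj (Y _⦋0⦌))] where
  act (F : HallCat D X) (M : D.obj (Y _⦋0⦌)) :
    (relEdge D Φ (n := 1) 0 1 (by decide)).obj F ⊗ (relVertex D Y 0).obj M ⟶
      (relVertex D Y 1).obj (F ⊙ₗ M)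
  act_isLan (F : HallCat D X) (M : D.obj (Y _⦋0⦌)) :
    D.IsLan (vertex Y (n := 1) 1) (act F M)
  act_naturality {F F' : HallCat D X} {M M' : D.obj (Y _⦋0⦌)} (f : F ⟶ F') (g : M ⟶ M') :
    ((relEdge D Φ (n := 1) 0 1 (by decide)).map f ⊗ₘ (relVertex D Y 0).map g) ≫ act F' M' =
      act F M ≫ (relVertex D Y 1).map (f ⊙ₗₘ g)
  act_assoc (F G : HallCat D X) (M : D.obj (Y _⦋0⦌)) :
    (relMul Φ (H.mul F G) (n := 2) 0 1 2 (by decide) (by decide) ▷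
          (relVertex D Y 0).obj M) ≫
        resLeftAct Φ (act (F ⊗ G) M) 0 2 (by decide) ≫
          (relVertex D Y 2).map (αₗ F G M).hom =
      (α_ _ _ _).hom ≫
        ((relEdge D Φ 1 2 (by decide)).obj F ◁
          resLeftAct Φ (act G M) (n := 2) 0 1 (by decide)) ≫
          resLeftAct Φ (act F (G ⊙ₗ M)) 1 2 (by decide)
  unit_act (M : D.obj (Y _⦋0⦌)) :
    (relUnit Φ H.unit (n := 0) 0 ▷ (relVertex D Y 0).obj M) ≫
        resLeftAct Φ (act (𝟙_ (HallCat D X)) M) 0 0 le_rfl ≫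
          (relVertex D Y 0).map (MonoidalLeftActionStruct.actionUnitIso (C := HallCat D X) M).hom =
      (λ_ _).hom

end Modules

/-!
The Hall tensor product multiplies the restrictions of two coefficient systems to `X_2` and takes a
left Kan extension along `X_2 ⥤ X_1`; both actions have the same shape. Everything is expressed by
the universal *multiplication maps* `f^* F ⊗ g^* G ⟶ h^* K` that accompany these Kan extensions.

*Existence of the associator and unitors.* In a triple product the inner Kan extension can be pulled
out of the outer one. Base change along a 2-pullback square moves it from an edge of `X_2` to an
edge of `X_3`, and the projection formulas `IsLan.whiskerRight` and `IsLan.whiskerLeft` move it past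
the remaining tensor factor. The projection formulas hold because `M ⊗ q^* L` is the restriction of
the external product of `M` and `L` along the graph of `q`, and the graph of `q` is a 2-pullback of
the diagonal. Hence both bracketings of a triple product are left Kan extensions, along the same
edge, of the same pointwise product of three factors (`IsLan.mul_whiskerRight_comp`,
`IsLan.mul_whiskerLeft_comp`), so that they are canonically isomorphic. The squares needed are those
which cut a quadrilateral along either of its diagonals, and this is where the 2-Segal condition
enters; for the modules they are the path squares and the relative squares of `Φ`. In the same way,
unitality produces the unitors.

*Coherence.* The structure isomorphisms are characterized by equations between multiplication maps
on `X_3` and `X_1`. Such equations restrict to all simplices (`pullMul_associativity`,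
`resMul_associativity`, `relMul_associativity`). An axiom such as the pentagon is an equality of
morphisms out of an iterated product, and may be checked after composition with the universal
multiplication map of that product, a left Kan extension from `X_4` (from `Y_3` for the modules).
There it follows formally, from the restricted equations and the pentagon for the pointwise tensor
product (`pentagon_of_mul`). The other axioms are treated alike.

*Functors to a monoidal category.* If `V` is cocomplete, left Kan extensions of functors to `V` are
pointwise. A 2-pullback square of groupoids induces equivalences between the comma categories over
which these are computed (`IsTwoPullback.guitartExact`), which gives base change. Left Kan extension
of an external product can be checked on the fibres of a projection, where the product becomes
composition with `- ⊗ v` or `v ⊗ -`; these functors are cocontinuous, so they preserve pointwise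
Kan extensions.
-/

/-! ### Lax monoidal functors -/

section LaxMonoidal

open Functor.LaxMonoidal

variable {C C' : Type*} [Category* C] [MonoidalCategory C] [Category* C'] [MonoidalCategory C']
  (F : C ⥤ C') [F.LaxMonoidal]

/-- The associativity of the lax structure of `F`, composed with morphisms to objects in the image
of `F`. -/
lemma lax_associativity {X Y Z : C} {X' Y' Z' : C'} (x : X' ⟶ F.obj X) (y : Y' ⟶ F.obj Y)
    (z : Z' ⟶ F.obj Z) :
    (((x ⊗ₘ y) ≫ μ F X Y) ▷ Z') ≫ (F.obj (X ⊗ Y) ◁ z) ≫ μ F (X ⊗ Y) Z ≫ F.map (α_ X Y Z).hom =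
      (α_ X' Y' Z').hom ≫ (X' ◁ ((y ⊗ₘ z) ≫ μ F Y Z)) ≫ (x ▷ F.obj (Y ⊗ Z)) ≫
        μ F X (Y ⊗ Z) := by
  have h : (((x ⊗ₘ y) ≫ μ F X Y) ▷ Z') ≫ (F.obj (X ⊗ Y) ◁ z) =
      ((x ⊗ₘ y) ⊗ₘ z) ≫ (μ F X Y ▷ F.obj Z) := by
    rw [comp_whiskerRight, Category.assoc, ← whisker_exchange,
      MonoidalCategory.tensorHom_def (x ⊗ₘ y) z, Category.assoc]
  have h' : (X' ◁ ((y ⊗ₘ z) ≫ μ F Y Z)) ≫ (x ▷ F.obj (Y ⊗ Z)) =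
      (x ⊗ₘ (y ⊗ₘ z)) ≫ (F.obj X ◁ μ F Y Z) := by
    rw [MonoidalCategory.whiskerLeft_comp, Category.assoc, whisker_exchange,
      MonoidalCategory.tensorHom_def' x (y ⊗ₘ z), Category.assoc]
  rw [reassoc_of% h, reassoc_of% h', associativity, associator_naturality_assoc]

lemma lax_left_unitality {X : C} {X' : C'} (x : X' ⟶ F.obj X) :
    (ε F ▷ X') ≫ (F.obj (𝟙_ C) ◁ x) ≫ μ F (𝟙_ C) X ≫ F.map (λ_ X).hom =
      (λ_ X').hom ≫ x := by
  rw [← whisker_exchange_assoc, ← left_unitality, leftUnitor_naturality]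

lemma lax_right_unitality {X : C} {X' : C'} (x : X' ⟶ F.obj X) :
    (X' ◁ ε F) ≫ (x ▷ F.obj (𝟙_ C)) ≫ μ F X (𝟙_ C) ≫ F.map (ρ_ X).hom =
      (ρ_ X').hom ≫ x := by
  rw [whisker_exchange_assoc, ← right_unitality, rightUnitor_naturality]

end LaxMonoidal

namespace MonoidalPrederivator

open Functor.LaxMonoidal

variable (D : MonoidalPrederivator.{w, z, u})

attribute [instance] pull₂_isMonoidal pullId_isMonoidal pullComp_isMonoidal

/-! ### Coherence of restriction -/

section Coherence

variable {A B C E : Grpd.{u, u}}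

/-- The axiom `pull_assoc` without its 2-cell: composition of functors is strictly associative, so
that the associator restricts to an identity. -/
lemma pullComp_assoc (f : A ⥤ B) (g : B ⥤ C) (h : C ⥤ E) (M : D.obj E) :
    (D.pullComp (f ⋙ g) h).hom.app M ≫ (D.pullComp f g).hom.app ((D.pull h).obj M) =
      (D.pullComp f (g ⋙ h)).hom.app M ≫ (D.pull f).map ((D.pullComp g h).hom.app M) := by
  rw [D.pull_assoc f g h M]
  have h1 : D.pull₂ (Functor.associator f g h).hom = 𝟙 _ := D.pull₂_id (f ⋙ g ⋙ h)
  rw [h1]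
  exact Category.id_comp _

lemma pullComp_assoc_inv (f : A ⥤ B) (g : B ⥤ C) (h : C ⥤ E) (M : D.obj E) :
    (D.pullComp f g).hom.app ((D.pull h).obj M) ≫
        (D.pull f).map ((D.pullComp g h).inv.app M) ≫ (D.pullComp f (g ⋙ h)).inv.app M =
      (D.pullComp (f ⋙ g) h).inv.app M := by
  rw [← cancel_epi ((D.pullComp (f ⋙ g) h).hom.app M), reassoc_of% D.pullComp_assoc,
    ← Functor.map_comp_assoc, Iso.hom_inv_id_app, Iso.hom_inv_id_app, CategoryTheory.Functor.map_id,
    Category.id_comp]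
  exact Iso.hom_inv_id_app _ _

lemma pullComp_id_left (f : A ⥤ B) (M : D.obj B) :
    (D.pullComp (𝟭 A) f).hom.app M ≫ (D.pullId A).hom.app ((D.pull f).obj M) = 𝟙 _ := by
  rw [D.pull_leftUnitor f M]
  have h1 : D.pull₂ f.leftUnitor.hom = 𝟙 _ := D.pull₂_id f
  rw [h1]
  rfl

lemma pullComp_id_right (f : A ⥤ B) (M : D.obj B) :
    (D.pullComp f (𝟭 B)).hom.app M ≫ (D.pull f).map ((D.pullId B).hom.app M) = 𝟙 _ := by
  rw [D.pull_rightUnitor f M]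
  have h1 : D.pull₂ f.rightUnitor.hom = 𝟙 _ := D.pull₂_id f
  rw [h1]
  rfl

lemma pullComp_naturality (f : A ⥤ B) (g : B ⥤ C) {M N : D.obj C} (x : M ⟶ N) :
    (D.pull (f ⋙ g)).map x ≫ (D.pullComp f g).hom.app N =
      (D.pullComp f g).hom.app M ≫ (D.pull f).map ((D.pull g).map x) :=
  (D.pullComp f g).hom.naturality x

lemma μ_pullComp (f : A ⥤ B) (g : B ⥤ C) (M N : D.obj C) :
    μ (D.pull (f ⋙ g)) M N ≫ (D.pullComp f g).hom.app (M ⊗ N) =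
      ((D.pullComp f g).hom.app M ⊗ₘ (D.pullComp f g).hom.app N) ≫
        μ (D.pull f) _ _ ≫ (D.pull f).map (μ (D.pull g) M N) := by
  rw [NatTrans.IsMonoidal.tensor (τ := (D.pullComp f g).hom), comp_μ]

lemma pull₂_eqToHom {f g : A ⥤ B} (e : f = g) :
    D.pull₂ (eqToHom e) = eqToHom (congrArg D.pull e) := by
  subst e
  exact D.pull₂_id f

@[simp]
lemma pullFac_rfl (f : A ⥤ B) (g : B ⥤ C) :
    D.pullFac f g rfl = D.pullComp f g := by
  simp [pullFac]

end Coherence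

/-! ### Restriction of multiplication maps -/

section Restriction

variable {P Q A B B₁ B₂ B₃ : Grpd.{u, u}}

/-- Restriction along `p` of a morphism `M ⟶ h^* N`. -/
def pullHom (p : P ⥤ A) {h : A ⥤ B} {s : P ⥤ B} (e : s = p ⋙ h) {M : D.obj A} {N : D.obj B}
    (x : M ⟶ (D.pull h).obj N) : (D.pull p).obj M ⟶ (D.pull s).obj N :=
  (D.pull p).map x ≫ (D.pullFac p h e).inv.app N

lemma pullMul_eq_pullHom (p : P ⥤ A) {f : A ⥤ B₁} {g : A ⥤ B₂} {h : A ⥤ B₃}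
    {f' : P ⥤ B₁} {g' : P ⥤ B₂} {h' : P ⥤ B₃}
    (ef : f' = p ⋙ f) (eg : g' = p ⋙ g) (eh : h' = p ⋙ h)
    {F : D.obj B₁} {G : D.obj B₂} {K : D.obj B₃}
    (m : (D.pull f).obj F ⊗ (D.pull g).obj G ⟶ (D.pull h).obj K) :
    D.pullMul p ef eg eh m =
      (((D.pullFac p f ef).hom.app F ⊗ₘ (D.pullFac p g eg).hom.app G) ≫
        μ (D.pull p) _ _) ≫ D.pullHom p eh m := by
  simp [pullMul, pullHom]

lemma pullUnit_eq_pullHom (p : P ⥤ A) {s : A ⥤ B} {s' : P ⥤ B} (e : s' = p ⋙ s)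
    {U : D.obj B} (t : 𝟙_ (D.obj A) ⟶ (D.pull s).obj U) :
    D.pullUnit p e t = ε (D.pull p) ≫ D.pullHom p e t := by
  simp [pullUnit, pullHom]

/-- Restriction is compatible with the composition of a multiplication map with a morphism to its
first factor. -/
lemma pullHom_whiskerRight_comp (p : P ⥤ A) {f : A ⥤ B₁} {g : A ⥤ B₂} {h : A ⥤ B₃}
    {f' : P ⥤ B₁} {g' : P ⥤ B₂} {h' : P ⥤ B₃}
    (ef : f' = p ⋙ f) (eg : g' = p ⋙ g) (eh : h' = p ⋙ h)
    {M : D.obj A} {F : D.obj B₁} {G : D.obj B₂} {K : D.obj B₃} (x : M ⟶ (D.pull f).obj F)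
    (m : (D.pull f).obj F ⊗ (D.pull g).obj G ⟶ (D.pull h).obj K) :
    (D.pullHom p ef x ▷ (D.pull g').obj G) ≫ D.pullMul p ef eg eh m =
      (((D.pull p).obj M ◁ (D.pullFac p g eg).hom.app G) ≫ μ (D.pull p) _ _) ≫
        D.pullHom p eh ((x ▷ (D.pull g).obj G) ≫ m) := by
  subst ef eg eh
  simp only [pullHom, pullMul, pullFac_rfl, Functor.map_comp, Category.assoc]
  rw [← μ_natural_left_assoc, whiskerRight_comp_tensorHom_assoc]
  simp [MonoidalCategory.tensorHom_def']

/-- Restriction is compatible with the composition of a multiplication map with a morphism to its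
second factor. -/
lemma pullHom_whiskerLeft_comp (p : P ⥤ A) {f : A ⥤ B₁} {g : A ⥤ B₂} {h : A ⥤ B₃}
    {f' : P ⥤ B₁} {g' : P ⥤ B₂} {h' : P ⥤ B₃}
    (ef : f' = p ⋙ f) (eg : g' = p ⋙ g) (eh : h' = p ⋙ h)
    {M : D.obj A} {F : D.obj B₁} {G : D.obj B₂} {K : D.obj B₃} (x : M ⟶ (D.pull g).obj G)
    (m : (D.pull f).obj F ⊗ (D.pull g).obj G ⟶ (D.pull h).obj K) :
    ((D.pull f').obj F ◁ D.pullHom p eg x) ≫ D.pullMul p ef eg eh m =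
      (((D.pullFac p f ef).hom.app F ▷ (D.pull p).obj M) ≫ μ (D.pull p) _ _) ≫
        D.pullHom p eh (((D.pull f).obj F ◁ x) ≫ m) := by
  subst ef eg eh
  simp only [pullHom, pullMul, pullFac_rfl, Functor.map_comp, Category.assoc]
  rw [← μ_natural_right_assoc, whiskerLeft_comp_tensorHom_assoc]
  simp [MonoidalCategory.tensorHom_def]

lemma pullHom_comp (p : P ⥤ A) {h : A ⥤ B} {s : P ⥤ B} (e : s = p ⋙ h) {L M : D.obj A}
    {N : D.obj B} (y : L ⟶ M) (x : M ⟶ (D.pull h).obj N) :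
    D.pullHom p e (y ≫ x) = (D.pull p).map y ≫ D.pullHom p e x := by
  simp [pullHom]

lemma pullHom_comp_map (p : P ⥤ A) {h : A ⥤ B} {s : P ⥤ B} (e : s = p ⋙ h) {M : D.obj A}
    {N K : D.obj B} (x : M ⟶ (D.pull h).obj N) (k : N ⟶ K) :
    D.pullHom p e x ≫ (D.pull s).map k = D.pullHom p e (x ≫ (D.pull h).map k) := by
  simp only [pullHom, Functor.map_comp, Category.assoc]
  congr 1
  exact ((D.pullFac p h e).inv.naturality k).symm

/-- Restriction of morphisms `M ⟶ h^* N` is functorial, up to the identification of `(q ⋙ p)^* M`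
with `q^* p^* M`. -/
lemma pullHom_pullHom (q : Q ⥤ P) (p : P ⥤ A) {r : Q ⥤ A} (er : r = q ⋙ p)
    {h : A ⥤ B} {s : P ⥤ B} {t : Q ⥤ B} (e : s = p ⋙ h) (e' : t = q ⋙ s) (e'' : t = r ⋙ h)
    {M : D.obj A} {N : D.obj B} (x : M ⟶ (D.pull h).obj N) :
    (D.pullFac q p er).hom.app M ≫ D.pullHom q e' (D.pullHom p e x) = D.pullHom r e'' x := by
  subst er e e'
  simp only [pullHom, pullFac_rfl, Functor.map_comp, Category.assoc]
  rw [← reassoc_of% D.pullComp_naturality]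
  congr 1
  exact D.pullComp_assoc_inv q p h N

lemma μ_pullFac (p : P ⥤ A) (f : A ⥤ B) {s : P ⥤ B} (e : s = p ⋙ f) (M N : D.obj B) :
    μ (D.pull s) M N ≫ (D.pullFac p f e).hom.app (M ⊗ N) =
      ((D.pullFac p f e).hom.app M ⊗ₘ (D.pullFac p f e).hom.app N) ≫
        μ (D.pull p) _ _ ≫ (D.pull p).map (μ (D.pull f) M N) := by
  subst e
  simp

lemma ε_pullFac (p : P ⥤ A) (f : A ⥤ B) {s : P ⥤ B} (e : s = p ⋙ f) :
    ε (D.pull s) ≫ (D.pullFac p f e).hom.app (𝟙_ (D.obj B)) =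
      ε (D.pull p) ≫ (D.pull p).map (ε (D.pull f)) := by
  subst e
  simp

/-- The two ways to identify the restriction of `N` along `q ⋙ p ⋙ h` with an iterated restriction
agree. -/
lemma pullFac_pullFac (q : Q ⥤ P) (p : P ⥤ A) {r : Q ⥤ A} (er : r = q ⋙ p)
    {h : A ⥤ B} {s : P ⥤ B} {t : Q ⥤ B} (e : s = p ⋙ h) (e' : t = q ⋙ s) (e'' : t = r ⋙ h)
    (N : D.obj B) :
    (D.pullFac q s e').hom.app N ≫ (D.pull q).map ((D.pullFac p h e).hom.app N) =
      (D.pullFac r h e'').hom.app N ≫ (D.pullFac q p er).hom.app ((D.pull h).obj N) := by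
  subst er e e'
  simpa using (D.pullComp_assoc q p h N).symm

/-- Restriction of multiplication maps is functorial. -/
lemma pullMul_pullMul (q : Q ⥤ P) (p : P ⥤ A) {r : Q ⥤ A} (er : r = q ⋙ p)
    {f : A ⥤ B₁} {g : A ⥤ B₂} {h : A ⥤ B₃}
    {f' : P ⥤ B₁} {g' : P ⥤ B₂} {h' : P ⥤ B₃}
    {f'' : Q ⥤ B₁} {g'' : Q ⥤ B₂} {h'' : Q ⥤ B₃}
    (ef : f' = p ⋙ f) (eg : g' = p ⋙ g) (eh : h' = p ⋙ h)
    (ef' : f'' = q ⋙ f') (eg' : g'' = q ⋙ g') (eh' : h'' = q ⋙ h')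
    (ef'' : f'' = r ⋙ f) (eg'' : g'' = r ⋙ g) (eh'' : h'' = r ⋙ h)
    {F : D.obj B₁} {G : D.obj B₂} {K : D.obj B₃}
    (m : (D.pull f).obj F ⊗ (D.pull g).obj G ⟶ (D.pull h).obj K) :
    D.pullMul q ef' eg' eh' (D.pullMul p ef eg eh m) = D.pullMul r ef'' eg'' eh'' m := by
  rw [D.pullMul_eq_pullHom q, D.pullMul_eq_pullHom p, D.pullMul_eq_pullHom r,
    ← D.pullHom_pullHom q p er eh eh' eh'' m, pullHom_comp]
  simp only [Functor.map_comp, Category.assoc]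
  rw [← μ_natural_assoc, tensorHom_comp_tensorHom_assoc, D.pullFac_pullFac q p er ef ef' ef'',
    D.pullFac_pullFac q p er eg eg' eg'', ← tensorHom_comp_tensorHom_assoc]
  rw [reassoc_of% D.μ_pullFac q p er]
  rfl

lemma pullUnit_pullUnit (q : Q ⥤ P) (p : P ⥤ A) {r : Q ⥤ A} (er : r = q ⋙ p)
    {h : A ⥤ B} {s : P ⥤ B} {t : Q ⥤ B} (e : s = p ⋙ h) (e' : t = q ⋙ s) (e'' : t = r ⋙ h)
    {U : D.obj B} (x : 𝟙_ (D.obj A) ⟶ (D.pull h).obj U) :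
    D.pullUnit q e' (D.pullUnit p e x) = D.pullUnit r e'' x := by
  rw [D.pullUnit_eq_pullHom q, D.pullUnit_eq_pullHom p, D.pullUnit_eq_pullHom r,
    ← D.pullHom_pullHom q p er e e' e'' x, pullHom_comp]
  rw [reassoc_of% D.ε_pullFac q p er]

/-- Morphisms which intertwine two multiplication maps still do so after restriction. -/
lemma pullMul_naturality (p : P ⥤ A) {f : A ⥤ B₁} {g : A ⥤ B₂} {h : A ⥤ B₃}
    {f' : P ⥤ B₁} {g' : P ⥤ B₂} {h' : P ⥤ B₃}
    (ef : f' = p ⋙ f) (eg : g' = p ⋙ g) (eh : h' = p ⋙ h)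
    {F F' : D.obj B₁} {G G' : D.obj B₂} {K K' : D.obj B₃}
    {m : (D.pull f).obj F ⊗ (D.pull g).obj G ⟶ (D.pull h).obj K}
    {m' : (D.pull f).obj F' ⊗ (D.pull g).obj G' ⟶ (D.pull h).obj K'}
    {x : F ⟶ F'} {y : G ⟶ G'} {k : K ⟶ K'}
    (H : ((D.pull f).map x ⊗ₘ (D.pull g).map y) ≫ m' = m ≫ (D.pull h).map k) :
    ((D.pull f').map x ⊗ₘ (D.pull g').map y) ≫ D.pullMul p ef eg eh m' =
      D.pullMul p ef eg eh m ≫ (D.pull h').map k := by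
  rw [D.pullMul_eq_pullHom p, D.pullMul_eq_pullHom p]
  simp only [Category.assoc]
  rw [pullHom_comp_map, ← H, pullHom_comp, ← μ_natural_assoc,
    tensorHom_comp_tensorHom_assoc, tensorHom_comp_tensorHom_assoc]
  rw [← Functor.comp_map, ← Functor.comp_map, ← NatTrans.naturality, ← NatTrans.naturality]

/-- An associativity equation between multiplication maps may be restricted. -/
lemma pullMul_associativity {B₁₂ B₂₃ B₁₂₃ : Grpd.{u, u}} (p : P ⥤ A)
    {f : A ⥤ B₁} {g : A ⥤ B₂} {h : A ⥤ B₃} {k : A ⥤ B₁₂} {r : A ⥤ B₂₃} {l : A ⥤ B₁₂₃}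
    {f' : P ⥤ B₁} {g' : P ⥤ B₂} {h' : P ⥤ B₃} {k' : P ⥤ B₁₂} {r' : P ⥤ B₂₃} {l' : P ⥤ B₁₂₃}
    (ef : f' = p ⋙ f) (eg : g' = p ⋙ g) (eh : h' = p ⋙ h) (ek : k' = p ⋙ k) (er : r' = p ⋙ r)
    (el : l' = p ⋙ l)
    {F : D.obj B₁} {G : D.obj B₂} {H : D.obj B₃} {K : D.obj B₁₂} {R : D.obj B₂₃}
    {L L' : D.obj B₁₂₃}
    {m₁ : (D.pull f).obj F ⊗ (D.pull g).obj G ⟶ (D.pull k).obj K}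
    {m₂ : (D.pull k).obj K ⊗ (D.pull h).obj H ⟶ (D.pull l).obj L}
    {m₃ : (D.pull g).obj G ⊗ (D.pull h).obj H ⟶ (D.pull r).obj R}
    {m₄ : (D.pull f).obj F ⊗ (D.pull r).obj R ⟶ (D.pull l).obj L'} {a : L ⟶ L'}
    (E : (m₁ ▷ (D.pull h).obj H) ≫ m₂ ≫ (D.pull l).map a =
      (α_ _ _ _).hom ≫ ((D.pull f).obj F ◁ m₃) ≫ m₄) :
    (D.pullMul p ef eg ek m₁ ▷ (D.pull h').obj H) ≫ D.pullMul p ek eh el m₂ ≫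
        (D.pull l').map a =
      (α_ _ _ _).hom ≫ ((D.pull f').obj F ◁ D.pullMul p eg eh er m₃) ≫
        D.pullMul p ef er el m₄ := by
  rw [D.pullMul_eq_pullHom p ef eg, D.pullMul_eq_pullHom p eg eh]
  rw [comp_whiskerRight, MonoidalCategory.whiskerLeft_comp]
  simp only [Category.assoc]
  rw [reassoc_of% D.pullHom_whiskerRight_comp p ek eh el,
    D.pullHom_whiskerLeft_comp p ef er el, pullHom_comp_map, Category.assoc, E, pullHom_comp,
    pullHom_comp]
  simp only [Category.assoc]
  exact (reassoc_of% lax_associativity) (D.pull p) ((D.pullFac p f ef).hom.app F)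
    ((D.pullFac p g eg).hom.app G) ((D.pullFac p h eh).hom.app H) _

/-- A left unit equation may be restricted. -/
lemma pullMul_unit_left (p : P ⥤ A) {f : A ⥤ B₁} {g : A ⥤ B₂} {f' : P ⥤ B₁} {g' : P ⥤ B₂}
    (ef : f' = p ⋙ f) (eg : g' = p ⋙ g)
    {U : D.obj B₁} {G K : D.obj B₂} {t : 𝟙_ (D.obj A) ⟶ (D.pull f).obj U}
    {m : (D.pull f).obj U ⊗ (D.pull g).obj G ⟶ (D.pull g).obj K} {k : K ⟶ G}
    (E : (t ▷ (D.pull g).obj G) ≫ m ≫ (D.pull g).map k = (λ_ _).hom) :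
    (D.pullUnit p ef t ▷ (D.pull g').obj G) ≫ D.pullMul p ef eg eg m ≫ (D.pull g').map k =
      (λ_ _).hom := by
  rw [pullUnit_eq_pullHom, comp_whiskerRight, Category.assoc,
    reassoc_of% D.pullHom_whiskerRight_comp p ef eg eg, pullHom_comp_map, Category.assoc, E,
    pullHom]
  rw [reassoc_of% lax_left_unitality, Iso.hom_inv_id_app]
  exact Category.comp_id _

/-- A right unit equation may be restricted. -/
lemma pullMul_unit_right (p : P ⥤ A) {f : A ⥤ B₁} {g : A ⥤ B₂} {f' : P ⥤ B₁} {g' : P ⥤ B₂}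
    (ef : f' = p ⋙ f) (eg : g' = p ⋙ g)
    {F K : D.obj B₁} {U : D.obj B₂} {t : 𝟙_ (D.obj A) ⟶ (D.pull g).obj U}
    {m : (D.pull f).obj F ⊗ (D.pull g).obj U ⟶ (D.pull f).obj K} {k : K ⟶ F}
    (E : ((D.pull f).obj F ◁ t) ≫ m ≫ (D.pull f).map k = (ρ_ _).hom) :
    ((D.pull f').obj F ◁ D.pullUnit p eg t) ≫ D.pullMul p ef eg ef m ≫ (D.pull f').map k =
      (ρ_ _).hom := by
  rw [pullUnit_eq_pullHom, MonoidalCategory.whiskerLeft_comp, Category.assoc,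
    reassoc_of% D.pullHom_whiskerLeft_comp p ef eg ef, pullHom_comp_map, Category.assoc, E, pullHom]
  rw [reassoc_of% lax_right_unitality, Iso.hom_inv_id_app]
  exact Category.comp_id _

end Restriction

end MonoidalPrederivator

/-! ### 2-pullback squares of groupoids -/

section TwoPullback

variable {P A B C : Grpd.{u, u}} {p : P ⥤ A} {q : P ⥤ C} {f : A ⥤ B} {g : C ⥤ B}
  {α : p ⋙ f ≅ q ⋙ g}

/-- The elementary description of 2-pullbacks: morphisms into the comparison category lift
uniquely and its objects lift up to isomorphism. -/
lemma isTwoPullback_iff : IsTwoPullback p q f g α ↔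
    (∀ (x y : P) (a : p.obj x ⟶ p.obj y) (c : q.obj x ⟶ q.obj y),
      f.map a ≫ α.hom.app y = α.hom.app x ≫ g.map c → ∃! k : x ⟶ y, p.map k = a ∧ q.map k = c) ∧
    (∀ (a : A) (c : C) (i : f.obj a ≅ g.obj c), ∃ (x : P) (a' : p.obj x ≅ a) (c' : q.obj x ≅ c),
      f.map a'.hom ≫ i.hom = α.hom.app x ≫ g.map c'.hom) := by
  constructor
  · intro h
    refine ⟨fun x y a c e => ?_, fun a c i => ?_⟩
    · let Ψ := (CategoricalPullback.CatCommSqOver.toFunctorToCategoricalPullback f g P).obj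
        ⟨p, q, α⟩
      have : Ψ.IsEquivalence := h
      let m : Ψ.obj x ⟶ Ψ.obj y := ⟨a, c, e⟩
      obtain ⟨k, hk⟩ := Ψ.map_surjective m
      refine ⟨k, ⟨congrArg (fun t => CategoricalPullback.Hom.fst t) hk,
        congrArg (fun t => CategoricalPullback.Hom.snd t) hk⟩, ?_⟩
      rintro k' ⟨h1, h2⟩
      apply Ψ.map_injective
      rw [hk]
      exact CategoricalPullback.hom_ext h1 h2
    · let Ψ := (CategoricalPullback.CatCommSqOver.toFunctorToCategoricalPullback f g P).obj
        ⟨p, q, α⟩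
      have : Ψ.IsEquivalence := h
      let t : CategoricalPullback f g := ⟨a, c, i⟩
      let j := Ψ.objObjPreimageIso t
      exact ⟨Ψ.objPreimage t, (CategoricalPullback.π₁ f g).mapIso j,
        (CategoricalPullback.π₂ f g).mapIso j, j.hom.w⟩
  · rintro ⟨h1, h2⟩
    refine @Functor.IsEquivalence.mk _ _ _ _ _ ⟨?_⟩ ⟨?_⟩ ⟨?_⟩
    · intro x y k k' e
      have e1 := congrArg (fun t => CategoricalPullback.Hom.fst t) e
      have e2 := congrArg (fun t => CategoricalPullback.Hom.snd t) e
      exact (h1 x y (p.map k') (q.map k') (α.hom.naturality k')).unique ⟨e1, e2⟩ ⟨rfl, rfl⟩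
    · intro x y m
      obtain ⟨k, ⟨e1, e2⟩, -⟩ := h1 x y m.fst m.snd m.w
      exact ⟨k, CategoricalPullback.hom_ext e1 e2⟩
    · intro t
      obtain ⟨x, a, c, e⟩ := h2 t.fst t.snd t.iso
      exact ⟨x, ⟨CategoricalPullback.mkIso a c e⟩⟩

lemma IsTwoPullback.symm (h : IsTwoPullback p q f g α) : IsTwoPullback q p g f α.symm := by
  rw [isTwoPullback_iff] at h ⊢
  refine ⟨fun x y c a e => ?_, fun c a i => ?_⟩
  · obtain ⟨k, ⟨e1, e2⟩, hk⟩ := h.1 x y a c (by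
      simp only [Iso.symm_hom] at e
      have e' : α.hom.app x ≫ (g.map c ≫ α.inv.app y) ≫ α.hom.app y =
        α.hom.app x ≫ (α.inv.app x ≫ f.map a) ≫ α.hom.app y := by rw [e]
      simpa using e'.symm)
    exact ⟨k, ⟨e2, e1⟩, fun k' ⟨e1', e2'⟩ => hk k' ⟨e2', e1'⟩⟩
  · obtain ⟨x, a', c', e⟩ := h.2 a c i.symm
    refine ⟨x, c', a', ?_⟩
    simp only [Iso.symm_hom] at e ⊢
    have e' : α.inv.app x ≫ (f.map a'.hom ≫ i.inv) ≫ i.hom =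
      α.inv.app x ≫ (α.hom.app x ≫ g.map c'.hom) ≫ i.hom := by rw [e]
    simpa using e'.symm

lemma IsTwoPullback.eqToIso_symm {e : p ⋙ f = q ⋙ g} (h : IsTwoPullback p q f g (eqToIso e)) :
    IsTwoPullback q p g f (eqToIso e.symm) := h.symm

/-- The square which exhibits the graph of `q` as the pullback of the diagonal along `q × 1`. -/
lemma isTwoPullback_graph_left {A B : Grpd.{u, u}} (q : A ⥤ B) :
    IsTwoPullback (A := Grpd.of (A × B)) (B := Grpd.of (B × B)) (Functor.prod' (𝟭 A) q) q
      (MonoidalPrederivator.prodMap q (𝟭 B)) (Functor.prod' (𝟭 B) (𝟭 B)) (Iso.refl _) := by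
  refine isTwoPullback_iff.2 ⟨fun x y a c e => ?_, fun a c i => ?_⟩
  · have e1 : q.map a.1 ≫ 𝟙 _ = 𝟙 _ ≫ c := congrArg Prod.fst e
    have e2 : a.2 ≫ 𝟙 _ = 𝟙 _ ≫ c := congrArg Prod.snd e
    simp only [Category.comp_id, Category.id_comp] at e1 e2
    refine ⟨a.1, ⟨?_, e1⟩, fun k ⟨h, _⟩ => congrArg Prod.fst h⟩
    exact Prod.ext rfl (e1.trans e2.symm)
  · let i1 : q.obj a.1 ≅ c := (CategoryTheory.Prod.fst B B).mapIso i
    let i2 : a.2 ≅ c := (CategoryTheory.Prod.snd B B).mapIso i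
    refine ⟨a.1, Iso.prod (Iso.refl _) (i1 ≪≫ i2.symm), i1, ?_⟩
    refine Prod.ext ?_ ?_
    · change q.map (𝟙 _) ≫ i1.hom = 𝟙 _ ≫ i1.hom
      simp
    · change (i1.hom ≫ i2.inv) ≫ i2.hom = 𝟙 _ ≫ i1.hom
      simp

/-- The square which exhibits the transposed graph of `q` as the pullback of the diagonal along
`1 × q`. -/
lemma isTwoPullback_graph_right {A B : Grpd.{u, u}} (q : A ⥤ B) :
    IsTwoPullback (A := Grpd.of (B × A)) (B := Grpd.of (B × B)) (Functor.prod' q (𝟭 A)) q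
      (MonoidalPrederivator.prodMap (𝟭 B) q) (Functor.prod' (𝟭 B) (𝟭 B)) (Iso.refl _) := by
  refine isTwoPullback_iff.2 ⟨fun x y a c e => ?_, fun a c i => ?_⟩
  · have e1 : a.1 ≫ 𝟙 _ = 𝟙 _ ≫ c := congrArg Prod.fst e
    have e2 : q.map a.2 ≫ 𝟙 _ = 𝟙 _ ≫ c := congrArg Prod.snd e
    simp only [Category.comp_id, Category.id_comp] at e1 e2
    refine ⟨a.2, ⟨?_, e2⟩, fun k ⟨h, _⟩ => congrArg Prod.snd h⟩
    exact Prod.ext (e2.trans e1.symm) rfl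
  · let i1 : a.1 ≅ c := (CategoryTheory.Prod.fst B B).mapIso i
    let i2 : q.obj a.2 ≅ c := (CategoryTheory.Prod.snd B B).mapIso i
    refine ⟨a.2, Iso.prod (i2 ≪≫ i1.symm) (Iso.refl _), i2, ?_⟩
    refine Prod.ext ?_ ?_
    · change (i2.hom ≫ i1.inv) ≫ i1.hom = 𝟙 _ ≫ i2.hom
      simp
    · change q.map (𝟙 _) ≫ i2.hom = 𝟙 _ ≫ i2.hom
      simp

end TwoPullback

namespace MonoidalPrederivator

open Functor.LaxMonoidal

variable {D : MonoidalPrederivator.{w, z, u}}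

/-! ### Left Kan extensions -/

section Lan

variable {P A B C : Grpd.{u, u}}

lemma IsLan.iso_comp {f : A ⥤ B} {L M : D.obj A} {N : D.obj B} {η : M ⟶ (D.pull f).obj N}
    (hη : D.IsLan f η) (i : L ⟶ M) [IsIso i] : D.IsLan f (i ≫ η) := by
  intro K
  have h : (fun k : N ⟶ K => (i ≫ η) ≫ (D.pull f).map k) =
      (fun x => i ≫ x) ∘ fun k : N ⟶ K => η ≫ (D.pull f).map k := by
    funext k
    simp
  rw [h]
  refine Function.Bijective.comp ⟨fun x y e => ?_, fun y => ⟨inv i ≫ y, by simp⟩⟩ (hη K)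
  exact (cancel_epi i).1 e

lemma IsLan.comp_iso {f : A ⥤ B} {M : D.obj A} {N N' : D.obj B} {η : M ⟶ (D.pull f).obj N}
    (hη : D.IsLan f η) (i : N ⟶ N') [IsIso i] : D.IsLan f (η ≫ (D.pull f).map i) := by
  intro K
  have h : (fun k : N' ⟶ K => (η ≫ (D.pull f).map i) ≫ (D.pull f).map k) =
      (fun k : N ⟶ K => η ≫ (D.pull f).map k) ∘ fun x => i ≫ x := by
    funext k
    simp
  rw [h]
  refine Function.Bijective.comp (hη K) ⟨fun x y e => ?_, fun y => ⟨inv i ≫ y, by simp⟩⟩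
  exact (cancel_epi i).1 e

lemma IsLan.comp {f : A ⥤ B} {g : B ⥤ C} {h : A ⥤ C} (e : h = f ⋙ g) {L : D.obj A} {M : D.obj B}
    {N : D.obj C} {η : L ⟶ (D.pull f).obj M} {θ : M ⟶ (D.pull g).obj N}
    (hη : D.IsLan f η) (hθ : D.IsLan g θ) : D.IsLan h (η ≫ D.pullHom f e θ) := by
  intro K
  have E : (fun k : N ⟶ K => (η ≫ D.pullHom f e θ) ≫ (D.pull h).map k) =
      (fun x => x ≫ (D.pullFac f g e).inv.app K) ∘
        (fun y => η ≫ (D.pull f).map y) ∘ fun k : N ⟶ K => θ ≫ (D.pull g).map k := by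
    funext k
    simp only [Category.assoc, Function.comp]
    rw [pullHom_comp_map, pullHom]
  rw [E]
  refine Function.Bijective.comp ⟨fun x y e => (cancel_mono _).1 e,
    fun y => ⟨y ≫ (D.pullFac f g e).hom.app K, ?_⟩⟩ ((hη _).comp (hθ K))
  simp

/-- An isomorphism is a left Kan extension along the identity. The functor `f` is only required to
be equal to the identity: it will be the restriction along an identity operator, for which this
equality is not definitional. -/
lemma isLan_of_isIso (f : A ⥤ A) (hf : f = 𝟭 A) {M : D.obj A} {N : D.obj A}
    (η : M ⟶ (D.pull f).obj N) [IsIso η] : D.IsLan f η := by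
  subst hf
  intro K
  have E : (fun k : N ⟶ K => η ≫ (D.pull (𝟭 A)).map k) =
      (fun x => (η ≫ (D.pullId A).hom.app N) ≫ x ≫ (D.pullId A).inv.app K) := by
    funext k
    have h := (D.pullId A).hom.naturality k
    rw [Functor.id_map] at h
    rw [Category.assoc, ← reassoc_of% h, Iso.hom_inv_id_app, Category.comp_id]
  rw [E]
  refine ⟨fun x y e => ?_, fun y => ⟨(D.pullId A).inv.app N ≫ inv η ≫ y ≫ (D.pullId A).hom.app K,
    by simp⟩⟩
  exact (cancel_mono ((D.pullId A).inv.app K)).1 ((cancel_epi (η ≫ (D.pullId A).hom.app N)).1 e)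

/-- Two left Kan extensions of the same object are isomorphic. -/
lemma IsLan.exists_iso {f : A ⥤ B} {M : D.obj A} {N N' : D.obj B} {η : M ⟶ (D.pull f).obj N}
    {η' : M ⟶ (D.pull f).obj N'} (hη : D.IsLan f η) (hη' : D.IsLan f η') :
    ∃ i : N ≅ N', η ≫ (D.pull f).map i.hom = η' := by
  obtain ⟨a, ha⟩ := (hη N').2 η'
  obtain ⟨b, hb⟩ := (hη' N).2 η
  dsimp only at ha hb
  refine ⟨⟨a, b, (hη N).1 ?_, (hη' N').1 ?_⟩, ha⟩
  · simp only [Functor.map_comp, reassoc_of% ha, hb]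
    simp
  · simp only [Functor.map_comp, reassoc_of% hb, ha]
    simp

end Lan

/-! ### Base change and the projection formulas -/

section BaseChange

variable {P Q A B A' B' C R R' : Grpd.{u, u}}

lemma pullComp_pull₂_left (f : A ⥤ B) {g g' : B ⥤ C} (a : g ⟶ g') (M : D.obj C) :
    (D.pullComp f g).hom.app M ≫ (D.pull f).map ((D.pull₂ a).app M) =
      (D.pull₂ (Functor.whiskerLeft f a)).app M ≫ (D.pullComp f g').hom.app M :=
  (congr_app (D.pull₂_whiskerLeft f a) M).symm

lemma pullComp_pull₂_right {f f' : A ⥤ B} (a : f ⟶ f') (g : B ⥤ C) (M : D.obj C) :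
    (D.pullComp f g).hom.app M ≫ (D.pull₂ a).app ((D.pull g).obj M) =
      (D.pull₂ (Functor.whiskerRight a g)).app M ≫ (D.pullComp f' g).hom.app M :=
  (congr_app (D.pull₂_whiskerRight a g) M).symm

/-- Base change is compatible with the pasting of squares: base change along `α₁`, followed by base
change along `α₂`, is base change along the pasted square `β`. -/
lemma baseChange_baseChange (p : P ⥤ R) (π : R ⥤ A) (f : A ⥤ A') (k : R ⥤ R') (π' : R' ⥤ A')
    (q : P ⥤ Q) (δ : Q ⥤ R') (α₁ : π ⋙ f ≅ k ⋙ π') (α₂ : p ⋙ k ≅ q ⋙ δ)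
    (β : (p ⋙ π) ⋙ f ≅ q ⋙ δ ⋙ π')
    (hβ : ∀ x, β.hom.app x = α₁.hom.app (p.obj x) ≫ π'.map (α₂.hom.app x))
    {M : D.obj A} {N : D.obj A'} (η : M ⟶ (D.pull f).obj N) :
    (D.pullComp p π).hom.app M ≫ D.baseChange p q k δ α₂ (D.baseChange π k f π' α₁ η) =
      D.baseChange (p ⋙ π) q f (δ ⋙ π') β η ≫
        (D.pull q).map ((D.pullComp δ π').hom.app N) := by
  have hβ' : D.pull₂ β.hom =
      D.pull₂ (Functor.whiskerLeft p α₁.hom) ≫ D.pull₂ (Functor.whiskerRight α₂.hom π') := by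
    rw [← D.pull₂_comp]
    congr 1
    ext x
    exact hβ x
  simp only [baseChange, Functor.map_comp, Category.assoc]
  rw [← reassoc_of% D.pullComp_naturality]
  have h1 : (D.pullComp p π).hom.app ((D.pull f).obj N) ≫
      (D.pull p).map ((D.pullComp π f).inv.app N) =
      (D.pullComp (p ⋙ π) f).inv.app N ≫ (D.pullComp p (π ⋙ f)).hom.app N := by
    rw [← reassoc_of% D.pullComp_assoc_inv, Iso.inv_hom_id_app]
    simp
  rw [reassoc_of% h1, reassoc_of% D.pullComp_pull₂_left, ← reassoc_of% D.pullComp_assoc,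
    Iso.hom_inv_id_app_assoc, reassoc_of% D.pullComp_pull₂_right, hβ']
  simp only [NatTrans.comp_app, Category.assoc]
  rw [← D.pullComp_assoc]

/-- Base change is monoidal. -/
lemma μ_baseChange (p : P ⥤ A) (q : P ⥤ C) (f : A ⥤ B) (g : C ⥤ B) (α : p ⋙ f ≅ q ⋙ g)
    {M M' : D.obj A} {N N' : D.obj B} (x : M ⟶ (D.pull f).obj N) (y : M' ⟶ (D.pull f).obj N') :
    μ (D.pull p) M M' ≫ D.baseChange p q f g α ((x ⊗ₘ y) ≫ μ (D.pull f) N N') =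
      (D.baseChange p q f g α x ⊗ₘ D.baseChange p q f g α y) ≫ μ (D.pull q) _ _ ≫
        (D.pull q).map (μ (D.pull g) N N') := by
  have h : μ (D.pull p) _ _ ≫ (D.pull p).map (μ (D.pull f) N N') ≫
      (D.pullComp p f).inv.app (N ⊗ N') =
      ((D.pullComp p f).inv.app N ⊗ₘ (D.pullComp p f).inv.app N') ≫ μ (D.pull (p ⋙ f)) N N' := by
    rw [← cancel_mono ((D.pullComp p f).hom.app (N ⊗ N'))]
    simp only [Category.assoc, Iso.inv_hom_id_app]
    rw [D.μ_pullComp, tensorHom_comp_tensorHom_assoc, Iso.inv_hom_id_app, Iso.inv_hom_id_app]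
    simp
  simp only [baseChange, Functor.map_comp, Category.assoc]
  rw [← μ_natural_assoc, reassoc_of% h, NatTrans.IsMonoidal.tensor_assoc, D.μ_pullComp]
  simp only [tensorHom_comp_tensorHom_assoc]

/-- The base change of an external product along a functor to `A' × B'` is the tensor product of the
base changes of its factors along the two components of that functor. -/
lemma baseChange_extMap (p : P ⥤ Grpd.of (A × B)) (q : P ⥤ Q) (f : A ⥤ A') (g : B ⥤ B')
    (δ : Q ⥤ Grpd.of (A' × B')) (α : p ⋙ prodMap f g ≅ q ⋙ δ)
    (β₁ : (p ⋙ CategoryTheory.Prod.fst A B) ⋙ f ≅ q ⋙ δ ⋙ CategoryTheory.Prod.fst A' B')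
    (β₂ : (p ⋙ CategoryTheory.Prod.snd A B) ⋙ g ≅ q ⋙ δ ⋙ CategoryTheory.Prod.snd A' B')
    (h₁ : ∀ x, β₁.hom.app x = (α.hom.app x).1) (h₂ : ∀ x, β₂.hom.app x = (α.hom.app x).2)
    {M : D.obj A} {N : D.obj B} {M' : D.obj A'} {N' : D.obj B'}
    (η : M ⟶ (D.pull f).obj M') (θ : N ⟶ (D.pull g).obj N') :
    (((D.pullComp (B := Grpd.of (A × B)) p (CategoryTheory.Prod.fst A B)).hom.app M ⊗ₘ
        (D.pullComp (B := Grpd.of (A × B)) p (CategoryTheory.Prod.snd A B)).hom.app N) ≫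
        μ (D.pull p) _ _) ≫
        D.baseChange p q (prodMap f g) δ α (D.extMap f g η θ) =
      (D.baseChange (p ⋙ CategoryTheory.Prod.fst A B) q f
          (δ ⋙ CategoryTheory.Prod.fst A' B') β₁ η ⊗ₘ
        D.baseChange (p ⋙ CategoryTheory.Prod.snd A B) q g
          (δ ⋙ CategoryTheory.Prod.snd A' B') β₂ θ) ≫ μ (D.pull q) _ _ ≫
        (D.pull q).map
          (((D.pullComp (B := Grpd.of (A' × B')) δ
              (CategoryTheory.Prod.fst A' B')).hom.app M' ⊗ₘ
            (D.pullComp (B := Grpd.of (A' × B')) δ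
              (CategoryTheory.Prod.snd A' B')).hom.app N') ≫ μ (D.pull δ) _ _) := by
  have e₁ := D.baseChange_baseChange (R := Grpd.of (A × B)) (R' := Grpd.of (A' × B')) p
    (CategoryTheory.Prod.fst A B) f (prodMap f g) (CategoryTheory.Prod.fst A' B') q δ
    (Iso.refl _) α β₁ (fun x => (h₁ x).trans (Category.id_comp _).symm) η
  have e₂ := D.baseChange_baseChange (R := Grpd.of (A × B)) (R' := Grpd.of (A' × B')) p
    (CategoryTheory.Prod.snd A B) g (prodMap f g) (CategoryTheory.Prod.snd A' B') q δ
    (Iso.refl _) α β₂ (fun x => (h₂ x).trans (Category.id_comp _).symm) θ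
  rw [Functor.map_comp, ← μ_natural_assoc, tensorHom_comp_tensorHom_assoc, ← e₁, ← e₂,
    ← tensorHom_comp_tensorHom_assoc, Category.assoc]
  congr 1
  exact μ_baseChange _ _ _ _ _ _ _

/-- The left Kan extension of an external product, restricted along a 2-pullback square over
`A' × B'`, is a left Kan extension of a tensor product. -/
lemma isLan_tensor_of_extMap (hD : D.IsCocontinuousLeftDerivator)
    (p : P ⥤ Grpd.of (A × B)) (q : P ⥤ Q) (f : A ⥤ A') (g : B ⥤ B')
    (δ : Q ⥤ Grpd.of (A' × B')) (α : p ⋙ prodMap f g ≅ q ⋙ δ)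
    (hα : IsTwoPullback p q (prodMap f g) δ α)
    (β₁ : (p ⋙ CategoryTheory.Prod.fst A B) ⋙ f ≅ q ⋙ δ ⋙ CategoryTheory.Prod.fst A' B')
    (β₂ : (p ⋙ CategoryTheory.Prod.snd A B) ⋙ g ≅ q ⋙ δ ⋙ CategoryTheory.Prod.snd A' B')
    (h₁ : ∀ x, β₁.hom.app x = (α.hom.app x).1) (h₂ : ∀ x, β₂.hom.app x = (α.hom.app x).2)
    {M : D.obj A} {N : D.obj B} {M' : D.obj A'} {N' : D.obj B'}
    (η : M ⟶ (D.pull f).obj M') (θ : N ⟶ (D.pull g).obj N')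
    (h : D.IsLan (prodMap f g) (D.extMap f g η θ)) :
    D.IsLan q ((D.baseChange (p ⋙ CategoryTheory.Prod.fst A B) q f
          (δ ⋙ CategoryTheory.Prod.fst A' B') β₁ η ⊗ₘ
        D.baseChange (p ⋙ CategoryTheory.Prod.snd A B) q g
          (δ ⋙ CategoryTheory.Prod.snd A' B') β₂ θ) ≫ μ (D.pull q) _ _) := by
  have h' := hD.isLan_baseChange p q _ _ α hα _ h
  have e := baseChange_extMap p q f g δ α β₁ β₂ h₁ h₂ η θ
  let i : _ ≅ (D.pull δ).obj (D.extTensor M' N') :=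
    ((D.pullComp (B := Grpd.of (A' × B')) δ (CategoryTheory.Prod.fst A' B')).app M' ⊗ᵢ
      (D.pullComp (B := Grpd.of (A' × B')) δ (CategoryTheory.Prod.snd A' B')).app N') ≪≫
    Functor.Monoidal.μIso (D.pull δ) _ _
  let j : _ ≅ (D.pull p).obj (D.extTensor M N) :=
    ((D.pullComp (B := Grpd.of (A × B)) p (CategoryTheory.Prod.fst A B)).app M ⊗ᵢ
      (D.pullComp (B := Grpd.of (A × B)) p (CategoryTheory.Prod.snd A B)).app N) ≪≫
    Functor.Monoidal.μIso (D.pull p) _ _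
  have h'' := (h'.iso_comp j.hom).comp_iso i.inv
  have e' : j.hom ≫ D.baseChange p q (prodMap f g) δ α (D.extMap f g η θ) =
      (D.baseChange (p ⋙ CategoryTheory.Prod.fst A B) q f
          (δ ⋙ CategoryTheory.Prod.fst A' B') β₁ η ⊗ₘ
        D.baseChange (p ⋙ CategoryTheory.Prod.snd A B) q g
          (δ ⋙ CategoryTheory.Prod.snd A' B') β₂ θ) ≫ μ (D.pull q) _ _ ≫
        (D.pull q).map i.hom := e
  have e'' : (j.hom ≫ D.baseChange p q (prodMap f g) δ α (D.extMap f g η θ)) ≫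
      (D.pull q).map i.inv = (D.baseChange (p ⋙ CategoryTheory.Prod.fst A B) q f
          (δ ⋙ CategoryTheory.Prod.fst A' B') β₁ η ⊗ₘ
        D.baseChange (p ⋙ CategoryTheory.Prod.snd A B) q g
          (δ ⋙ CategoryTheory.Prod.snd A' B') β₂ θ) ≫ μ (D.pull q) _ _ := by
    rw [e', Category.assoc, Category.assoc, ← Functor.map_comp, Iso.hom_inv_id,
      CategoryTheory.Functor.map_id, Category.comp_id]
  exact e'' ▸ h''

/-- Base change along the first component `𝟭 A` of the graph of `q` does not alter a morphism
`M ⟶ q^* N`. -/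
lemma baseChange_refl_id (q : A ⥤ B) {M : D.obj A} {N : D.obj B} (η : M ⟶ (D.pull q).obj N) :
    (D.pullId A).inv.app M ≫ D.baseChange (𝟭 A) q q (𝟭 B) (Iso.refl q) η ≫
      (D.pull q).map ((D.pullId B).hom.app N) = η := by
  have h : D.pull₂ (Iso.refl q).hom = 𝟙 (D.pull q) := D.pull₂_id q
  have h' := (D.pullId A).inv.naturality η
  rw [Functor.id_map] at h'
  simp only [baseChange, h, Category.assoc]
  rw [← reassoc_of% h']
  erw [D.pullComp_id_right q N, Category.id_comp]
  have h2 := D.pullComp_id_left q N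
  erw [Category.comp_id]
  have h3 : (D.pullId A).inv.app ((D.pull q).obj N) ≫ (D.pullComp (𝟭 A) q).inv.app N = 𝟙 _ := by
    rw [← cancel_epi ((D.pullId A).hom.app ((D.pull q).obj N)),
      ← cancel_epi ((D.pullComp (𝟭 A) q).hom.app N)]
    simp [h2]
  erw [h3, Category.comp_id]

/-- Base change along the second component `q` of the graph of `q` turns the identification of `N`
with its restriction along `𝟭 B` into the restriction along `q` of this identification. -/
lemma baseChange_pullId (q : A ⥤ B) (N : D.obj B) :
    D.baseChange (M := N) q q (𝟭 B) (𝟭 B) (Iso.refl q) ((D.pullId B).inv.app N) ≫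
      (D.pull q).map ((D.pullId B).hom.app N) = 𝟙 _ := by
  have h : D.pull₂ (Iso.refl q).hom = 𝟙 (D.pull q) := D.pull₂_id q
  simp only [baseChange, h, Category.assoc]
  erw [Category.id_comp, Iso.inv_hom_id_app_assoc, ← Functor.map_comp, Iso.inv_hom_id_app]
  exact (D.pull q).map_id _

/-- Left projection formula: left Kan extensions along `q` are preserved by `- ⊗ q^* L`. -/
lemma IsLan.whiskerRight (hD : D.IsCocontinuousLeftDerivator) {q : A ⥤ B} {M : D.obj A}
    {N : D.obj B} {η : M ⟶ (D.pull q).obj N} (hη : D.IsLan q η) (L : D.obj B) :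
    D.IsLan q ((η ▷ (D.pull q).obj L) ≫ μ (D.pull q) N L) := by
  -- The external product of `η` and the identity of `L` is restricted along the graph of `q`.
  have h : D.IsLan q ((D.baseChange (𝟭 A) q q (𝟭 B) (Iso.refl q) η ⊗ₘ
      D.baseChange (M := L) q q (𝟭 B) (𝟭 B) (Iso.refl q) ((D.pullId B).inv.app L)) ≫
        μ (D.pull q) _ _) :=
    isLan_tensor_of_extMap hD (A := A) (B := B) (A' := B) (B' := B)
      (Functor.prod' (𝟭 A) q) q q (𝟭 B)
      (Functor.prod' (𝟭 B) (𝟭 B)) (Iso.refl _) (isTwoPullback_graph_left q) (Iso.refl _)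
      (Iso.refl _) (fun _ => rfl) (fun _ => rfl) η _ (hD.isLan_ext_left q η hη L)
  -- It remains to remove the restrictions along identity functors.
  have h' := (h.iso_comp (((D.pullId A).app M).inv ▷ (D.pull q).obj L)).comp_iso
    (((D.pullId B).app N).hom ⊗ₘ ((D.pullId B).app L).hom)
  have e : (((D.pullId A).app M).inv ▷ (D.pull q).obj L ≫
      (D.baseChange (𝟭 A) q q (𝟭 B) (Iso.refl q) η ⊗ₘ
        D.baseChange (M := L) q q (𝟭 B) (𝟭 B) (Iso.refl q) ((D.pullId B).inv.app L)) ≫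
        μ (D.pull q) _ _) ≫
      (D.pull q).map (((D.pullId B).app N).hom ⊗ₘ ((D.pullId B).app L).hom) =
      (η ▷ (D.pull q).obj L) ≫ μ (D.pull q) N L := by
    simp only [Category.assoc]
    rw [← μ_natural, tensorHom_comp_tensorHom_assoc, whiskerRight_comp_tensorHom_assoc]
    have h1 := baseChange_refl_id q η
    have h2 := baseChange_pullId q L
    erw [h1, h2]
    simp
  rw [← e]
  exact h'

/-- Right projection formula: left Kan extensions along `q` are preserved by `q^* L ⊗ -`. -/
lemma IsLan.whiskerLeft (hD : D.IsCocontinuousLeftDerivator) {q : A ⥤ B} {M : D.obj A}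
    {N : D.obj B} {η : M ⟶ (D.pull q).obj N} (hη : D.IsLan q η) (L : D.obj B) :
    D.IsLan q (((D.pull q).obj L ◁ η) ≫ μ (D.pull q) L N) := by
  have h : D.IsLan q ((D.baseChange (M := L) q q (𝟭 B) (𝟭 B) (Iso.refl q)
        ((D.pullId B).inv.app L) ⊗ₘ D.baseChange (𝟭 A) q q (𝟭 B) (Iso.refl q) η) ≫
        μ (D.pull q) _ _) :=
    isLan_tensor_of_extMap hD (A := B) (B := A) (A' := B) (B' := B)
      (Functor.prod' q (𝟭 A)) q (𝟭 B) q
      (Functor.prod' (𝟭 B) (𝟭 B)) (Iso.refl _) (isTwoPullback_graph_right q) (Iso.refl _)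
      (Iso.refl _) (fun _ => rfl) (fun _ => rfl) _ η (hD.isLan_ext_right q η hη L)
  have h' := (h.iso_comp ((D.pull q).obj L ◁ ((D.pullId A).app M).inv)).comp_iso
    (((D.pullId B).app L).hom ⊗ₘ ((D.pullId B).app N).hom)
  have e : ((D.pull q).obj L ◁ ((D.pullId A).app M).inv ≫
      (D.baseChange (M := L) q q (𝟭 B) (𝟭 B) (Iso.refl q) ((D.pullId B).inv.app L) ⊗ₘ
        D.baseChange (𝟭 A) q q (𝟭 B) (Iso.refl q) η) ≫ μ (D.pull q) _ _) ≫
      (D.pull q).map (((D.pullId B).app L).hom ⊗ₘ ((D.pullId B).app N).hom) =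
      ((D.pull q).obj L ◁ η) ≫ μ (D.pull q) L N := by
    simp only [Category.assoc]
    rw [← μ_natural, tensorHom_comp_tensorHom_assoc, whiskerLeft_comp_tensorHom_assoc]
    have h1 := baseChange_refl_id q η
    have h2 := baseChange_pullId q L
    erw [h1, h2]
    simp
  rw [← e]
  exact h'

end BaseChange

/-! ### Iterated products are left Kan extensions -/

section CompositeLan

variable {P A A' B B₁ B₂ B₃ B₄ : Grpd.{u, u}}

/-- Base change along a strictly commutative square is restriction of morphisms. -/
lemma baseChange_eqToIso (p : P ⥤ A') (q : P ⥤ A) (h : A' ⥤ B) (f : A ⥤ B) (e : p ⋙ h = q ⋙ f)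
    {s : P ⥤ B} (es : s = p ⋙ h) (es' : s = q ⋙ f) {M : D.obj A'} {N : D.obj B}
    (x : M ⟶ (D.pull h).obj N) :
    D.baseChange p q h f (eqToIso e) x ≫ (D.pullFac q f es').inv.app N = D.pullHom p es x := by
  subst es'
  simp [baseChange, pullHom, pullFac, pull₂_eqToHom]

/-- The composite of (the restriction of) a left Kan extension `x : M ⟶ h^* N` in the first variable
with a multiplication map which is a left Kan extension, is a left Kan extension. -/
lemma IsLan.pullHom_whiskerRight_comp (hD : D.IsCocontinuousLeftDerivator)
    {p : P ⥤ A'} {q : P ⥤ A} {h : A' ⥤ B} {f : A ⥤ B} {e : p ⋙ h = q ⋙ f}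
    (sq : IsTwoPullback p q h f (eqToIso e)) {M : D.obj A'} {N : D.obj B}
    {x : M ⟶ (D.pull h).obj N} (hx : D.IsLan h x) {g : A ⥤ B₂} {k : A ⥤ B₃}
    {G : D.obj B₂} {K : D.obj B₃} {m : (D.pull f).obj N ⊗ (D.pull g).obj G ⟶ (D.pull k).obj K}
    (hm : D.IsLan k m) {s : P ⥤ B} {g' : P ⥤ B₂} {k' : P ⥤ B₃}
    (es : s = p ⋙ h) (es' : s = q ⋙ f) (eg : g' = q ⋙ g) (ek : k' = q ⋙ k) :
    D.IsLan k' ((D.pullHom p es x ▷ (D.pull g').obj G) ≫ D.pullMul q es' eg ek m) := by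
  -- Base change, then the projection formula, then composition of left Kan extensions.
  have h1 := ((hD.isLan_baseChange p q h f _ sq x hx).whiskerRight hD
    ((D.pull g).obj G)).comp ek hm
  have h2 := h1.iso_comp ((D.pull p).obj M ◁ (D.pullFac q g eg).hom.app G)
  convert h2 using 1
  rw [pullMul_eq_pullHom, ← baseChange_eqToIso p q h f e es es' x]
  simp [MonoidalCategory.tensorHom_def, whisker_exchange_assoc]

/-- The composite of (the restriction of) a left Kan extension `x : M ⟶ h^* N` in the second
variable with a multiplication map which is a left Kan extension, is a left Kan extension. -/
lemma IsLan.pullHom_whiskerLeft_comp (hD : D.IsCocontinuousLeftDerivator)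
    {p : P ⥤ A'} {q : P ⥤ A} {h : A' ⥤ B} {g : A ⥤ B} {e : p ⋙ h = q ⋙ g}
    (sq : IsTwoPullback p q h g (eqToIso e)) {M : D.obj A'} {N : D.obj B}
    {x : M ⟶ (D.pull h).obj N} (hx : D.IsLan h x) {f : A ⥤ B₁} {k : A ⥤ B₃}
    {F : D.obj B₁} {K : D.obj B₃} {m : (D.pull f).obj F ⊗ (D.pull g).obj N ⟶ (D.pull k).obj K}
    (hm : D.IsLan k m) {s : P ⥤ B} {f' : P ⥤ B₁} {k' : P ⥤ B₃}
    (es : s = p ⋙ h) (es' : s = q ⋙ g) (ef : f' = q ⋙ f) (ek : k' = q ⋙ k) :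
    D.IsLan k' (((D.pull f').obj F ◁ D.pullHom p es x) ≫ D.pullMul q ef es' ek m) := by
  have h1 := ((hD.isLan_baseChange p q h g _ sq x hx).whiskerLeft hD
    ((D.pull f).obj F)).comp ek hm
  have h2 := h1.iso_comp ((D.pullFac q f ef).hom.app F ▷ (D.pull p).obj M)
  convert h2 using 1
  rw [pullMul_eq_pullHom, ← baseChange_eqToIso p q h g e es es' x]
  simp [MonoidalCategory.tensorHom_def', whisker_exchange_assoc]

/-- Left-bracketed triple products are left Kan extensions. -/
lemma IsLan.mul_whiskerRight_comp (hD : D.IsCocontinuousLeftDerivator)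
    {p : P ⥤ A'} {q : P ⥤ A} {a : A' ⥤ B₁} {b : A' ⥤ B₂} {h : A' ⥤ B} {f : A ⥤ B}
    {e : p ⋙ h = q ⋙ f} (sq : IsTwoPullback p q h f (eqToIso e))
    {E : D.obj B₁} {F : D.obj B₂} {N : D.obj B}
    {x : (D.pull a).obj E ⊗ (D.pull b).obj F ⟶ (D.pull h).obj N} (hx : D.IsLan h x)
    {g : A ⥤ B₃} {k : A ⥤ B₄} {G : D.obj B₃} {K : D.obj B₄}
    {m : (D.pull f).obj N ⊗ (D.pull g).obj G ⟶ (D.pull k).obj K} (hm : D.IsLan k m)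
    {a' : P ⥤ B₁} {b' : P ⥤ B₂} {s : P ⥤ B} {g' : P ⥤ B₃} {k' : P ⥤ B₄}
    (ea : a' = p ⋙ a) (eb : b' = p ⋙ b)
    (es : s = p ⋙ h) (es' : s = q ⋙ f) (eg : g' = q ⋙ g) (ek : k' = q ⋙ k) :
    D.IsLan k' ((D.pullMul p ea eb es x ▷ (D.pull g').obj G) ≫ D.pullMul q es' eg ek m) := by
  rw [D.pullMul_eq_pullHom p, comp_whiskerRight, Category.assoc]
  exact (IsLan.pullHom_whiskerRight_comp hD sq hx hm es es' eg ek).iso_comp _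

/-- Right-bracketed triple products are left Kan extensions. -/
lemma IsLan.mul_whiskerLeft_comp (hD : D.IsCocontinuousLeftDerivator)
    {p : P ⥤ A'} {q : P ⥤ A} {a : A' ⥤ B₂} {b : A' ⥤ B₃} {h : A' ⥤ B} {g : A ⥤ B}
    {e : p ⋙ h = q ⋙ g} (sq : IsTwoPullback p q h g (eqToIso e))
    {E : D.obj B₂} {G : D.obj B₃} {N : D.obj B}
    {x : (D.pull a).obj E ⊗ (D.pull b).obj G ⟶ (D.pull h).obj N} (hx : D.IsLan h x)
    {f : A ⥤ B₁} {k : A ⥤ B₄} {F : D.obj B₁} {K : D.obj B₄}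
    {m : (D.pull f).obj F ⊗ (D.pull g).obj N ⟶ (D.pull k).obj K} (hm : D.IsLan k m)
    {a' : P ⥤ B₂} {b' : P ⥤ B₃} {s : P ⥤ B} {f' : P ⥤ B₁} {k' : P ⥤ B₄}
    (ea : a' = p ⋙ a) (eb : b' = p ⋙ b)
    (es : s = p ⋙ h) (es' : s = q ⋙ g) (ef : f' = q ⋙ f) (ek : k' = q ⋙ k) :
    D.IsLan k' (((D.pull f').obj F ◁ D.pullMul p ea eb es x) ≫ D.pullMul q ef es' ek m) := by
  rw [D.pullMul_eq_pullHom p, MonoidalCategory.whiskerLeft_comp, Category.assoc]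
  exact (IsLan.pullHom_whiskerLeft_comp hD sq hx hm es es' ef ek).iso_comp _

/-- Left-bracketed quadruple products are left Kan extensions. -/
lemma IsLan.mul_mul_whiskerRight_comp (hD : D.IsCocontinuousLeftDerivator)
    {B₅ B₁₂ : Grpd.{u, u}}
    {p : P ⥤ A'} {q : P ⥤ A} {a : A' ⥤ B₁} {b : A' ⥤ B₂} {ab : A' ⥤ B₁₂} {c : A' ⥤ B₃}
    {h : A' ⥤ B} {f : A ⥤ B}
    {e : p ⋙ h = q ⋙ f} (sq : IsTwoPullback p q h f (eqToIso e))
    {E : D.obj B₁} {F : D.obj B₂} {EF : D.obj B₁₂} {G : D.obj B₃} {N : D.obj B}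
    {x : (D.pull a).obj E ⊗ (D.pull b).obj F ⟶ (D.pull ab).obj EF}
    {y : (D.pull ab).obj EF ⊗ (D.pull c).obj G ⟶ (D.pull h).obj N}
    (hx : D.IsLan h ((x ▷ (D.pull c).obj G) ≫ y))
    {g : A ⥤ B₄} {k : A ⥤ B₅} {H : D.obj B₄} {K : D.obj B₅}
    {m : (D.pull f).obj N ⊗ (D.pull g).obj H ⟶ (D.pull k).obj K} (hm : D.IsLan k m)
    {a' : P ⥤ B₁} {b' : P ⥤ B₂} {ab' : P ⥤ B₁₂} {c' : P ⥤ B₃} {s : P ⥤ B}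
    {g' : P ⥤ B₄} {k' : P ⥤ B₅}
    (ea : a' = p ⋙ a) (eb : b' = p ⋙ b) (eab : ab' = p ⋙ ab) (ec : c' = p ⋙ c)
    (es : s = p ⋙ h) (es' : s = q ⋙ f) (eg : g' = q ⋙ g) (ek : k' = q ⋙ k) :
    D.IsLan k' ((((D.pullMul p ea eb eab x ▷ (D.pull c').obj G) ≫ D.pullMul p eab ec es y) ▷
      (D.pull g').obj H) ≫ D.pullMul q es' eg ek m) := by
  have e₁ : (D.pullMul p ea eb eab x ▷ (D.pull c').obj G) ≫ D.pullMul p eab ec es y =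
      ((((D.pullFac p a ea).hom.app E ⊗ₘ (D.pullFac p b eb).hom.app F) ≫ μ (D.pull p) _ _) ▷
        (D.pull c').obj G ≫ (_ ◁ (D.pullFac p c ec).hom.app G) ≫ μ (D.pull p) _ _) ≫
        D.pullHom p es ((x ▷ (D.pull c).obj G) ≫ y) := by
    rw [D.pullMul_eq_pullHom p ea eb, comp_whiskerRight, Category.assoc,
      D.pullHom_whiskerRight_comp p eab ec es]
    simp only [Category.assoc]
  rw [e₁, comp_whiskerRight, Category.assoc]
  exact (IsLan.pullHom_whiskerRight_comp hD sq hx hm es es' eg ek).iso_comp _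

/-- Multiplying by a left Kan extension of the unit on the left. -/
lemma IsLan.unit_whiskerRight_comp (hD : D.IsCocontinuousLeftDerivator)
    {p : P ⥤ A'} {q : P ⥤ A} {h : A' ⥤ B} {f : A ⥤ B} {e : p ⋙ h = q ⋙ f}
    (sq : IsTwoPullback p q h f (eqToIso e)) {N : D.obj B}
    {x : 𝟙_ (D.obj A') ⟶ (D.pull h).obj N} (hx : D.IsLan h x) {g : A ⥤ B₂} {k : A ⥤ B₃}
    {G : D.obj B₂} {K : D.obj B₃} {m : (D.pull f).obj N ⊗ (D.pull g).obj G ⟶ (D.pull k).obj K}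
    (hm : D.IsLan k m) {s : P ⥤ B} {g' : P ⥤ B₂} {k' : P ⥤ B₃}
    (es : s = p ⋙ h) (es' : s = q ⋙ f) (eg : g' = q ⋙ g) (ek : k' = q ⋙ k) :
    D.IsLan k' ((D.pullUnit p es x ▷ (D.pull g').obj G) ≫ D.pullMul q es' eg ek m) := by
  rw [D.pullUnit_eq_pullHom p, comp_whiskerRight, Category.assoc]
  exact (IsLan.pullHom_whiskerRight_comp hD sq hx hm es es' eg ek).iso_comp _

/-- Multiplying by a left Kan extension of the unit on the right. -/
lemma IsLan.unit_whiskerLeft_comp (hD : D.IsCocontinuousLeftDerivator)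
    {p : P ⥤ A'} {q : P ⥤ A} {h : A' ⥤ B} {g : A ⥤ B} {e : p ⋙ h = q ⋙ g}
    (sq : IsTwoPullback p q h g (eqToIso e)) {N : D.obj B}
    {x : 𝟙_ (D.obj A') ⟶ (D.pull h).obj N} (hx : D.IsLan h x) {f : A ⥤ B₁} {k : A ⥤ B₃}
    {F : D.obj B₁} {K : D.obj B₃} {m : (D.pull f).obj F ⊗ (D.pull g).obj N ⟶ (D.pull k).obj K}
    (hm : D.IsLan k m) {s : P ⥤ B} {f' : P ⥤ B₁} {k' : P ⥤ B₃}
    (es : s = p ⋙ h) (es' : s = q ⋙ g) (ef : f' = q ⋙ f) (ek : k' = q ⋙ k) :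
    D.IsLan k' (((D.pull f').obj F ◁ D.pullUnit p es x) ≫ D.pullMul q ef es' ek m) := by
  rw [D.pullUnit_eq_pullHom p, MonoidalCategory.whiskerLeft_comp, Category.assoc]
  exact (IsLan.pullHom_whiskerLeft_comp hD sq hx hm es es' ef ek).iso_comp _

end CompositeLan

end MonoidalPrederivator

/-! ### Coherence deduced from universal multiplication maps -/

section Formal

variable {C : Type*} [Category* C] [MonoidalCategory C]

/-- The pentagon for an associator which is defined by multiplication maps. The objects `fg`, `x₁`,
`t₁`, … are products with universal maps `m`, `n`, `p`; the hypotheses `h₁`, …, `h₅` define the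
components `a`, `b`, `c`, `d`, `e` of the associator, and `h₆`, `h₇` express that `a'`, `b'` are the
products of `a`, `b` with the remaining factor. The equation holds after composition with the
universal map of the product that is bracketed to the left. -/
lemma pentagon_of_mul {f g h k fg gh hk x₁ x₂ y₁ y₂ t₁ t₂ t₃ t₄ t₅ : C}
    {m₁ : f ⊗ g ⟶ fg} {m₂ : g ⊗ h ⟶ gh} {m₃ : h ⊗ k ⟶ hk}
    {n₁ : fg ⊗ h ⟶ x₁} {n₂ : f ⊗ gh ⟶ x₂} {n₃ : gh ⊗ k ⟶ y₁} {n₄ : g ⊗ hk ⟶ y₂}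
    {p₁ : x₁ ⊗ k ⟶ t₁} {p₂ : x₂ ⊗ k ⟶ t₂} {p₃ : f ⊗ y₁ ⟶ t₃} {p₄ : f ⊗ y₂ ⟶ t₄}
    {p₅ : fg ⊗ hk ⟶ t₅} {a : x₁ ⟶ x₂} {b : y₁ ⟶ y₂} {a' : t₁ ⟶ t₂} {c : t₂ ⟶ t₃}
    {b' : t₃ ⟶ t₄} {d : t₁ ⟶ t₅} {e : t₅ ⟶ t₄}
    (h₁ : (m₁ ▷ h) ≫ n₁ ≫ a = (α_ _ _ _).hom ≫ (f ◁ m₂) ≫ n₂)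
    (h₂ : (m₂ ▷ k) ≫ n₃ ≫ b = (α_ _ _ _).hom ≫ (g ◁ m₃) ≫ n₄)
    (h₃ : (n₂ ▷ k) ≫ p₂ ≫ c = (α_ _ _ _).hom ≫ (f ◁ n₃) ≫ p₃)
    (h₄ : (n₁ ▷ k) ≫ p₁ ≫ d = (α_ _ _ _).hom ≫ (fg ◁ m₃) ≫ p₅)
    (h₅ : (m₁ ▷ hk) ≫ p₅ ≫ e = (α_ _ _ _).hom ≫ (f ◁ n₄) ≫ p₄)
    (h₆ : (a ▷ k) ≫ p₂ = p₁ ≫ a') (h₇ : (f ◁ b) ≫ p₄ = p₃ ≫ b') :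
    ((((m₁ ▷ h) ≫ n₁) ▷ k) ≫ p₁) ≫ a' ≫ c ≫ b' =
      ((((m₁ ▷ h) ≫ n₁) ▷ k) ≫ p₁) ≫ d ≫ e := by
  have h₁' := congrArg (fun x => x ▷ k) h₁
  have h₂' := congrArg (fun x => f ◁ x) h₂
  simp only [comp_whiskerRight, MonoidalCategory.whiskerLeft_comp] at h₁' h₂'
  simp only [comp_whiskerRight, Category.assoc]
  rw [← reassoc_of% h₆, reassoc_of% h₁', reassoc_of% h₃, ← h₇, associator_naturality_middle_assoc,
    reassoc_of% h₂', pentagon_assoc, reassoc_of% h₄, associator_naturality_left_assoc,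
    ← whisker_exchange_assoc, h₅, associator_naturality_right_assoc]

lemma associator_naturality_of_mul {f g h f' g' h' fg gh fg' gh' x₁ x₂ x₁' x₂' : C}
    {m₁ : f ⊗ g ⟶ fg} {m₂ : g ⊗ h ⟶ gh} {n₁ : fg ⊗ h ⟶ x₁} {n₂ : f ⊗ gh ⟶ x₂} {a : x₁ ⟶ x₂}
    {m₁' : f' ⊗ g' ⟶ fg'} {m₂' : g' ⊗ h' ⟶ gh'} {n₁' : fg' ⊗ h' ⟶ x₁'} {n₂' : f' ⊗ gh' ⟶ x₂'}
    {a' : x₁' ⟶ x₂'} {p : f ⟶ f'} {q : g ⟶ g'} {r : h ⟶ h'} {pq : fg ⟶ fg'} {qr : gh ⟶ gh'}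
    {s₁ : x₁ ⟶ x₁'} {s₂ : x₂ ⟶ x₂'}
    (h₁ : (m₁ ▷ h) ≫ n₁ ≫ a = (α_ _ _ _).hom ≫ (f ◁ m₂) ≫ n₂)
    (h₁' : (m₁' ▷ h') ≫ n₁' ≫ a' = (α_ _ _ _).hom ≫ (f' ◁ m₂') ≫ n₂')
    (k₁ : (p ⊗ₘ q) ≫ m₁' = m₁ ≫ pq) (k₂ : (q ⊗ₘ r) ≫ m₂' = m₂ ≫ qr)
    (k₃ : (pq ⊗ₘ r) ≫ n₁' = n₁ ≫ s₁) (k₄ : (p ⊗ₘ qr) ≫ n₂' = n₂ ≫ s₂) :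
    ((m₁ ▷ h) ≫ n₁) ≫ s₁ ≫ a' = ((m₁ ▷ h) ≫ n₁) ≫ a ≫ s₂ := by
  simp only [Category.assoc]
  rw [reassoc_of% h₁, ← k₄, ← reassoc_of% k₃, whiskerRight_comp_tensorHom_assoc, ← k₁,
    whiskerLeft_comp_tensorHom_assoc, ← k₂, ← tensorHom_comp_whiskerRight_assoc,
    ← tensorHom_comp_whiskerLeft_assoc, h₁', associator_naturality_assoc]

/-- The triangle for structure isomorphisms which are defined by multiplication maps and a unit map
`t`, after composition with the map to the product `(f u) k`. -/
lemma triangle_of_mul {f k u fu uk x₁ x₂ y : C} {t : 𝟙_ C ⟶ u} {m₁ : f ⊗ u ⟶ fu} {r : fu ⟶ f}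
    {m₂ : u ⊗ k ⟶ uk} {l : uk ⟶ k} {n₁ : fu ⊗ k ⟶ x₁} {n₂ : f ⊗ uk ⟶ x₂} {a : x₁ ⟶ x₂}
    {p : f ⊗ k ⟶ y} {r' : x₁ ⟶ y} {l' : x₂ ⟶ y}
    (h₁ : (f ◁ t) ≫ m₁ ≫ r = (ρ_ _).hom) (h₂ : (t ▷ k) ≫ m₂ ≫ l = (λ_ _).hom)
    (h₃ : (m₁ ▷ k) ≫ n₁ ≫ a = (α_ _ _ _).hom ≫ (f ◁ m₂) ≫ n₂)
    (h₄ : (r ▷ k) ≫ p = n₁ ≫ r') (h₅ : (f ◁ l) ≫ p = n₂ ≫ l') :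
    ((((f ◁ t) ≫ m₁) ▷ k) ≫ n₁) ≫ a ≫ l' = ((((f ◁ t) ≫ m₁) ▷ k) ≫ n₁) ≫ r' := by
  have h₁' := congrArg (fun x => x ▷ k) h₁
  have h₂' := congrArg (fun x => f ◁ x) h₂
  simp only [comp_whiskerRight, MonoidalCategory.whiskerLeft_comp] at h₁' h₂'
  simp only [comp_whiskerRight, Category.assoc]
  rw [reassoc_of% h₃, ← h₅, ← h₄, reassoc_of% h₁', associator_naturality_middle_assoc,
    reassoc_of% h₂', triangle_assoc]

/-- The compatibility of the right unitor with a product `m f`, after composition with the map to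
`(m f) u`. It is a theorem in a monoidal category but an axiom of right actions. -/
lemma rightUnitor_tensor_of_mul {m f u mf fu x₁ x₂ : C} {t : 𝟙_ C ⟶ u} {v : m ⊗ f ⟶ mf}
    {n₁ : mf ⊗ u ⟶ x₁} {r₁ : x₁ ⟶ mf} {m₂ : f ⊗ u ⟶ fu} {r₂ : fu ⟶ f} {n₂ : m ⊗ fu ⟶ x₂}
    {a : x₁ ⟶ x₂} {r' : x₂ ⟶ mf}
    (h₁ : (mf ◁ t) ≫ n₁ ≫ r₁ = (ρ_ _).hom) (h₂ : (f ◁ t) ≫ m₂ ≫ r₂ = (ρ_ _).hom)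
    (h₃ : (v ▷ u) ≫ n₁ ≫ a = (α_ _ _ _).hom ≫ (m ◁ m₂) ≫ n₂) (h₄ : (m ◁ r₂) ≫ v = n₂ ≫ r') :
    (v ▷ _ ≫ (mf ◁ t) ≫ n₁) ≫ a ≫ r' = (v ▷ _ ≫ (mf ◁ t) ≫ n₁) ≫ r₁ := by
  have h₂' := congrArg (fun x => m ◁ x) h₂
  simp only [MonoidalCategory.whiskerLeft_comp] at h₂'
  simp only [Category.assoc]
  rw [h₁, ← whisker_exchange_assoc, reassoc_of% h₃, ← h₄, associator_naturality_right_assoc,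
    reassoc_of% h₂', rightUnitor_naturality, rightUnitor_tensor_hom]
  simp

/-- The compatibility of the left unitor with a product `g m`, after composition with the map to
`(u g) m`. It is a theorem in a monoidal category but an axiom of left actions. -/
lemma leftUnitor_tensor_of_mul {g m u gm ug x₁ x₂ : C} {t : 𝟙_ C ⟶ u} {v : g ⊗ m ⟶ gm}
    {m₁ : u ⊗ g ⟶ ug} {l₁ : ug ⟶ g} {n₁ : ug ⊗ m ⟶ x₁} {n₂ : u ⊗ gm ⟶ x₂} {l₂ : x₂ ⟶ gm}
    {a : x₁ ⟶ x₂} {l' : x₁ ⟶ gm}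
    (h₁ : (t ▷ g) ≫ m₁ ≫ l₁ = (λ_ _).hom) (h₂ : (t ▷ gm) ≫ n₂ ≫ l₂ = (λ_ _).hom)
    (h₃ : (m₁ ▷ m) ≫ n₁ ≫ a = (α_ _ _ _).hom ≫ (u ◁ v) ≫ n₂) (h₄ : (l₁ ▷ m) ≫ v = n₁ ≫ l') :
    ((((t ▷ g) ≫ m₁) ▷ m) ≫ n₁) ≫ a ≫ l₂ = ((((t ▷ g) ≫ m₁) ▷ m) ≫ n₁) ≫ l' := by
  have h₁' := congrArg (fun x => x ▷ m) h₁
  simp only [comp_whiskerRight] at h₁'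
  simp only [comp_whiskerRight, Category.assoc]
  rw [← h₄, reassoc_of% h₁', reassoc_of% h₃, associator_naturality_left_assoc,
    ← whisker_exchange_assoc, h₂, leftUnitor_naturality, leftUnitor_tensor_hom]
  simp

lemma leftUnitor_naturality_of_mul {u g g' ug ug' : C} {t : 𝟙_ C ⟶ u} {m : u ⊗ g ⟶ ug}
    {m' : u ⊗ g' ⟶ ug'} {l : ug ⟶ g} {l' : ug' ⟶ g'} {x : g ⟶ g'} {s : ug ⟶ ug'}
    (h : (t ▷ g) ≫ m ≫ l = (λ_ _).hom) (h' : (t ▷ g') ≫ m' ≫ l' = (λ_ _).hom)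
    (k : (u ◁ x) ≫ m' = m ≫ s) : ((t ▷ g) ≫ m) ≫ s ≫ l' = ((t ▷ g) ≫ m) ≫ l ≫ x := by
  simp only [Category.assoc]
  rw [reassoc_of% h, ← reassoc_of% k, ← whisker_exchange_assoc, h', leftUnitor_naturality]

lemma rightUnitor_naturality_of_mul {u g g' ug ug' : C} {t : 𝟙_ C ⟶ u} {m : g ⊗ u ⟶ ug}
    {m' : g' ⊗ u ⟶ ug'} {l : ug ⟶ g} {l' : ug' ⟶ g'} {x : g ⟶ g'} {s : ug ⟶ ug'}
    (h : (g ◁ t) ≫ m ≫ l = (ρ_ _).hom) (h' : (g' ◁ t) ≫ m' ≫ l' = (ρ_ _).hom)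
    (k : (x ▷ u) ≫ m' = m ≫ s) : ((g ◁ t) ≫ m) ≫ s ≫ l' = ((g ◁ t) ≫ m) ≫ l ≫ x := by
  simp only [Category.assoc]
  rw [reassoc_of% h, ← reassoc_of% k, whisker_exchange_assoc, h', rightUnitor_naturality]

end Formal

namespace MonoidalPrederivator

open Functor.LaxMonoidal

variable {D : MonoidalPrederivator.{w, z, u}}

/-! ### Tensor products defined by a left Kan extension -/

section Choice

variable {A B B₁ B₂ B₃ : Grpd.{u, u}}

/-- Restriction of multiplication maps along the identity. The functor `p` is only required to be
equal to the identity, see `isLan_of_isIso`. -/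
lemma pullMul_id {p : A ⥤ A} (hp : p = 𝟭 A) {f : A ⥤ B₁} {g : A ⥤ B₂} {h : A ⥤ B₃}
    (ef : f = p ⋙ f) (eg : g = p ⋙ g) (eh : h = p ⋙ h)
    {F : D.obj B₁} {G : D.obj B₂} {K : D.obj B₃}
    (m : (D.pull f).obj F ⊗ (D.pull g).obj G ⟶ (D.pull h).obj K) :
    D.pullMul p ef eg eh m = m := by
  subst hp
  have e₁ : ∀ {E : Grpd.{u, u}} (k : A ⥤ E) (N : D.obj E) (e : k = 𝟭 A ⋙ k),
      (D.pullFac (𝟭 A) k e).hom.app N = (D.pullId A).inv.app ((D.pull k).obj N) := by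
    intro E k N e
    rw [← cancel_mono ((D.pullId A).hom.app ((D.pull k).obj N)), Iso.inv_hom_id_app]
    exact (congrArg (fun x => x ≫ _) (congr_app (congrArg Iso.hom (D.pullFac_rfl (𝟭 A) k)) N)).trans
      (D.pullComp_id_left k N)
  have e₂ : (D.pullFac (𝟭 A) h eh).inv.app K = (D.pullId A).hom.app ((D.pull h).obj K) := by
    rw [← cancel_epi ((D.pullFac (𝟭 A) h eh).hom.app K), Iso.hom_inv_id_app, e₁,
      Iso.inv_hom_id_app]
    rfl
  have e₃ := NatTrans.IsMonoidal.tensor (τ := (D.pullId A).hom) ((D.pull f).obj F)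
    ((D.pull g).obj G)
  have e₄ := (D.pullId A).hom.naturality m
  rw [pullMul, e₁, e₁, e₂]
  erw [e₄, reassoc_of% e₃, tensorHom_comp_tensorHom_assoc]
  simp

variable (hD : D.IsCocontinuousLeftDerivator)

/-- A choice of the left Kan extension of `M` along `f`. -/
noncomputable def lan (f : A ⥤ B) (M : D.obj A) : D.obj B :=
  (hD.exists_lan f M).choose

/-- The unit of the chosen left Kan extension. -/
noncomputable def lanUnit (f : A ⥤ B) (M : D.obj A) : M ⟶ (D.pull f).obj (lan hD f M) :=
  (hD.exists_lan f M).choose_spec.choose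

lemma isLan_lanUnit (f : A ⥤ B) (M : D.obj A) : D.IsLan f (lanUnit hD f M) :=
  (hD.exists_lan f M).choose_spec.choose_spec

/-- The product `h_! (f^* F ⊗ g^* G)` associated with functors `f`, `g` and `h` on `A`. -/
noncomputable def lanTensor (f : A ⥤ B₁) (g : A ⥤ B₂) (h : A ⥤ B₃) (F : D.obj B₁) (G : D.obj B₂) :
    D.obj B₃ :=
  lan hD h ((D.pull f).obj F ⊗ (D.pull g).obj G)

/-- The universal multiplication map of `lanTensor`. -/
noncomputable def lanMul (f : A ⥤ B₁) (g : A ⥤ B₂) (h : A ⥤ B₃) (F : D.obj B₁) (G : D.obj B₂) :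
    (D.pull f).obj F ⊗ (D.pull g).obj G ⟶ (D.pull h).obj (lanTensor hD f g h F G) :=
  lanUnit hD h _

variable (f : A ⥤ B₁) (g : A ⥤ B₂) (h : A ⥤ B₃)

lemma isLan_lanMul (F : D.obj B₁) (G : D.obj B₂) : D.IsLan h (lanMul hD f g h F G) :=
  isLan_lanUnit hD h _

/-- Functoriality of `lanTensor`. -/
noncomputable def lanTensorMap {F F' : D.obj B₁} {G G' : D.obj B₂} (x : F ⟶ F') (y : G ⟶ G') :
    lanTensor hD f g h F G ⟶ lanTensor hD f g h F' G' :=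
  ((isLan_lanMul hD f g h F G _).2
    (((D.pull f).map x ⊗ₘ (D.pull g).map y) ≫ lanMul hD f g h F' G')).choose

lemma lanMul_naturality {F F' : D.obj B₁} {G G' : D.obj B₂} (x : F ⟶ F') (y : G ⟶ G') :
    ((D.pull f).map x ⊗ₘ (D.pull g).map y) ≫ lanMul hD f g h F' G' =
      lanMul hD f g h F G ≫ (D.pull h).map (lanTensorMap hD f g h x y) :=
  ((isLan_lanMul hD f g h F G _).2
    (((D.pull f).map x ⊗ₘ (D.pull g).map y) ≫ lanMul hD f g h F' G')).choose_spec.symm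

lemma lanTensorMap_id (F : D.obj B₁) (G : D.obj B₂) :
    lanTensorMap hD f g h (𝟙 F) (𝟙 G) = 𝟙 _ :=
  (isLan_lanMul hD f g h F G _).1 (by
    dsimp only
    rw [← lanMul_naturality]
    simp)

lemma lanTensorMap_comp {F F' F'' : D.obj B₁} {G G' G'' : D.obj B₂} (x : F ⟶ F') (y : G ⟶ G')
    (x' : F' ⟶ F'') (y' : G' ⟶ G'') :
    lanTensorMap hD f g h (x ≫ x') (y ≫ y') =
      lanTensorMap hD f g h x y ≫ lanTensorMap hD f g h x' y' :=
  (isLan_lanMul hD f g h F G _).1 (by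
    dsimp only
    rw [← lanMul_naturality, Functor.map_comp (D.pull h), ← reassoc_of% lanMul_naturality,
      ← lanMul_naturality, Functor.map_comp, Functor.map_comp,
      tensorHom_comp_tensorHom_assoc])

end Choice

end MonoidalPrederivator

/-! ### 2-Segal squares in low dimensions -/

section Squares

variable (X : SimplicialObject Grpd.{u, u})

/-- Replaces the functors of a strictly commutative 2-pullback square by equal ones, for example by
other names of the restriction to a face. -/
lemma IsTwoPullback.of_eq {P A B C : Grpd.{u, u}} {p p' : P ⥤ A} {q q' : P ⥤ C} {f f' : A ⥤ B}
    {g g' : C ⥤ B} {e : p ⋙ f = q ⋙ g} (h : IsTwoPullback p q f g (eqToIso e)) (hp : p = p')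
    (hq : q = q') (hf : f = f') (hg : g = g') (e' : p' ⋙ f' = q' ⋙ g') :
    IsTwoPullback p' q' f' g' (eqToIso e') := by
  subst hp hq hf hg
  exact h

/-- The map `[3] ⟶ [n]` onto the tetrahedron `{i, j, k, l}`. -/
def tetrahedronMap {n : ℕ} (i j k l : Fin (n + 1)) (hij : i ≤ j) (hjk : j ≤ k) (hkl : k ≤ l) :
    ⦋3⦌ ⟶ ⦋n⦌ :=
  SimplexCategory.mkHom
    { toFun := ![i, j, k, l]
      monotone' := by
        rw [Fin.monotone_iff_le_succ]
        intro a
        fin_cases a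
        · exact hij
        · exact hjk
        · exact hkl }

/-- Restriction `X_n ⥤ X_3` to the tetrahedron `{i, j, k, l}`. -/
def tetrahedron {n : ℕ} (i j k l : Fin (n + 1)) (hij : i ≤ j) (hjk : j ≤ k) (hkl : k ≤ l) :
    X _⦋n⦌ ⥤ X _⦋3⦌ :=
  simplicialMap X (tetrahedronMap i j k l hij hjk hkl)

lemma edge_simplicialMap {m n : ℕ} (e : ⦋m⦌ ⟶ ⦋n⦌) (a b : Fin (m + 1)) (hab : a ≤ b)
    {i j : Fin (n + 1)} (hij : i ≤ j) (hi : e a = i) (hj : e b = j) :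
    edge X i j hij = simplicialMap X e ⋙ edge X a b hab :=
  simplicialMap_eq X (SimplexCategory.Hom.ext_one_left _ _ hi.symm hj.symm)

lemma triangle_simplicialMap {m n : ℕ} (e : ⦋m⦌ ⟶ ⦋n⦌) (a b c : Fin (m + 1)) (hab : a ≤ b)
    (hbc : b ≤ c) {i j k : Fin (n + 1)} (hij : i ≤ j) (hjk : j ≤ k) (hi : e a = i) (hj : e b = j)
    (hk : e c = k) :
    triangle X i j k hij hjk = simplicialMap X e ⋙ triangle X a b c hab hbc :=
  simplicialMap_eq X (by
    ext t
    fin_cases t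
    · exact congrArg Fin.val hi.symm
    · exact congrArg Fin.val hj.symm
    · exact congrArg Fin.val hk.symm)

lemma vertex_simplicialMap {m n : ℕ} (e : ⦋m⦌ ⟶ ⦋n⦌) (a : Fin (m + 1)) {i : Fin (n + 1)}
    (hi : e a = i) : vertex X i = simplicialMap X e ⋙ vertex X a :=
  simplicialMap_eq X (by
    ext t
    exact congrArg Fin.val hi.symm)

variable {X} (hX : IsTwoSegal X)
include hX

/-- The quadrilateral `{0, 1, 2, 3}` is cut along the diagonal `{1, 3}`. -/
lemma IsTwoSegal.square₁₂₃ : IsTwoPullback (triangle X (n := 3) 1 2 3 (by decide) (by decide))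
    (triangle X 0 1 3 (by decide) (by decide)) (edge X 0 2 (by decide)) (edge X 1 2 (by decide))
    (eqToIso ((triangle_edge₀₂ X _ _ _ _ _).symm.trans (triangle_edge₁₂ X _ _ _ _ _))) :=
  (hX 1 2 0).eqToIso_symm.of_eq
    (congrArg (simplicialMap X) (by ext k; fin_cases k <;> rfl))
    (congrArg (simplicialMap X) (by ext k; fin_cases k <;> rfl)) rfl rfl _

/-- The quadrilateral `{0, 1, 2, 3}` is cut along the diagonal `{0, 2}`. -/
lemma IsTwoSegal.square₀₁₂ : IsTwoPullback (triangle X (n := 3) 0 1 2 (by decide) (by decide))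
    (triangle X 0 2 3 (by decide) (by decide)) (edge X 0 2 (by decide)) (edge X 0 1 (by decide))
    (eqToIso ((triangle_edge₀₂ X _ _ _ _ _).symm.trans (triangle_edge₀₁ X _ _ _ _ _))) :=
  (hX 0 2 1).eqToIso_symm.of_eq
    (congrArg (simplicialMap X) (by ext k; fin_cases k <;> rfl))
    (congrArg (simplicialMap X) (by ext k; fin_cases k <;> rfl)) rfl rfl _

/-- The pentagon `{0, 1, 2, 3, 4}` is cut along the diagonal `{1, 4}`. -/
lemma IsTwoSegal.square₁₂₃₄ : IsTwoPullback
    (tetrahedron X (n := 4) 1 2 3 4 (by decide) (by decide) (by decide))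
    (triangle X 0 1 4 (by decide) (by decide)) (edge X 0 3 (by decide)) (edge X 1 2 (by decide))
    (eqToIso ((edge_simplicialMap X _ 0 3 _ (by decide) rfl rfl).symm.trans
      (triangle_edge₁₂ X _ _ _ _ _))) :=
  (hX 1 3 0).eqToIso_symm.of_eq
    (congrArg (simplicialMap X) (by ext k; fin_cases k <;> rfl))
    (congrArg (simplicialMap X) (by ext k; fin_cases k <;> rfl)) rfl rfl _

/-- Unitality for the degenerate triangle `{0, 1, 1}`. -/
lemma IsTwoSegal.square₀₁₁ : IsTwoPullback (vertex X (n := 1) 1)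
    (triangle X 0 1 1 (by decide) (by decide)) (edge X 0 0 le_rfl) (edge X 1 2 (by decide))
    (eqToIso ((vertex_degenerate X _).symm.trans (triangle_edge₁₂ X _ _ _ _ _))) :=
  (hX 1 0 0).eqToIso_symm.of_eq
    (congrArg (simplicialMap X) (by ext k; fin_cases k; rfl))
    (congrArg (simplicialMap X) (by ext k; fin_cases k <;> rfl)) rfl rfl _

/-- Unitality for the degenerate triangle `{0, 0, 1}`. -/
lemma IsTwoSegal.square₀₀₁ : IsTwoPullback (vertex X (n := 1) 0)
    (triangle X 0 0 1 (by decide) (by decide)) (edge X 0 0 le_rfl) (edge X 0 1 (by decide))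
    (eqToIso ((vertex_degenerate X _).symm.trans (triangle_edge₀₁ X _ _ _ _ _))) :=
  (hX 0 0 1).eqToIso_symm.of_eq
    (congrArg (simplicialMap X) (by ext k; fin_cases k; rfl))
    (congrArg (simplicialMap X) (by ext k; fin_cases k <;> rfl)) rfl rfl _

end Squares

/-! ### Multiplication maps on simplices -/

section HallRestriction

variable {D : MonoidalPrederivator.{w, z, u}} {X : SimplicialObject Grpd.{u, u}}

/-- Multiplication maps `F|_{12} ⊗ G|_{01} ⟶ K|_{02}` on `X_2`. -/
abbrev HallMul (F G K : HallCat D X) : Type z :=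
  (resEdge D X (n := 2) 1 2 (by decide)).obj F ⊗ (resEdge D X 0 1 (by decide)).obj G ⟶
      (resEdge D X 0 2 (by decide)).obj K

/-- Restriction of `resMul m a b c` along an operator `e` is `resMul m (e a) (e b) (e c)`. The
values of `e` are given by equations, so that they can be replaced by literals. -/
lemma resMul_simplicialMap {F G K : HallCat D X} (m : HallMul F G K) {n n' : ℕ} (e : ⦋n⦌ ⟶ ⦋n'⦌)
    {a b c : Fin (n + 1)} (hab : a ≤ b) (hbc : b ≤ c) {i j k : Fin (n' + 1)} (hij : i ≤ j)
    (hjk : j ≤ k) (hi : e a = i) (hj : e b = j) (hk : e c = k) :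
    D.pullMul (simplicialMap X e) (edge_simplicialMap X e b c hbc hjk hj hk)
      (edge_simplicialMap X e a b hab hij hi hj)
      (edge_simplicialMap X e a c (hab.trans hbc) (hij.trans hjk) hi hk)
      (resMul m a b c hab hbc) = resMul m i j k hij hjk :=
  D.pullMul_pullMul _ _ (triangle_simplicialMap X e a b c hab hbc hij hjk hi hj hk) _ _ _ _ _ _ _ _
    _ _

lemma resUnit_simplicialMap {U : HallCat D X}
    (t : 𝟙_ (D.obj (X _⦋0⦌)) ⟶ (resEdge D X (n := 0) 0 0 le_rfl).obj U)
    {n n' : ℕ} (e : ⦋n⦌ ⟶ ⦋n'⦌) {a : Fin (n + 1)} {i : Fin (n' + 1)} (hi : e a = i) :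
    D.pullUnit (simplicialMap X e) (edge_simplicialMap X e a a le_rfl le_rfl hi hi)
      (resUnit t a) = resUnit t i :=
  D.pullUnit_pullUnit _ _ (vertex_simplicialMap X e a hi) _ _ _ _

lemma resMul_naturality {F F' G G' K K' : HallCat D X} {m : HallMul F G K} {m' : HallMul F' G' K'}
    {x : F ⟶ F'} {y : G ⟶ G'} {k : K ⟶ K'}
    (H : ((resEdge D X (n := 2) 1 2 (by decide)).map x ⊗ₘ (resEdge D X 0 1 (by decide)).map y) ≫
      m' = m ≫ (resEdge D X 0 2 (by decide)).map k)
    {n : ℕ} (a b c : Fin (n + 1)) (hab : a ≤ b) (hbc : b ≤ c) :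
    ((resEdge D X b c hbc).map x ⊗ₘ (resEdge D X a b hab).map y) ≫ resMul m' a b c hab hbc =
      resMul m a b c hab hbc ≫ (resEdge D X a c (hab.trans hbc)).map k :=
  D.pullMul_naturality (triangle X a b c hab hbc) _ _ _ H

lemma resMul_naturality_left {F F' G K K' : HallCat D X} {m : HallMul F G K} {m' : HallMul F' G K'}
    {x : F ⟶ F'} {k : K ⟶ K'}
    (H : ((resEdge D X (n := 2) 1 2 (by decide)).map x ⊗ₘ
      (resEdge D X 0 1 (by decide)).map (𝟙 G)) ≫ m' = m ≫ (resEdge D X 0 2 (by decide)).map k)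
    {n : ℕ} (a b c : Fin (n + 1)) (hab : a ≤ b) (hbc : b ≤ c) :
    ((resEdge D X b c hbc).map x ▷ (resEdge D X a b hab).obj G) ≫ resMul m' a b c hab hbc =
      resMul m a b c hab hbc ≫ (resEdge D X a c (hab.trans hbc)).map k := by
  rw [← resMul_naturality H, CategoryTheory.Functor.map_id, tensorHom_id]

lemma resMul_naturality_right {F G G' K K' : HallCat D X} {m : HallMul F G K} {m' : HallMul F G' K'}
    {y : G ⟶ G'} {k : K ⟶ K'}
    (H : ((resEdge D X (n := 2) 1 2 (by decide)).map (𝟙 F) ⊗ₘ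
      (resEdge D X 0 1 (by decide)).map y) ≫ m' = m ≫ (resEdge D X 0 2 (by decide)).map k)
    {n : ℕ} (a b c : Fin (n + 1)) (hab : a ≤ b) (hbc : b ≤ c) :
    ((resEdge D X b c hbc).obj F ◁ (resEdge D X a b hab).map y) ≫ resMul m' a b c hab hbc =
      resMul m a b c hab hbc ≫ (resEdge D X a c (hab.trans hbc)).map k := by
  rw [← resMul_naturality H, CategoryTheory.Functor.map_id, id_tensorHom]

/-- An associativity equation on `X_3` restricts to all tetrahedra. -/
lemma resMul_associativity {F G H K R L L' : HallCat D X} {m₁ : HallMul F G K}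
    {m₂ : HallMul K H L} {m₃ : HallMul G H R} {m₄ : HallMul F R L'} {a : L ⟶ L'}
    (E : (resMul m₁ (n := 3) 1 2 3 (by decide) (by decide) ▷
          (resEdge D X 0 1 (by decide)).obj H) ≫
        resMul m₂ 0 1 3 (by decide) (by decide) ≫ (resEdge D X 0 3 (by decide)).map a =
      (α_ _ _ _).hom ≫ ((resEdge D X 2 3 (by decide)).obj F ◁
          resMul m₃ (n := 3) 0 1 2 (by decide) (by decide)) ≫
          resMul m₄ 0 2 3 (by decide) (by decide))
    {n : ℕ} (i j k l : Fin (n + 1)) (hij : i ≤ j) (hjk : j ≤ k) (hkl : k ≤ l) :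
    (resMul m₁ j k l hjk hkl ▷ (resEdge D X i j hij).obj H) ≫
        resMul m₂ i j l hij (hjk.trans hkl) ≫
          (resEdge D X i l (hij.trans (hjk.trans hkl))).map a =
      (α_ _ _ _).hom ≫ ((resEdge D X k l hkl).obj F ◁ resMul m₃ i j k hij hjk) ≫
          resMul m₄ i k l (hij.trans hjk) hkl := by
  let e := tetrahedronMap i j k l hij hjk hkl
  rw [← resMul_simplicialMap m₁ e (a := 1) (b := 2) (c := 3) (by decide) (by decide) hjk hkl
      rfl rfl rfl,
    ← resMul_simplicialMap m₂ e (a := 0) (b := 1) (c := 3) (by decide) (by decide) hij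
      (hjk.trans hkl) rfl rfl rfl,
    ← resMul_simplicialMap m₃ e (a := 0) (b := 1) (c := 2) (by decide) (by decide) hij hjk
      rfl rfl rfl,
    ← resMul_simplicialMap m₄ e (a := 0) (b := 2) (c := 3) (by decide) (by decide) (hij.trans hjk)
      hkl rfl rfl rfl]
  exact D.pullMul_associativity (simplicialMap X e) _ _ _ _ _ _ E

/-- A left unit equation on `X_1` restricts to all edges. -/
lemma resMul_unit_left {U F K : HallCat D X}
    {t : 𝟙_ (D.obj (X _⦋0⦌)) ⟶ (resEdge D X (n := 0) 0 0 le_rfl).obj U} {m : HallMul U F K}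
    {k : K ⟶ F}
    (E : (resUnit t (n := 1) 1 ▷ (resEdge D X 0 1 (by decide)).obj F) ≫
        resMul m 0 1 1 (by decide) (by decide) ≫ (resEdge D X 0 1 (by decide)).map k =
      (λ_ _).hom) {n : ℕ} (i j : Fin (n + 1)) (hij : i ≤ j) :
    (resUnit t j ▷ (resEdge D X i j hij).obj F) ≫ resMul m i j j hij le_rfl ≫
      (resEdge D X i j hij).map k = (λ_ _).hom := by
  let e := SimplexCategory.mkOfLe i j hij
  rw [← resMul_simplicialMap m e (a := 0) (b := 1) (c := 1) (by decide) (by decide) hij le_rfl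
      rfl rfl rfl, ← resUnit_simplicialMap t e (a := 1) (i := j) rfl]
  exact D.pullMul_unit_left (simplicialMap X e) _ _ E

/-- A right unit equation on `X_1` restricts to all edges. -/
lemma resMul_unit_right {U F K : HallCat D X}
    {t : 𝟙_ (D.obj (X _⦋0⦌)) ⟶ (resEdge D X (n := 0) 0 0 le_rfl).obj U} {m : HallMul F U K}
    {k : K ⟶ F}
    (E : ((resEdge D X 0 1 (by decide)).obj F ◁ resUnit t (n := 1) 0) ≫
        resMul m 0 0 1 (by decide) (by decide) ≫ (resEdge D X 0 1 (by decide)).map k =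
      (ρ_ _).hom) {n : ℕ} (i j : Fin (n + 1)) (hij : i ≤ j) :
    ((resEdge D X i j hij).obj F ◁ resUnit t i) ≫ resMul m i i j le_rfl hij ≫
      (resEdge D X i j hij).map k = (ρ_ _).hom := by
  let e := SimplexCategory.mkOfLe i j hij
  rw [← resMul_simplicialMap m e (a := 0) (b := 0) (c := 1) (by decide) (by decide) le_rfl hij
      rfl rfl rfl, ← resUnit_simplicialMap t e (a := 0) (i := i) rfl]
  exact D.pullMul_unit_right (simplicialMap X e) _ _ E

end HallRestriction

/-! ### Iterated Hall products -/

section HallLan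

variable {D : MonoidalPrederivator.{w, z, u}} {X : SimplicialObject Grpd.{u, u}}
  (hD : D.IsCocontinuousLeftDerivator) (hX : IsTwoSegal X)

include hD hX

/-- A left-bracketed triple product is the left Kan extension along `{0, 3}` of the product of the
three factors on `X_3`. -/
lemma isLan_resMul_left {F G H K L : HallCat D X} {m₁ : HallMul F G K} {m₂ : HallMul K H L}
    (h₁ : D.IsLan (edge X 0 2 (by decide)) m₁) (h₂ : D.IsLan (edge X 0 2 (by decide)) m₂) :
    D.IsLan (edge X 0 3 (by decide)) ((resMul m₁ (n := 3) 1 2 3 (by decide) (by decide) ▷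
          (resEdge D X 0 1 (by decide)).obj H) ≫ resMul m₂ 0 1 3 (by decide) (by decide)) :=
  MonoidalPrederivator.IsLan.mul_whiskerRight_comp hD hX.square₁₂₃ h₁ h₂ _ _ _ _ _ _

/-- A right-bracketed triple product is the left Kan extension along `{0, 3}` of the product of the
three factors on `X_3`. -/
lemma isLan_resMul_right {F G H R L : HallCat D X} {m₃ : HallMul G H R} {m₄ : HallMul F R L}
    (h₃ : D.IsLan (edge X 0 2 (by decide)) m₃) (h₄ : D.IsLan (edge X 0 2 (by decide)) m₄) :
    D.IsLan (edge X 0 3 (by decide)) (((resEdge D X 2 3 (by decide)).obj F ◁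
          resMul m₃ (n := 3) 0 1 2 (by decide) (by decide)) ≫
          resMul m₄ 0 2 3 (by decide) (by decide)) :=
  MonoidalPrederivator.IsLan.mul_whiskerLeft_comp hD hX.square₀₁₂ h₃ h₄ _ _ _ _ _ _

/-- A left-bracketed quadruple product is the left Kan extension along `{0, 4}` of the product of
the four factors on `X_4`. -/
lemma isLan_resMul_resMul {F G H K FG FGH FGHK : HallCat D X} {m₁ : HallMul F G FG}
    {m₂ : HallMul FG H FGH} {m₃ : HallMul FGH K FGHK}
    (h₁ : D.IsLan (edge X 0 2 (by decide)) m₁) (h₂ : D.IsLan (edge X 0 2 (by decide)) m₂)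
    (h₃ : D.IsLan (edge X 0 2 (by decide)) m₃) :
    D.IsLan (edge X 0 4 (by decide)) ((((resMul m₁ (n := 4) 2 3 4 (by decide) (by decide) ▷
      (resEdge D X 1 2 (by decide)).obj H) ≫ resMul m₂ 1 2 4 (by decide) (by decide)) ▷
        (resEdge D X 0 1 (by decide)).obj K) ≫ resMul m₃ 0 1 4 (by decide) (by decide)) := by
  let e := tetrahedronMap (n := 4) 1 2 3 4 (by decide) (by decide) (by decide)
  rw [← resMul_simplicialMap m₁ e (a := 1) (b := 2) (c := 3) (by decide) (by decide)
      (i := 2) (j := 3) (k := 4) (by decide) (by decide) rfl rfl rfl,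
    ← resMul_simplicialMap m₂ e (a := 0) (b := 1) (c := 3) (by decide) (by decide)
      (i := 1) (j := 2) (k := 4) (by decide) (by decide) rfl rfl rfl]
  exact MonoidalPrederivator.IsLan.mul_mul_whiskerRight_comp hD hX.square₁₂₃₄
    (isLan_resMul_left hD hX h₁ h₂) h₃ _ _ _ _ (edge_simplicialMap X e 0 3 _ _ rfl rfl) _ _ _

lemma isLan_resMul_unit_left {U F K : HallCat D X}
    {t : 𝟙_ (D.obj (X _⦋0⦌)) ⟶ (resEdge D X (n := 0) 0 0 le_rfl).obj U} {m : HallMul U F K}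
    (ht : D.IsLan (edge X (n := 0) 0 0 le_rfl) t) (hm : D.IsLan (edge X 0 2 (by decide)) m) :
    D.IsLan (edge X 0 1 (by decide)) ((resUnit t (n := 1) 1 ▷
      (resEdge D X 0 1 (by decide)).obj F) ≫ resMul m 0 1 1 (by decide) (by decide)) :=
  MonoidalPrederivator.IsLan.unit_whiskerRight_comp hD hX.square₀₁₁ ht hm _ _ _ _

lemma isLan_resMul_unit_right {U F K : HallCat D X}
    {t : 𝟙_ (D.obj (X _⦋0⦌)) ⟶ (resEdge D X (n := 0) 0 0 le_rfl).obj U} {m : HallMul F U K}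
    (ht : D.IsLan (edge X (n := 0) 0 0 le_rfl) t) (hm : D.IsLan (edge X 0 2 (by decide)) m) :
    D.IsLan (edge X 0 1 (by decide)) (((resEdge D X 0 1 (by decide)).obj F ◁
      resUnit t (n := 1) 0) ≫ resMul m 0 0 1 (by decide) (by decide)) :=
  MonoidalPrederivator.IsLan.unit_whiskerLeft_comp hD hX.square₀₀₁ ht hm _ _ _ _

end HallLan

/-! ### The Hall monoidal category -/

section HallAlgebra

open MonoidalPrederivator

variable {D : MonoidalPrederivator.{w, z, u}} {X : SimplicialObject Grpd.{u, u}}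
  (hD : D.IsCocontinuousLeftDerivator) (hX : IsTwoSegal X)

/-- The Hall tensor product. -/
noncomputable def hallTensor (F G : HallCat D X) : HallCat D X :=
  lanTensor hD (edge X (n := 2) 1 2 (by decide)) (edge X 0 1 (by decide)) (edge X 0 2 (by decide))
    F G

/-- The universal multiplication map of the Hall tensor product. -/
noncomputable def hallMul (F G : HallCat D X) : HallMul F G (hallTensor hD F G) :=
  lanMul hD (edge X (n := 2) 1 2 (by decide)) (edge X 0 1 (by decide)) (edge X 0 2 (by decide)) F G

lemma isLan_hallMul (F G : HallCat D X) :
    D.IsLan (edge X 0 2 (by decide)) (hallMul hD F G) :=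
  isLan_lanMul hD _ _ _ F G

/-- The Hall tensor product of morphisms. -/
noncomputable def hallTensorMap {F F' G G' : HallCat D X} (x : F ⟶ F') (y : G ⟶ G') :
    hallTensor hD F G ⟶ hallTensor hD F' G' :=
  lanTensorMap hD (edge X (n := 2) 1 2 (by decide)) (edge X 0 1 (by decide))
    (edge X 0 2 (by decide)) x y

lemma hallMul_naturality {F F' G G' : HallCat D X} (x : F ⟶ F') (y : G ⟶ G') :
    ((resEdge D X (n := 2) 1 2 (by decide)).map x ⊗ₘ (resEdge D X 0 1 (by decide)).map y) ≫
        hallMul hD F' G' =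
      hallMul hD F G ≫ (resEdge D X 0 2 (by decide)).map (hallTensorMap hD x y) :=
  lanMul_naturality hD _ _ _ x y

variable (X) in
/-- The Hall unit. -/
noncomputable def hallUnit : HallCat D X :=
  lan hD (edge X (n := 0) 0 0 le_rfl) (𝟙_ _)

variable (X) in
/-- The universal unit map of the Hall unit. -/
noncomputable def hallOne : 𝟙_ (D.obj (X _⦋0⦌)) ⟶
    (resEdge D X (n := 0) 0 0 le_rfl).obj (hallUnit X hD) :=
  lanUnit hD (edge X (n := 0) 0 0 le_rfl) (𝟙_ _)

lemma isLan_hallOne : D.IsLan (edge X (n := 0) 0 0 le_rfl) (hallOne X hD) :=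
  isLan_lanUnit hD _ _

lemma edge_zero_one_eq_id : edge X (n := 1) 0 1 (by decide) = 𝟭 _ :=
  (congrArg (simplicialMap X) (SimplexCategory.Hom.ext_one_left _ (𝟙 ⦋1⦌))).trans (X.map_id _)

lemma resMul_zero_one_two {F G K : HallCat D X} (m : HallMul F G K) :
    resMul m (n := 2) 0 1 2 (by decide) (by decide) = m :=
  pullMul_id ((congrArg (simplicialMap X) (by ext k; fin_cases k <;> rfl)).trans (X.map_id _))
    _ _ _ _

/-- If a right unit equation holds for an isomorphism, then multiplication by the unit map is an
isomorphism on all edges. -/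
lemma isIso_of_unit_right {U F K : HallCat D X}
    {t : 𝟙_ (D.obj (X _⦋0⦌)) ⟶ (resEdge D X (n := 0) 0 0 le_rfl).obj U} {m : HallMul F U K}
    {k : K ≅ F}
    (E : ((resEdge D X 0 1 (by decide)).obj F ◁ resUnit t (n := 1) 0) ≫
        resMul m 0 0 1 (by decide) (by decide) ≫ (resEdge D X 0 1 (by decide)).map k.hom =
      (ρ_ _).hom) {n : ℕ} (i j : Fin (n + 1)) (hij : i ≤ j) :
    IsIso (((resEdge D X i j hij).obj F ◁ resUnit t i) ≫ resMul m i i j le_rfl hij) := by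
  have h := resMul_unit_right E i j hij
  rw [← Category.assoc] at h
  -- The composite with the isomorphism `k` is a right unitor.
  have : IsIso ((((resEdge D X i j hij).obj F ◁ resUnit t i) ≫ resMul m i i j le_rfl hij) ≫
      (resEdge D X i j hij).map k.hom) := by
    rw [h]
    infer_instance
  exact IsIso.of_isIso_comp_right _ ((resEdge D X i j hij).map k.hom)

include hX

/-- The associator compares two left Kan extensions of the same product on `X_3`. -/
lemma exists_hallAssociator (F G H : HallCat D X) :
    ∃ a : hallTensor hD (hallTensor hD F G) H ≅ hallTensor hD F (hallTensor hD G H),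
      (resMul (hallMul hD F G) (n := 3) 1 2 3 (by decide) (by decide) ▷
          (resEdge D X 0 1 (by decide)).obj H) ≫
        resMul (hallMul hD (hallTensor hD F G) H) 0 1 3 (by decide) (by decide) ≫
          (resEdge D X 0 3 (by decide)).map a.hom =
      (α_ _ _ _).hom ≫
        ((resEdge D X 2 3 (by decide)).obj F ◁
          resMul (hallMul hD G H) (n := 3) 0 1 2 (by decide) (by decide)) ≫
          resMul (hallMul hD F (hallTensor hD G H)) 0 2 3 (by decide) (by decide) := by
  obtain ⟨a, ha⟩ := (isLan_resMul_left hD hX (isLan_hallMul hD F G)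
    (isLan_hallMul hD (hallTensor hD F G) H)).exists_iso
    ((isLan_resMul_right hD hX (isLan_hallMul hD G H)
      (isLan_hallMul hD F (hallTensor hD G H))).iso_comp (α_ _ _ _).hom)
  exact ⟨a, (Category.assoc _ _ _).symm.trans ha⟩

/-- The left unitor compares two left Kan extensions along the edge `{0, 1}` of `X_1`, which is the
identity. -/
lemma exists_hallLeftUnitor (F : HallCat D X) :
    ∃ l : hallTensor hD (hallUnit X hD) F ≅ F,
      (resUnit (hallOne X hD) (n := 1) 1 ▷ (resEdge D X 0 1 (by decide)).obj F) ≫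
        resMul (hallMul hD (hallUnit X hD) F) 0 1 1 (by decide) (by decide) ≫
          (resEdge D X 0 1 (by decide)).map l.hom = (λ_ _).hom := by
  obtain ⟨a, ha⟩ := (isLan_resMul_unit_left hD hX (isLan_hallOne hD)
    (isLan_hallMul hD (hallUnit X hD) F)).exists_iso
      (@isLan_of_isIso D _ _ edge_zero_one_eq_id _ _
        (λ_ ((resEdge D X (n := 1) 0 1 (Fin.zero_le _)).obj F)).hom (Iso.isIso_hom _))
  exact ⟨a, (Category.assoc _ _ _).symm.trans ha⟩

/-- The right unitor compares two left Kan extensions along the edge `{0, 1}` of `X_1`, which is the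
identity. -/
lemma exists_hallRightUnitor (F : HallCat D X) :
    ∃ r : hallTensor hD F (hallUnit X hD) ≅ F,
      ((resEdge D X 0 1 (by decide)).obj F ◁ resUnit (hallOne X hD) (n := 1) 0) ≫
        resMul (hallMul hD F (hallUnit X hD)) 0 0 1 (by decide) (by decide) ≫
          (resEdge D X 0 1 (by decide)).map r.hom = (ρ_ _).hom := by
  obtain ⟨a, ha⟩ := (isLan_resMul_unit_right hD hX (isLan_hallOne hD)
    (isLan_hallMul hD F (hallUnit X hD))).exists_iso
      (@isLan_of_isIso D _ _ edge_zero_one_eq_id _ _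
        (ρ_ ((resEdge D X (n := 1) 0 1 (Fin.zero_le _)).obj F)).hom (Iso.isIso_hom _))
  exact ⟨a, (Category.assoc _ _ _).symm.trans ha⟩

/-- The structure morphisms of the Hall monoidal category. -/
@[reducible]
noncomputable def hallMonoidalStruct : MonoidalCategoryStruct (HallCat D X) where
  tensorObj := hallTensor hD
  whiskerLeft F _ _ y := hallTensorMap hD (𝟙 F) y
  whiskerRight x G := hallTensorMap hD x (𝟙 G)
  tensorHom x y := hallTensorMap hD x y
  tensorUnit := hallUnit X hD
  associator F G H := (exists_hallAssociator hD hX F G H).choose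
  leftUnitor F := (exists_hallLeftUnitor hD hX F).choose
  rightUnitor F := (exists_hallRightUnitor hD hX F).choose

/-- The Hall monoidal category. -/
@[reducible]
noncomputable def hallMonoidalCategory : MonoidalCategory (HallCat D X) :=
  letI := hallMonoidalStruct hD hX
  MonoidalCategory.ofTensorHom
    (id_tensorHom_id := fun F G => lanTensorMap_id hD _ _ _ F G)
    (id_tensorHom := fun _ _ _ _ => rfl)
    (tensorHom_id := fun _ _ => rfl)
    (tensorHom_comp_tensorHom := fun x y x' y' =>
      (lanTensorMap_comp hD _ _ _ x y x' y').symm)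
    (associator_naturality := fun {F G H F' G' H'} x y z => by
      refine (isLan_resMul_left hD hX (isLan_hallMul hD F G)
        (isLan_hallMul hD (hallTensor hD F G) H) _).1 ?_
      have h := associator_naturality_of_mul
        (exists_hallAssociator hD hX F G H).choose_spec
        (exists_hallAssociator hD hX F' G' H').choose_spec
        (resMul_naturality (hallMul_naturality hD x y) _ _ _ _ _)
        (resMul_naturality (hallMul_naturality hD y z) _ _ _ _ _)
        (resMul_naturality (hallMul_naturality hD (hallTensorMap hD x y) z) _ _ _ _ _)
        (resMul_naturality (hallMul_naturality hD x (hallTensorMap hD y z)) _ _ _ _ _)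
      simp only [← Functor.map_comp] at h
      exact h)
    (leftUnitor_naturality := fun {F G} x => by
      refine (isLan_resMul_unit_left hD hX (isLan_hallOne hD)
        (isLan_hallMul hD (hallUnit X hD) F) _).1 ?_
      have h := leftUnitor_naturality_of_mul
        (exists_hallLeftUnitor hD hX F).choose_spec
        (exists_hallLeftUnitor hD hX G).choose_spec
        (resMul_naturality_right (hallMul_naturality hD (𝟙 _) x) _ _ _ _ _)
      simp only [← Functor.map_comp] at h
      exact h)
    (rightUnitor_naturality := fun {F G} x => by
      refine (isLan_resMul_unit_right hD hX (isLan_hallOne hD)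
        (isLan_hallMul hD F (hallUnit X hD)) _).1 ?_
      have h := rightUnitor_naturality_of_mul
        (exists_hallRightUnitor hD hX F).choose_spec
        (exists_hallRightUnitor hD hX G).choose_spec
        (resMul_naturality_left (hallMul_naturality hD x (𝟙 _)) _ _ _ _ _)
      simp only [← Functor.map_comp] at h
      exact h)
    (pentagon := fun F G H K => by
      refine (isLan_resMul_resMul hD hX (isLan_hallMul hD F G)
        (isLan_hallMul hD (hallTensor hD F G) H)
        (isLan_hallMul hD (hallTensor hD (hallTensor hD F G) H) K) _).1 ?_
      have h := pentagon_of_mul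
        (resMul_associativity (exists_hallAssociator hD hX F G H).choose_spec (n := 4) 1 2 3 4
          (by decide) (by decide) (by decide))
        (resMul_associativity (exists_hallAssociator hD hX G H K).choose_spec (n := 4) 0 1 2 3
          (by decide) (by decide) (by decide))
        (resMul_associativity (exists_hallAssociator hD hX F (hallTensor hD G H) K).choose_spec
          (n := 4) 0 1 3 4 (by decide) (by decide) (by decide))
        (resMul_associativity (exists_hallAssociator hD hX (hallTensor hD F G) H K).choose_spec
          (n := 4) 0 1 2 4 (by decide) (by decide) (by decide))
        (resMul_associativity (exists_hallAssociator hD hX F G (hallTensor hD H K)).choose_spec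
          (n := 4) 0 2 3 4 (by decide) (by decide) (by decide))
        (resMul_naturality_left (hallMul_naturality hD _ (𝟙 K)) _ _ _ _ _)
        (resMul_naturality_right (hallMul_naturality hD (𝟙 F) _) _ _ _ _ _)
      simp only [← Functor.map_comp] at h
      exact h)
    (triangle := fun F K => by
      have h := triangle_of_mul
        (resMul_unit_right (exists_hallRightUnitor hD hX F).choose_spec (n := 2) 1 2 (by decide))
        (resMul_unit_left (exists_hallLeftUnitor hD hX K).choose_spec (n := 2) 0 1 (by decide))
        (resMul_associativity (exists_hallAssociator hD hX F (hallUnit X hD) K).choose_spec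
          (n := 2) 0 1 1 2 (by decide) (by decide) (by decide))
        (resMul_naturality_left (hallMul_naturality hD _ (𝟙 K)) _ _ _ _ _)
        (resMul_naturality_right (hallMul_naturality hD (𝟙 F) _) _ _ _ _ _)
      -- The map to `(F ⊗ 𝟙_) ⊗ K` used here is still a left Kan extension, because
      -- multiplication by the unit map is an isomorphism.
      have := isIso_of_unit_right (exists_hallRightUnitor hD hX F).choose_spec (n := 2) 1 2
        (by decide)
      have hL := (isLan_hallMul hD (hallTensor hD F (hallUnit X hD)) K).iso_comp
        ((((resEdge D X (n := 2) 1 2 (by decide)).obj F ◁ resUnit (hallOne X hD) 1) ≫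
          resMul (hallMul hD F (hallUnit X hD)) 1 1 2 le_rfl (by decide)) ▷
            (resEdge D X 0 1 _).obj K)
      simp only [← Functor.map_comp, resMul_zero_one_two] at h
      exact (hL _).1 h)

/-- The structure maps of the Hall monoidal category. -/
noncomputable def hallStructure :
    letI := hallMonoidalCategory hD hX
    HallStructure D X :=
  letI := hallMonoidalCategory hD hX
  { mul := hallMul hD
    mul_isLan := isLan_hallMul hD
    unit := hallOne X hD
    unit_isLan := isLan_hallOne hD
    mul_naturality := hallMul_naturality hD
    mul_assoc := fun F G H => (exists_hallAssociator hD hX F G H).choose_spec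
    unit_mul := fun F => (exists_hallLeftUnitor hD hX F).choose_spec
    mul_unit := fun F => (exists_hallRightUnitor hD hX F).choose_spec }

end HallAlgebra

/-! ### Multiplication maps on relative simplices -/

section RelativeRestriction

variable {D : MonoidalPrederivator.{w, z, u}} {X Y : SimplicialObject Grpd.{u, u}} (Φ : Y ⟶ X)

lemma relEdge_simplicialMap {m n : ℕ} (e : ⦋m⦌ ⟶ ⦋n⦌) (a b : Fin (m + 1)) (hab : a ≤ b)
    {i j : Fin (n + 1)} (hij : i ≤ j) (hi : e a = i) (hj : e b = j) :
    component Φ n ⋙ edge X i j hij = simplicialMap Y e ⋙ component Φ m ⋙ edge X a b hab := by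
  rw [edge_simplicialMap X e a b hab hij hi hj, ← Functor.assoc, ← component_naturality,
    Functor.assoc]

lemma relMul_eq_pullMul {F G K : HallCat D X} (m : HallMul F G K) {n : ℕ} (i j k : Fin (n + 1))
    (hij : i ≤ j) (hjk : j ≤ k) :
    relMul Φ m i j k hij hjk = D.pullMul (component Φ n) rfl rfl rfl (resMul m i j k hij hjk) :=
  (D.pullMul_pullMul _ _ rfl _ _ _ _ _ _ _ _ _ _).symm

lemma relUnit_eq_pullUnit {U : HallCat D X}
    (t : 𝟙_ (D.obj (X _⦋0⦌)) ⟶ (resEdge D X (n := 0) 0 0 le_rfl).obj U) {n : ℕ}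
    (i : Fin (n + 1)) :
    relUnit Φ t i = D.pullUnit (component Φ n) rfl (resUnit t i) :=
  (D.pullUnit_pullUnit _ _ rfl _ _ _ _).symm

lemma relUnit_simplicialMap {U : HallCat D X}
    (t : 𝟙_ (D.obj (X _⦋0⦌)) ⟶ (resEdge D X (n := 0) 0 0 le_rfl).obj U)
    {n n' : ℕ} (e : ⦋n⦌ ⟶ ⦋n'⦌) {a : Fin (n + 1)} {i : Fin (n' + 1)} (hi : e a = i) :
    D.pullUnit (simplicialMap Y e) (relEdge_simplicialMap Φ e a a le_rfl le_rfl hi hi)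
      (relUnit Φ t a) = relUnit Φ t i :=
  D.pullUnit_pullUnit _ _ (by
    rw [vertex_simplicialMap X e a hi, ← Functor.assoc, ← component_naturality,
      Functor.assoc]) _ _ _ _

lemma relMul_simplicialMap {F G K : HallCat D X} (m : HallMul F G K) {n n' : ℕ} (e : ⦋n⦌ ⟶ ⦋n'⦌)
    {a b c : Fin (n + 1)} (hab : a ≤ b) (hbc : b ≤ c) {i j k : Fin (n' + 1)} (hij : i ≤ j)
    (hjk : j ≤ k) (hi : e a = i) (hj : e b = j) (hk : e c = k) :
    D.pullMul (simplicialMap Y e) (relEdge_simplicialMap Φ e b c hbc hjk hj hk)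
      (relEdge_simplicialMap Φ e a b hab hij hi hj)
      (relEdge_simplicialMap Φ e a c (hab.trans hbc) (hij.trans hjk) hi hk)
      (relMul Φ m a b c hab hbc) = relMul Φ m i j k hij hjk :=
  D.pullMul_pullMul _ _ (by
    rw [triangle_simplicialMap X e a b c hab hbc hij hjk hi hj hk, ← Functor.assoc,
      ← component_naturality, Functor.assoc]) _ _ _ _ _ _ _ _ _ _

lemma relMul_naturality {F F' G G' K K' : HallCat D X} {m : HallMul F G K} {m' : HallMul F' G' K'}
    {x : F ⟶ F'} {y : G ⟶ G'} {k : K ⟶ K'}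
    (H : ((resEdge D X (n := 2) 1 2 (by decide)).map x ⊗ₘ (resEdge D X 0 1 (by decide)).map y) ≫
      m' = m ≫ (resEdge D X 0 2 (by decide)).map k)
    {n : ℕ} (a b c : Fin (n + 1)) (hab : a ≤ b) (hbc : b ≤ c) :
    ((relEdge D Φ b c hbc).map x ⊗ₘ (relEdge D Φ a b hab).map y) ≫ relMul Φ m' a b c hab hbc =
      relMul Φ m a b c hab hbc ≫ (relEdge D Φ a c (hab.trans hbc)).map k :=
  D.pullMul_naturality (component Φ n ⋙ triangle X a b c hab hbc) _ _ _ H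

/-- An associativity equation on `X_3` restricts to all tetrahedra in `Y`. -/
lemma relMul_associativity {F G H K R L L' : HallCat D X} {m₁ : HallMul F G K}
    {m₂ : HallMul K H L} {m₃ : HallMul G H R} {m₄ : HallMul F R L'} {a : L ⟶ L'}
    (E : (resMul m₁ (n := 3) 1 2 3 (by decide) (by decide) ▷
          (resEdge D X 0 1 (by decide)).obj H) ≫
        resMul m₂ 0 1 3 (by decide) (by decide) ≫ (resEdge D X 0 3 (by decide)).map a =
      (α_ _ _ _).hom ≫ ((resEdge D X 2 3 (by decide)).obj F ◁
          resMul m₃ (n := 3) 0 1 2 (by decide) (by decide)) ≫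
          resMul m₄ 0 2 3 (by decide) (by decide))
    {n : ℕ} (i j k l : Fin (n + 1)) (hij : i ≤ j) (hjk : j ≤ k) (hkl : k ≤ l) :
    (relMul Φ m₁ j k l hjk hkl ▷ (relEdge D Φ i j hij).obj H) ≫
        relMul Φ m₂ i j l hij (hjk.trans hkl) ≫
          (relEdge D Φ i l (hij.trans (hjk.trans hkl))).map a =
      (α_ _ _ _).hom ≫ ((relEdge D Φ k l hkl).obj F ◁ relMul Φ m₃ i j k hij hjk) ≫
          relMul Φ m₄ i k l (hij.trans hjk) hkl := by
  simp only [relMul_eq_pullMul]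
  exact D.pullMul_associativity (component Φ n) rfl rfl rfl rfl rfl rfl
    (resMul_associativity E i j k l hij hjk hkl)

/-- A left unit equation on `X_1` restricts to all edges in `Y`. -/
lemma relMul_unit_left {U F K : HallCat D X}
    {t : 𝟙_ (D.obj (X _⦋0⦌)) ⟶ (resEdge D X (n := 0) 0 0 le_rfl).obj U} {m : HallMul U F K}
    {k : K ⟶ F}
    (E : (resUnit t (n := 1) 1 ▷ (resEdge D X 0 1 (by decide)).obj F) ≫
        resMul m 0 1 1 (by decide) (by decide) ≫ (resEdge D X 0 1 (by decide)).map k =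
      (λ_ _).hom) {n : ℕ} (i j : Fin (n + 1)) (hij : i ≤ j) :
    (relUnit Φ t j ▷ (relEdge D Φ i j hij).obj F) ≫ relMul Φ m i j j hij le_rfl ≫
      (relEdge D Φ i j hij).map k = (λ_ _).hom := by
  simp only [relMul_eq_pullMul, relUnit_eq_pullUnit]
  exact D.pullMul_unit_left (component Φ n) rfl rfl (resMul_unit_left E i j hij)

/-- A right unit equation on `X_1` restricts to all edges in `Y`. -/
lemma relMul_unit_right {U F K : HallCat D X}
    {t : 𝟙_ (D.obj (X _⦋0⦌)) ⟶ (resEdge D X (n := 0) 0 0 le_rfl).obj U} {m : HallMul F U K}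
    {k : K ⟶ F}
    (E : ((resEdge D X 0 1 (by decide)).obj F ◁ resUnit t (n := 1) 0) ≫
        resMul m 0 0 1 (by decide) (by decide) ≫ (resEdge D X 0 1 (by decide)).map k =
      (ρ_ _).hom) {n : ℕ} (i j : Fin (n + 1)) (hij : i ≤ j) :
    ((relEdge D Φ i j hij).obj F ◁ relUnit Φ t i) ≫ relMul Φ m i i j le_rfl hij ≫
      (relEdge D Φ i j hij).map k = (ρ_ _).hom := by
  simp only [relMul_eq_pullMul, relUnit_eq_pullUnit]
  exact D.pullMul_unit_right (component Φ n) rfl rfl (resMul_unit_right E i j hij)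

end RelativeRestriction

/-! ### Relative 2-Segal squares in low dimensions -/

section RelativeSquares

variable {X Y : SimplicialObject Grpd.{u, u}} {Φ : Y ⟶ X} (hΦ : IsTwoSegalMorphism Φ)
include hΦ

/-- The polygon `{0, 1, 2, +∞}` is cut along the diagonal `{1, +∞}`. -/
lemma IsTwoSegalMorphism.square₁₂ : IsTwoPullback (edge Y (n := 2) 1 2 (by decide))
    (edge Y 0 1 (by decide)) (vertex Y 0) (vertex Y 1)
    (eqToIso ((edge_vertex₀ Y _ _ _).symm.trans (edge_vertex₁ Y _ _ _))) :=
  (hΦ.path 1 1).eqToIso_symm.of_eq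
    (congrArg (simplicialMap Y) (by ext k; fin_cases k <;> rfl))
    (congrArg (simplicialMap Y) (by ext k; fin_cases k <;> rfl)) rfl rfl _

/-- The polygon `{0, 1, 2, 3, +∞}` is cut along the diagonal `{1, +∞}`. -/
lemma IsTwoSegalMorphism.square₁₂₃ : IsTwoPullback
    (triangle Y (n := 3) 1 2 3 (by decide) (by decide))
    (edge Y 0 1 (by decide)) (vertex Y 0) (vertex Y 1)
    (eqToIso ((vertex_simplicialMap Y _ 0 rfl).symm.trans (edge_vertex₁ Y _ _ _))) :=
  (hΦ.path 1 2).eqToIso_symm.of_eq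
    (congrArg (simplicialMap Y) (by ext k; fin_cases k <;> rfl))
    (congrArg (simplicialMap Y) (by ext k; fin_cases k <;> rfl)) rfl rfl _

/-- The polygon `{-∞, 0, 1, 2}` is cut along the diagonal `{-∞, 1}`. -/
lemma IsTwoSegalMorphism.square₀₁ : IsTwoPullback (edge Y (n := 2) 0 1 (by decide))
    (edge Y 1 2 (by decide)) (vertex Y 1) (vertex Y 0)
    (eqToIso ((edge_vertex₁ Y _ _ _).symm.trans (edge_vertex₀ Y _ _ _))) :=
  (hΦ.path 1 1).of_eq
    (congrArg (simplicialMap Y) (by ext k; fin_cases k <;> rfl))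
    (congrArg (simplicialMap Y) (by ext k; fin_cases k <;> rfl)) rfl rfl _

/-- The polygon `{0, 1, 2, +∞}` (or `{-∞, 0, 1, 2}`) is cut along the diagonal `{0, 2}`. -/
lemma IsTwoSegalMorphism.square₀₁₂ : IsTwoPullback
    (component Φ 2 ⋙ triangle X (n := 2) 0 1 2 (by decide) (by decide))
    (edge Y 0 2 (by decide)) (edge X 0 2 (by decide)) (component Φ 1 ⋙ edge X 0 1 (by decide))
    (eqToIso ((congrArg (component Φ 2 ⋙ ·) (triangle_edge₀₂ X _ _ _ _ _)).symm.trans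
      (component_edge_fac Φ _ _ _))) :=
  (hΦ.relative 0 2 0).eqToIso_symm.of_eq
    (congrArg (component Φ 2 ⋙ simplicialMap X ·) (by ext k; fin_cases k <;> rfl))
    (congrArg (simplicialMap Y) (by ext k; fin_cases k <;> rfl)) rfl rfl _

/-- The polygon `{-∞, 0, 1, 2, 3}` is cut along the diagonal `{0, 3}`. -/
lemma IsTwoSegalMorphism.square₀₁₂₃ : IsTwoPullback (component Φ 3) (edge Y 0 3 (by decide))
    (edge X 0 3 (by decide)) (component Φ 1 ⋙ edge X 0 1 (by decide))
    (eqToIso (component_edge_fac Φ 0 3 (by decide))) :=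
  (hΦ.relative 0 3 0).eqToIso_symm.of_eq
    (congrArg (component Φ 3 ⋙ ·) ((congrArg (simplicialMap X)
      (by ext k; fin_cases k <;> rfl)).trans (X.map_id _)))
    (congrArg (simplicialMap Y) (by ext k; fin_cases k <;> rfl)) rfl rfl _

/-- Unitality for the degenerate triangle `{0, 0, +∞}` (or `{-∞, 0, 0}`). -/
lemma IsTwoSegalMorphism.square₀₀ : IsTwoPullback
    (component Φ 0 ⋙ vertex X 0)
    (edge Y (n := 0) 0 0 le_rfl) (edge X 0 0 le_rfl) (component Φ 1 ⋙ edge X 0 1 (by decide))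
    (eqToIso ((congrArg (component Φ 0 ⋙ ·) (vertex_degenerate X _)).symm.trans
      (component_edge_fac Φ 0 0 le_rfl))) :=
  (hΦ.relative 0 0 0).eqToIso_symm.of_eq
    (congrArg (component Φ 0 ⋙ simplicialMap X ·) (by ext k; fin_cases k; rfl))
    (congrArg (simplicialMap Y) (by ext k; fin_cases k <;> rfl)) rfl rfl _

end RelativeSquares

/-! ### The right Hall module -/

section RightModule

open MonoidalPrederivator

variable {D : MonoidalPrederivator.{w, z, u}} {X Y : SimplicialObject Grpd.{u, u}} (Φ : Y ⟶ X)

/-- Right action maps `M|_1 ⊗ F|_{01} ⟶ N|_0` on `Y_1`. -/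
abbrev RightAct (M : D.obj (Y _⦋0⦌)) (F : HallCat D X) (N : D.obj (Y _⦋0⦌)) : Type z :=
  (relVertex D Y (n := 1) 1).obj M ⊗ (relEdge D Φ 0 1 (by decide)).obj F ⟶
      (relVertex D Y 0).obj N

section Restriction

variable {M M' N N' : D.obj (Y _⦋0⦌)} {F F' G : HallCat D X}

lemma resRightAct_simplicialMap (m : RightAct Φ M F N) {n n' : ℕ}
    (e : ⦋n⦌ ⟶ ⦋n'⦌) {a b : Fin (n + 1)} (hab : a ≤ b) {i j : Fin (n' + 1)} (hij : i ≤ j)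
    (hi : e a = i) (hj : e b = j) :
    D.pullMul (simplicialMap Y e) (vertex_simplicialMap Y e b hj)
      (relEdge_simplicialMap Φ e a b hab hij hi hj) (vertex_simplicialMap Y e a hi)
      (resRightAct Φ m a b hab) = resRightAct Φ m i j hij :=
  D.pullMul_pullMul _ _ (edge_simplicialMap Y e a b hab hij hi hj) _ _ _ _ _ _ _ _ _ _

lemma resRightAct_naturality {m : RightAct Φ M F N} {m' : RightAct Φ M' F' N'}
    {x : M ⟶ M'} {y : F ⟶ F'} {k : N ⟶ N'}
    (H : ((relVertex D Y (n := 1) 1).map x ⊗ₘ (relEdge D Φ 0 1 (by decide)).map y) ≫ m' =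
      m ≫ (relVertex D Y 0).map k) {n : ℕ} (a b : Fin (n + 1)) (hab : a ≤ b) :
    ((relVertex D Y b).map x ⊗ₘ (relEdge D Φ a b hab).map y) ≫ resRightAct Φ m' a b hab =
      resRightAct Φ m a b hab ≫ (relVertex D Y a).map k :=
  D.pullMul_naturality (edge Y a b hab) _ _ _ H

lemma resRightAct_naturality_left {m : RightAct Φ M F N} {m' : RightAct Φ M' F N'}
    {x : M ⟶ M'} {k : N ⟶ N'}
    (H : ((relVertex D Y (n := 1) 1).map x ⊗ₘ (relEdge D Φ 0 1 (by decide)).map (𝟙 F)) ≫ m' =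
      m ≫ (relVertex D Y 0).map k) {n : ℕ} (a b : Fin (n + 1)) (hab : a ≤ b) :
    ((relVertex D Y b).map x ▷ (relEdge D Φ a b hab).obj F) ≫ resRightAct Φ m' a b hab =
      resRightAct Φ m a b hab ≫ (relVertex D Y a).map k := by
  rw [← resRightAct_naturality Φ H, CategoryTheory.Functor.map_id, tensorHom_id]

lemma resRightAct_naturality_right {m : RightAct Φ M F N} {m' : RightAct Φ M F' N'}
    {y : F ⟶ F'} {k : N ⟶ N'}
    (H : ((relVertex D Y (n := 1) 1).map (𝟙 M) ⊗ₘ (relEdge D Φ 0 1 (by decide)).map y) ≫ m' =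
      m ≫ (relVertex D Y 0).map k) {n : ℕ} (a b : Fin (n + 1)) (hab : a ≤ b) :
    ((relVertex D Y b).obj M ◁ (relEdge D Φ a b hab).map y) ≫ resRightAct Φ m' a b hab =
      resRightAct Φ m a b hab ≫ (relVertex D Y a).map k := by
  rw [← resRightAct_naturality Φ H, CategoryTheory.Functor.map_id, id_tensorHom]

/-- An associativity equation on `Y_2` restricts to all triangles. -/
lemma resRightAct_associativity {MF L L' : D.obj (Y _⦋0⦌)} {FG : HallCat D X}
    {m₁ : RightAct Φ M F MF} {m₂ : RightAct Φ MF G L} {m₃ : HallMul F G FG}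
    {m₄ : RightAct Φ M FG L'} {a : L ⟶ L'}
    (E : (resRightAct Φ m₁ (n := 2) 1 2 (by decide) ▷ (relEdge D Φ 0 1 (by decide)).obj G) ≫
        resRightAct Φ m₂ 0 1 (by decide) ≫ (relVertex D Y 0).map a =
      (α_ _ _ _).hom ≫ ((relVertex D Y 2).obj M ◁
          relMul Φ m₃ (n := 2) 0 1 2 (by decide) (by decide)) ≫
          resRightAct Φ m₄ 0 2 (by decide))
    {n : ℕ} (i j k : Fin (n + 1)) (hij : i ≤ j) (hjk : j ≤ k) :
    (resRightAct Φ m₁ j k hjk ▷ (relEdge D Φ i j hij).obj G) ≫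
        resRightAct Φ m₂ i j hij ≫ (relVertex D Y i).map a =
      (α_ _ _ _).hom ≫ ((relVertex D Y k).obj M ◁ relMul Φ m₃ i j k hij hjk) ≫
          resRightAct Φ m₄ i k (hij.trans hjk) := by
  let e := SimplexCategory.mkOfLeComp i j k hij hjk
  rw [← resRightAct_simplicialMap Φ m₁ e (a := 1) (b := 2) (by decide) hjk rfl rfl,
    ← resRightAct_simplicialMap Φ m₂ e (a := 0) (b := 1) (by decide) hij rfl rfl,
    ← relMul_simplicialMap Φ m₃ e (a := 0) (b := 1) (c := 2) (by decide) (by decide) hij hjk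
      rfl rfl rfl,
    ← resRightAct_simplicialMap Φ m₄ e (a := 0) (b := 2) (by decide) (hij.trans hjk) rfl rfl]
  exact D.pullMul_associativity (simplicialMap Y e) _ _ _ _ _ _ E

/-- A unit equation on `Y_0` restricts to all vertices. -/
lemma resRightAct_unit {U : HallCat D X}
    {t : 𝟙_ (D.obj (X _⦋0⦌)) ⟶ (resEdge D X (n := 0) 0 0 le_rfl).obj U} {m : RightAct Φ M U N}
    {k : N ⟶ M}
    (E : ((relVertex D Y (n := 0) 0).obj M ◁ relUnit Φ t 0) ≫
        resRightAct Φ m 0 0 le_rfl ≫ (relVertex D Y 0).map k = (ρ_ _).hom)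
    {n : ℕ} (i : Fin (n + 1)) :
    ((relVertex D Y i).obj M ◁ relUnit Φ t i) ≫ resRightAct Φ m i i le_rfl ≫
      (relVertex D Y i).map k = (ρ_ _).hom := by
  let e := SimplexCategory.const ⦋0⦌ ⦋n⦌ i
  rw [← resRightAct_simplicialMap Φ m e (a := 0) (b := 0) le_rfl (i := i) (j := i) le_rfl
      rfl rfl,
    ← relUnit_simplicialMap Φ t e (a := 0) (i := i) rfl]
  exact D.pullMul_unit_right (simplicialMap Y e) _ _ E

/-- If a unit equation holds for an isomorphism, then the action of the unit map is an isomorphism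
on all vertices. -/
lemma isIso_of_resRightAct_unit {U : HallCat D X}
    {t : 𝟙_ (D.obj (X _⦋0⦌)) ⟶ (resEdge D X (n := 0) 0 0 le_rfl).obj U} {m : RightAct Φ M U N}
    {k : N ≅ M}
    (E : ((relVertex D Y (n := 0) 0).obj M ◁ relUnit Φ t 0) ≫
        resRightAct Φ m 0 0 le_rfl ≫ (relVertex D Y 0).map k.hom = (ρ_ _).hom)
    {n : ℕ} (i : Fin (n + 1)) :
    IsIso (((relVertex D Y i).obj M ◁ relUnit Φ t i) ≫ resRightAct Φ m i i le_rfl) := by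
  have h := resRightAct_unit Φ E i
  rw [← Category.assoc] at h
  have : IsIso ((((relVertex D Y i).obj M ◁ relUnit Φ t i) ≫ resRightAct Φ m i i le_rfl) ≫
      (relVertex D Y i).map k.hom) := by
    rw [h]
    infer_instance
  exact IsIso.of_isIso_comp_right _ ((relVertex D Y i).map k.hom)

/-- The product of a universal action map `v` with the unit is a left Kan extension, since the
action of the unit map is an isomorphism. -/
lemma isLan_whiskerRight_resRightAct_unit {U : HallCat D X} {L : D.obj (Y _⦋0⦌)}
    {t : 𝟙_ (D.obj (X _⦋0⦌)) ⟶ (resEdge D X (n := 0) 0 0 le_rfl).obj U} {v : RightAct Φ M F N}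
    {m : RightAct Φ N U L} {k : L ≅ N} (hv : D.IsLan (vertex Y 0) v)
    (E : ((relVertex D Y (n := 0) 0).obj N ◁ relUnit Φ t 0) ≫
        resRightAct Φ m 0 0 le_rfl ≫ (relVertex D Y 0).map k.hom = (ρ_ _).hom) :
    D.IsLan (vertex Y 0) (v ▷ _ ≫ ((relVertex D Y 0).obj N ◁ relUnit Φ t 0) ≫
      resRightAct Φ m 0 0 le_rfl) := by
  have h := resRightAct_unit Φ E (n := 1) 0
  have hL := (hv.iso_comp (ρ_ _).hom).comp_iso k.inv
  have e : ((relVertex D Y (n := 1) 0).obj N ◁ relUnit Φ t 0) ≫ resRightAct Φ m 0 0 le_rfl =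
      (ρ_ _).hom ≫ (relVertex D Y 0).map k.inv := by
    rw [← h, Category.assoc, Category.assoc, ← Functor.map_comp, Iso.hom_inv_id,
      CategoryTheory.Functor.map_id, Category.comp_id]
  have e' : ((ρ_ _).hom ≫ v) ≫ (relVertex D Y 0).map k.inv =
      v ▷ _ ≫ ((relVertex D Y 0).obj N ◁ relUnit Φ t 0) ≫ resRightAct Φ m 0 0 le_rfl := by
    rw [e, rightUnitor_naturality_assoc, Category.assoc]
  exact (congrArg (D.IsLan (vertex Y 0)) e').mp hL

lemma resRightAct_zero_one (m : RightAct Φ M F N) :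
    resRightAct Φ m (n := 1) 0 1 (by decide) = m :=
  pullMul_id edge_zero_one_eq_id _ _ _ _

end Restriction

variable (hD : D.IsCocontinuousLeftDerivator)

section Lan

variable {Φ} {M N L K : D.obj (Y _⦋0⦌)} {F G H FG U : HallCat D X} (hΦ : IsTwoSegalMorphism Φ)
include hD hΦ

/-- `(M F) G` is the left Kan extension along the vertex `0` of the product of the three factors on
`Y_2`. -/
lemma isLan_resRightAct_left {m₁ : RightAct Φ M F N} {m₂ : RightAct Φ N G L}
    (h₁ : D.IsLan (vertex Y 0) m₁) (h₂ : D.IsLan (vertex Y 0) m₂) :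
    D.IsLan (vertex Y 0) ((resRightAct Φ m₁ (n := 2) 1 2 (by decide) ▷
      (relEdge D Φ 0 1 (by decide)).obj G) ≫ resRightAct Φ m₂ 0 1 (by decide)) :=
  IsLan.mul_whiskerRight_comp hD hΦ.square₁₂ h₁ h₂ _ _ _ _ _ _

/-- `M (F G)` is the left Kan extension along the vertex `0` of the product of the three factors on
`Y_2`. -/
lemma isLan_resRightAct_right {m₃ : HallMul F G FG} {m₄ : RightAct Φ M FG L}
    (h₃ : D.IsLan (edge X 0 2 (by decide)) m₃) (h₄ : D.IsLan (vertex Y 0) m₄) :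
    D.IsLan (vertex Y 0) (((relVertex D Y 2).obj M ◁
      relMul Φ m₃ (n := 2) 0 1 2 (by decide) (by decide)) ≫
          resRightAct Φ m₄ 0 2 (by decide)) :=
  IsLan.mul_whiskerLeft_comp hD hΦ.square₀₁₂ h₃ h₄ _ _ _ _ _ _

/-- `((M F) G) H` is the left Kan extension along the vertex `0` of the product of the four factors
on `Y_3`. -/
lemma isLan_resRightAct_resRightAct {m₁ : RightAct Φ M F N} {m₂ : RightAct Φ N G L}
    {m₃ : RightAct Φ L H K} (h₁ : D.IsLan (vertex Y 0) m₁) (h₂ : D.IsLan (vertex Y 0) m₂)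
    (h₃ : D.IsLan (vertex Y 0) m₃) :
    D.IsLan (vertex Y 0) ((((resRightAct Φ m₁ (n := 3) 2 3 (by decide) ▷
      (relEdge D Φ 1 2 (by decide)).obj G) ≫ resRightAct Φ m₂ 1 2 (by decide)) ▷
        (relEdge D Φ 0 1 (by decide)).obj H) ≫ resRightAct Φ m₃ 0 1 (by decide)) := by
  let e : ⦋2⦌ ⟶ ⦋3⦌ := SimplexCategory.mkOfLeComp 1 2 3 (by decide) (by decide)
  rw [← resRightAct_simplicialMap Φ m₁ e (a := 1) (b := 2) (by decide) (i := 2) (j := 3)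
      (by decide) rfl rfl,
    ← resRightAct_simplicialMap Φ m₂ e (a := 0) (b := 1) (by decide) (i := 1) (j := 2)
      (by decide) rfl rfl]
  exact IsLan.mul_mul_whiskerRight_comp hD hΦ.square₁₂₃ (isLan_resRightAct_left hD hΦ h₁ h₂) h₃
    _ _ _ _ _ _ _ _

lemma isLan_resRightAct_unit
    {t : 𝟙_ (D.obj (X _⦋0⦌)) ⟶ (resEdge D X (n := 0) 0 0 le_rfl).obj U} {m : RightAct Φ M U N}
    (ht : D.IsLan (edge X (n := 0) 0 0 le_rfl) t) (hm : D.IsLan (vertex Y 0) m) :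
    D.IsLan (vertex Y 0) (((relVertex D Y (n := 0) 0).obj M ◁ relUnit Φ t 0) ≫
        resRightAct Φ m 0 0 le_rfl) :=
  IsLan.unit_whiskerLeft_comp hD hΦ.square₀₀ ht hm _ _ _ _

end Lan

/-- The right action of the Hall monoidal category on objects. -/
noncomputable def rightAct (M : D.obj (Y _⦋0⦌)) (F : HallCat D X) : D.obj (Y _⦋0⦌) :=
  lanTensor hD (vertex Y (n := 1) 1) (component Φ 1 ⋙ edge X 0 1 (by decide)) (vertex Y 0) M F

/-- The universal right action map. -/
noncomputable def rightActMul (M : D.obj (Y _⦋0⦌)) (F : HallCat D X) :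
    RightAct Φ M F (rightAct Φ hD M F) :=
  lanMul hD (vertex Y (n := 1) 1) (component Φ 1 ⋙ edge X 0 1 (by decide)) (vertex Y 0) M F

lemma isLan_rightActMul (M : D.obj (Y _⦋0⦌)) (F : HallCat D X) :
    D.IsLan (vertex Y 0) (rightActMul Φ hD M F) :=
  isLan_lanMul hD _ _ _ M F

/-- The right action of the Hall monoidal category on morphisms. -/
noncomputable def rightActMap {M M' : D.obj (Y _⦋0⦌)} {F F' : HallCat D X} (x : M ⟶ M')
    (y : F ⟶ F') : rightAct Φ hD M F ⟶ rightAct Φ hD M' F' :=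
  lanTensorMap hD (vertex Y (n := 1) 1) (component Φ 1 ⋙ edge X 0 1 (by decide)) (vertex Y 0) x y

lemma rightActMul_naturality {M M' : D.obj (Y _⦋0⦌)} {F F' : HallCat D X} (x : M ⟶ M')
    (y : F ⟶ F') :
    ((relVertex D Y (n := 1) 1).map x ⊗ₘ (relEdge D Φ 0 1 (by decide)).map y) ≫
        rightActMul Φ hD M' F' =
      rightActMul Φ hD M F ≫ (relVertex D Y 0).map (rightActMap Φ hD x y) :=
  lanMul_naturality hD _ _ _ x y

lemma rightActMap_id (M : D.obj (Y _⦋0⦌)) (F : HallCat D X) :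
    rightActMap Φ hD (𝟙 M) (𝟙 F) = 𝟙 _ :=
  lanTensorMap_id hD _ _ _ M F

lemma rightActMap_comp {M M' M'' : D.obj (Y _⦋0⦌)} {F F' F'' : HallCat D X} (x : M ⟶ M')
    (y : F ⟶ F') (x' : M' ⟶ M'') (y' : F' ⟶ F'') :
    rightActMap Φ hD (x ≫ x') (y ≫ y') = rightActMap Φ hD x y ≫ rightActMap Φ hD x' y' :=
  lanTensorMap_comp hD _ _ _ x y x' y'

variable {Φ} (hΦ : IsTwoSegalMorphism Φ) [MonoidalCategory (HallCat D X)] (H : HallStructure D X)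

lemma vertex_zero_eq_id : vertex Y (n := 0) 0 = 𝟭 _ :=
  (congrArg (simplicialMap Y) (by ext k; fin_cases k; rfl)).trans (Y.map_id _)

include hΦ

/-- The associator compares two left Kan extensions of the same product on `Y_2`. -/
lemma exists_rightActAssociator (M : D.obj (Y _⦋0⦌)) (F G : HallCat D X) :
    ∃ a : rightAct Φ hD (rightAct Φ hD M F) G ≅ rightAct Φ hD M (F ⊗ G),
      (resRightAct Φ (rightActMul Φ hD M F) (n := 2) 1 2 (by decide) ▷
          (relEdge D Φ 0 1 (by decide)).obj G) ≫
        resRightAct Φ (rightActMul Φ hD (rightAct Φ hD M F) G) 0 1 (by decide) ≫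
          (relVertex D Y 0).map a.hom =
      (α_ _ _ _).hom ≫ ((relVertex D Y 2).obj M ◁
          relMul Φ (H.mul F G) (n := 2) 0 1 2 (by decide) (by decide)) ≫
          resRightAct Φ (rightActMul Φ hD M (F ⊗ G)) 0 2 (by decide) := by
  obtain ⟨a, ha⟩ := (isLan_resRightAct_left hD hΦ (isLan_rightActMul Φ hD M F)
    (isLan_rightActMul Φ hD (rightAct Φ hD M F) G)).exists_iso
    ((isLan_resRightAct_right hD hΦ (H.mul_isLan F G)
      (isLan_rightActMul Φ hD M (F ⊗ G))).iso_comp (α_ _ _ _).hom)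
  exact ⟨a, (Category.assoc _ _ _).symm.trans ha⟩

lemma exists_rightActUnitor (M : D.obj (Y _⦋0⦌)) :
    ∃ r : rightAct Φ hD M (𝟙_ (HallCat D X)) ≅ M,
      ((relVertex D Y (n := 0) 0).obj M ◁ relUnit Φ H.unit 0) ≫
        resRightAct Φ (rightActMul Φ hD M (𝟙_ _)) 0 0 le_rfl ≫ (relVertex D Y 0).map r.hom =
      (ρ_ _).hom := by
  obtain ⟨a, ha⟩ := (isLan_resRightAct_unit hD hΦ H.unit_isLan
    (isLan_rightActMul Φ hD M (𝟙_ _))).exists_iso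
      (@isLan_of_isIso D _ _ vertex_zero_eq_id _ _
        (ρ_ ((relVertex D Y (n := 0) 0).obj M)).hom (Iso.isIso_hom _))
  exact ⟨a, (Category.assoc _ _ _).symm.trans ha⟩

/-- The associativity isomorphism `(M F) G ≅ M (F G)`. -/
noncomputable def rightActAssociator (M : D.obj (Y _⦋0⦌)) (F G : HallCat D X) :
    rightAct Φ hD (rightAct Φ hD M F) G ≅ rightAct Φ hD M (F ⊗ G) :=
  (exists_rightActAssociator hD hΦ H M F G).choose

/-- The unit isomorphism `M 𝟙 ≅ M`. -/
noncomputable def rightActUnitor (M : D.obj (Y _⦋0⦌)) :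
    rightAct Φ hD M (𝟙_ (HallCat D X)) ≅ M :=
  (exists_rightActUnitor hD hΦ H M).choose

lemma rightActAssociator_naturality {M M' : D.obj (Y _⦋0⦌)} {F F' G G' : HallCat D X}
    (x : M ⟶ M') (y : F ⟶ F') (z : G ⟶ G') :
    rightActMap Φ hD (rightActMap Φ hD x y) z ≫ (rightActAssociator hD hΦ H M' F' G').hom =
      (rightActAssociator hD hΦ H M F G).hom ≫ rightActMap Φ hD x (y ⊗ₘ z) := by
  refine (isLan_resRightAct_left hD hΦ (isLan_rightActMul Φ hD M F)
    (isLan_rightActMul Φ hD (rightAct Φ hD M F) G) _).1 ?_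
  have h := associator_naturality_of_mul
    (exists_rightActAssociator hD hΦ H M F G).choose_spec
    (exists_rightActAssociator hD hΦ H M' F' G').choose_spec
    (resRightAct_naturality Φ (rightActMul_naturality Φ hD x y) _ _ _)
    (relMul_naturality Φ (H.mul_naturality y z) _ _ _ _ _)
    (resRightAct_naturality Φ (rightActMul_naturality Φ hD (rightActMap Φ hD x y) z) _ _ _)
    (resRightAct_naturality Φ (rightActMul_naturality Φ hD x (y ⊗ₘ z)) _ _ _)
  simp only [← Functor.map_comp] at h
  exact h

lemma rightActUnitor_naturality {M M' : D.obj (Y _⦋0⦌)} (x : M ⟶ M') :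
    rightActMap Φ hD x (𝟙 _) ≫ (rightActUnitor hD hΦ H M').hom =
      (rightActUnitor hD hΦ H M).hom ≫ x := by
  refine (isLan_resRightAct_unit hD hΦ H.unit_isLan (isLan_rightActMul Φ hD M (𝟙_ _)) _).1 ?_
  have h := rightUnitor_naturality_of_mul
    (exists_rightActUnitor hD hΦ H M).choose_spec
    (exists_rightActUnitor hD hΦ H M').choose_spec
    (resRightAct_naturality_left Φ (rightActMul_naturality Φ hD x (𝟙 _)) _ _ _)
  simp only [← Functor.map_comp] at h
  exact h

lemma rightActAssociator_pentagon (M : D.obj (Y _⦋0⦌)) (F G K : HallCat D X) :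
    rightActMap Φ hD (rightActAssociator hD hΦ H M F G).hom (𝟙 K) ≫
        (rightActAssociator hD hΦ H M (F ⊗ G) K).hom ≫ rightActMap Φ hD (𝟙 M) (α_ F G K).hom =
      (rightActAssociator hD hΦ H (rightAct Φ hD M F) G K).hom ≫
        (rightActAssociator hD hΦ H M F (G ⊗ K)).hom := by
  refine (isLan_resRightAct_resRightAct hD hΦ (isLan_rightActMul Φ hD M F)
    (isLan_rightActMul Φ hD (rightAct Φ hD M F) G)
    (isLan_rightActMul Φ hD (rightAct Φ hD (rightAct Φ hD M F) G) K) _).1 ?_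
  have h := pentagon_of_mul
    (resRightAct_associativity Φ (exists_rightActAssociator hD hΦ H M F G).choose_spec
      (n := 3) 1 2 3 (by decide) (by decide))
    (relMul_associativity Φ (H.mul_assoc F G K) (n := 3) 0 1 2 3
      (by decide) (by decide) (by decide))
    (resRightAct_associativity Φ (exists_rightActAssociator hD hΦ H M (F ⊗ G) K).choose_spec
      (n := 3) 0 1 3 (by decide) (by decide))
    (resRightAct_associativity Φ
      (exists_rightActAssociator hD hΦ H (rightAct Φ hD M F) G K).choose_spec
      (n := 3) 0 1 2 (by decide) (by decide))
    (resRightAct_associativity Φ (exists_rightActAssociator hD hΦ H M F (G ⊗ K)).choose_spec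
      (n := 3) 0 2 3 (by decide) (by decide))
    (resRightAct_naturality_left Φ (rightActMul_naturality Φ hD _ (𝟙 K)) _ _ _)
    (resRightAct_naturality_right Φ (rightActMul_naturality Φ hD (𝟙 M) _) _ _ _)
  simp only [← Functor.map_comp] at h
  exact h

lemma rightActAssociator_leftUnitor (M : D.obj (Y _⦋0⦌)) (F : HallCat D X) :
    (rightActAssociator hD hΦ H M (𝟙_ _) F).hom ≫ rightActMap Φ hD (𝟙 M) (λ_ F).hom =
      rightActMap Φ hD (rightActUnitor hD hΦ H M).hom (𝟙 F) := by
  have h := triangle_of_mul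
    (resRightAct_unit Φ (exists_rightActUnitor hD hΦ H M).choose_spec (n := 1) 1)
    (relMul_unit_left Φ (H.unit_mul F) (n := 1) 0 1 (by decide))
    (resRightAct_associativity Φ (exists_rightActAssociator hD hΦ H M (𝟙_ _) F).choose_spec
      (n := 1) 0 1 1 (by decide) (by decide))
    (resRightAct_naturality_left Φ (rightActMul_naturality Φ hD _ (𝟙 F)) _ _ _)
    (resRightAct_naturality_right Φ (rightActMul_naturality Φ hD (𝟙 M) _) _ _ _)
  -- The action of the unit map is an isomorphism, so composing with it preserves left Kan
  -- extensions.
  have := isIso_of_resRightAct_unit Φ (exists_rightActUnitor hD hΦ H M).choose_spec (n := 1) 1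
  have hL := (isLan_rightActMul Φ hD (rightAct Φ hD M (𝟙_ _)) F).iso_comp
    ((((relVertex D Y (n := 1) 1).obj M ◁ relUnit Φ H.unit 1) ≫
      resRightAct Φ (rightActMul Φ hD M (𝟙_ _)) 1 1 le_rfl) ▷
        (relEdge D Φ 0 1 _).obj F)
  simp only [← Functor.map_comp, resRightAct_zero_one] at h
  exact (hL _).1 h

lemma rightActAssociator_rightUnitor (M : D.obj (Y _⦋0⦌)) (F : HallCat D X) :
    (rightActAssociator hD hΦ H M F (𝟙_ _)).hom ≫ rightActMap Φ hD (𝟙 M) (ρ_ F).hom =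
      (rightActUnitor hD hΦ H (rightAct Φ hD M F)).hom := by
  have hu := resRightAct_unit Φ
    (exists_rightActUnitor hD hΦ H (rightAct Φ hD M F)).choose_spec (n := 1) 0
  have h := rightUnitor_tensor_of_mul
    (v := resRightAct Φ (rightActMul Φ hD M F) (n := 1) 0 1 (by decide)) hu
    (relMul_unit_right Φ (H.mul_unit F) (n := 1) 0 1 (by decide))
    (resRightAct_associativity Φ (exists_rightActAssociator hD hΦ H M F (𝟙_ _)).choose_spec
      (n := 1) 0 0 1 (by decide) (by decide))
    (resRightAct_naturality_right Φ (rightActMul_naturality Φ hD (𝟙 M) _) _ _ _)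
  simp only [← Functor.map_comp, resRightAct_zero_one] at h
  exact (isLan_whiskerRight_resRightAct_unit Φ (isLan_rightActMul Φ hD M F)
    (exists_rightActUnitor hD hΦ H (rightAct Φ hD M F)).choose_spec _).1 h

/-- The right action of the Hall monoidal category. The associativity isomorphism of a right action
points from `M (F G)` to `(M F) G`, so it is the inverse of `rightActAssociator`. -/
@[reducible]
noncomputable def hallRightAction : MonoidalRightAction (HallCat D X) (D.obj (Y _⦋0⦌)) where
  actionObj := rightAct Φ hD
  actionHomRight M _ _ y := rightActMap Φ hD (𝟙 M) y
  actionHomLeft x F := rightActMap Φ hD x (𝟙 F)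
  actionHom x y := rightActMap Φ hD x y
  actionAssocIso M F G := (rightActAssociator hD hΦ H M F G).symm
  actionUnitIso := rightActUnitor hD hΦ H
  actionHom_def x y := by
    rw [← rightActMap_comp, Category.comp_id, Category.id_comp]
  actionHomRight_id F M := rightActMap_id Φ hD M F
  id_actionHomLeft F M := rightActMap_id Φ hD M F
  actionHom_comp x x' y y' := rightActMap_comp Φ hD x y x' y'
  actionAssocIso_hom_naturality x y z := by
    simp only [Iso.symm_hom]
    rw [Iso.comp_inv_eq, Category.assoc, rightActAssociator_naturality, Iso.inv_hom_id_assoc]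
  actionUnitIso_hom_naturality x := (rightActUnitor_naturality hD hΦ H x).symm
  actionHomRight_whiskerRight y G M := by
    simp only [Iso.symm_hom, Iso.symm_inv]
    rw [Iso.eq_inv_comp, rightActAssociator_naturality, tensorHom_id]
  whiskerRight_actionHomLeft F _ _ y M := by
    simp only [Iso.symm_hom, Iso.symm_inv]
    rw [Iso.eq_inv_comp, ← rightActMap_id, rightActAssociator_naturality, id_tensorHom]
  actionHom_associator F G K M := by
    have h := rightActAssociator_pentagon hD hΦ H M F G K
    have e : rightActMap Φ hD (rightActAssociator hD hΦ H M F G).inv (𝟙 K) ≫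
        rightActMap Φ hD (rightActAssociator hD hΦ H M F G).hom (𝟙 K) = 𝟙 _ := by
      rw [← rightActMap_comp, Iso.inv_hom_id, Category.comp_id, rightActMap_id]
    simp only [Iso.symm_hom]
    rw [← Category.assoc, Iso.comp_inv_eq, Iso.comp_inv_eq, Category.assoc, Category.assoc,
      ← h, reassoc_of% e, Iso.inv_hom_id_assoc]
  actionHom_leftUnitor F M := by
    simp only [Iso.symm_hom]
    rw [Iso.eq_inv_comp, rightActAssociator_leftUnitor]
  actionHom_rightUnitor F M := by
    simp only [Iso.symm_hom]
    rw [Iso.eq_inv_comp, rightActAssociator_rightUnitor]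

/-- The structure maps of the right Hall module. -/
noncomputable def hallRightModule :
    letI := hallRightAction hD hΦ H
    HallRightModule Φ H :=
  letI := hallRightAction hD hΦ H
  { act := rightActMul Φ hD
    act_isLan := isLan_rightActMul Φ hD
    act_naturality := rightActMul_naturality Φ hD
    act_assoc := fun M F G => by
      have h := (exists_rightActAssociator hD hΦ H M F G).choose_spec
      change _ ≫ _ ≫ (relVertex D Y 0).map (rightActAssociator hD hΦ H M F G).inv = _
      rw [← Iso.inv_comp_eq] at h
      rw [← Category.assoc, ← h]
      simp only [Category.assoc]
      erw [← Functor.map_comp, Iso.hom_inv_id, CategoryTheory.Functor.map_id, Category.comp_id]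
      rfl
    act_unit := fun M => (exists_rightActUnitor hD hΦ H M).choose_spec }

end RightModule

/-! ### The left Hall module -/

section LeftModule

open MonoidalPrederivator

variable {D : MonoidalPrederivator.{w, z, u}} {X Y : SimplicialObject Grpd.{u, u}} (Φ : Y ⟶ X)

/-- Left action maps `F|_{01} ⊗ M|_0 ⟶ N|_1` on `Y_1`. -/
abbrev LeftAct (F : HallCat D X) (M N : D.obj (Y _⦋0⦌)) : Type z :=
  (relEdge D Φ (n := 1) 0 1 (by decide)).obj F ⊗ (relVertex D Y 0).obj M ⟶
      (relVertex D Y 1).obj N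

section Restriction

variable {M M' N N' : D.obj (Y _⦋0⦌)} {F F' G : HallCat D X}

lemma resLeftAct_simplicialMap (m : LeftAct Φ F M N) {n n' : ℕ}
    (e : ⦋n⦌ ⟶ ⦋n'⦌) {a b : Fin (n + 1)} (hab : a ≤ b) {i j : Fin (n' + 1)} (hij : i ≤ j)
    (hi : e a = i) (hj : e b = j) :
    D.pullMul (simplicialMap Y e) (relEdge_simplicialMap Φ e a b hab hij hi hj)
      (vertex_simplicialMap Y e a hi) (vertex_simplicialMap Y e b hj)
      (resLeftAct Φ m a b hab) = resLeftAct Φ m i j hij :=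
  D.pullMul_pullMul _ _ (edge_simplicialMap Y e a b hab hij hi hj) _ _ _ _ _ _ _ _ _ _

lemma resLeftAct_naturality {m : LeftAct Φ F M N} {m' : LeftAct Φ F' M' N'}
    {x : F ⟶ F'} {y : M ⟶ M'} {k : N ⟶ N'}
    (H : ((relEdge D Φ (n := 1) 0 1 (by decide)).map x ⊗ₘ (relVertex D Y 0).map y) ≫ m' =
      m ≫ (relVertex D Y 1).map k) {n : ℕ} (a b : Fin (n + 1)) (hab : a ≤ b) :
    ((relEdge D Φ a b hab).map x ⊗ₘ (relVertex D Y a).map y) ≫ resLeftAct Φ m' a b hab =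
      resLeftAct Φ m a b hab ≫ (relVertex D Y b).map k :=
  D.pullMul_naturality (edge Y a b hab) _ _ _ H

lemma resLeftAct_naturality_left {m : LeftAct Φ F M N} {m' : LeftAct Φ F' M N'}
    {x : F ⟶ F'} {k : N ⟶ N'}
    (H : ((relEdge D Φ (n := 1) 0 1 (by decide)).map x ⊗ₘ (relVertex D Y 0).map (𝟙 M)) ≫ m' =
      m ≫ (relVertex D Y 1).map k) {n : ℕ} (a b : Fin (n + 1)) (hab : a ≤ b) :
    ((relEdge D Φ a b hab).map x ▷ (relVertex D Y a).obj M) ≫ resLeftAct Φ m' a b hab =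
      resLeftAct Φ m a b hab ≫ (relVertex D Y b).map k := by
  rw [← resLeftAct_naturality Φ H, CategoryTheory.Functor.map_id, tensorHom_id]

lemma resLeftAct_naturality_right {m : LeftAct Φ F M N} {m' : LeftAct Φ F M' N'}
    {y : M ⟶ M'} {k : N ⟶ N'}
    (H : ((relEdge D Φ (n := 1) 0 1 (by decide)).map (𝟙 F) ⊗ₘ (relVertex D Y 0).map y) ≫ m' =
      m ≫ (relVertex D Y 1).map k) {n : ℕ} (a b : Fin (n + 1)) (hab : a ≤ b) :
    ((relEdge D Φ a b hab).obj F ◁ (relVertex D Y a).map y) ≫ resLeftAct Φ m' a b hab =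
      resLeftAct Φ m a b hab ≫ (relVertex D Y b).map k := by
  rw [← resLeftAct_naturality Φ H, CategoryTheory.Functor.map_id, id_tensorHom]

/-- An associativity equation on `Y_2` restricts to all triangles. -/
lemma resLeftAct_associativity {GM L L' : D.obj (Y _⦋0⦌)} {FG : HallCat D X}
    {m₁ : HallMul F G FG} {m₂ : LeftAct Φ FG M L} {m₃ : LeftAct Φ G M GM}
    {m₄ : LeftAct Φ F GM L'} {a : L ⟶ L'}
    (E : (relMul Φ m₁ (n := 2) 0 1 2 (by decide) (by decide) ▷ (relVertex D Y 0).obj M) ≫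
        resLeftAct Φ m₂ 0 2 (by decide) ≫ (relVertex D Y 2).map a =
      (α_ _ _ _).hom ≫ ((relEdge D Φ 1 2 (by decide)).obj F ◁
          resLeftAct Φ m₃ (n := 2) 0 1 (by decide)) ≫ resLeftAct Φ m₄ 1 2 (by decide))
    {n : ℕ} (i j k : Fin (n + 1)) (hij : i ≤ j) (hjk : j ≤ k) :
    (relMul Φ m₁ i j k hij hjk ▷ (relVertex D Y i).obj M) ≫
        resLeftAct Φ m₂ i k (hij.trans hjk) ≫ (relVertex D Y k).map a =
      (α_ _ _ _).hom ≫ ((relEdge D Φ j k hjk).obj F ◁ resLeftAct Φ m₃ i j hij) ≫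
          resLeftAct Φ m₄ j k hjk := by
  let e := SimplexCategory.mkOfLeComp i j k hij hjk
  rw [← relMul_simplicialMap Φ m₁ e (a := 0) (b := 1) (c := 2) (by decide) (by decide) hij hjk
      rfl rfl rfl,
    ← resLeftAct_simplicialMap Φ m₂ e (a := 0) (b := 2) (by decide) (hij.trans hjk) rfl rfl,
    ← resLeftAct_simplicialMap Φ m₃ e (a := 0) (b := 1) (by decide) hij rfl rfl,
    ← resLeftAct_simplicialMap Φ m₄ e (a := 1) (b := 2) (by decide) hjk rfl rfl]
  exact D.pullMul_associativity (simplicialMap Y e) _ _ _ _ _ _ E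

/-- A unit equation on `Y_0` restricts to all vertices. -/
lemma resLeftAct_unit {U : HallCat D X}
    {t : 𝟙_ (D.obj (X _⦋0⦌)) ⟶ (resEdge D X (n := 0) 0 0 le_rfl).obj U} {m : LeftAct Φ U M N}
    {k : N ⟶ M}
    (E : (relUnit Φ t (n := 0) 0 ▷ (relVertex D Y 0).obj M) ≫
        resLeftAct Φ m 0 0 le_rfl ≫ (relVertex D Y 0).map k = (λ_ _).hom)
    {n : ℕ} (i : Fin (n + 1)) :
    (relUnit Φ t i ▷ (relVertex D Y i).obj M) ≫ resLeftAct Φ m i i le_rfl ≫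
      (relVertex D Y i).map k = (λ_ _).hom := by
  let e := SimplexCategory.const ⦋0⦌ ⦋n⦌ i
  rw [← resLeftAct_simplicialMap Φ m e (a := 0) (b := 0) le_rfl (i := i) (j := i) le_rfl
      rfl rfl,
    ← relUnit_simplicialMap Φ t e (a := 0) (i := i) rfl]
  exact D.pullMul_unit_left (simplicialMap Y e) _ _ E

lemma resLeftAct_zero_one (m : LeftAct Φ F M N) :
    resLeftAct Φ m (n := 1) 0 1 (by decide) = m :=
  pullMul_id edge_zero_one_eq_id _ _ _ _

end Restriction

variable (hD : D.IsCocontinuousLeftDerivator)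

section Lan

variable {Φ} {M N L K : D.obj (Y _⦋0⦌)} {F G H FG FGH U : HallCat D X}
  (hΦ : IsTwoSegalMorphism Φ)
include hD hΦ

/-- `(F G) M` is the left Kan extension along the vertex `2` of the product of the three factors on
`Y_2`. -/
lemma isLan_resLeftAct_left {m₁ : HallMul F G FG} {m₂ : LeftAct Φ FG M L}
    (h₁ : D.IsLan (edge X 0 2 (by decide)) m₁) (h₂ : D.IsLan (vertex Y 1) m₂) :
    D.IsLan (vertex Y 2) ((relMul Φ m₁ (n := 2) 0 1 2 (by decide) (by decide) ▷
      (relVertex D Y 0).obj M) ≫ resLeftAct Φ m₂ 0 2 (by decide)) :=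
  IsLan.mul_whiskerRight_comp hD hΦ.square₀₁₂ h₁ h₂ _ _ _ _ _ _

/-- `F (G M)` is the left Kan extension along the vertex `2` of the product of the three factors on
`Y_2`. -/
lemma isLan_resLeftAct_right {m₃ : LeftAct Φ G M N} {m₄ : LeftAct Φ F N L}
    (h₃ : D.IsLan (vertex Y 1) m₃) (h₄ : D.IsLan (vertex Y 1) m₄) :
    D.IsLan (vertex Y 2) (((relEdge D Φ 1 2 (by decide)).obj F ◁
      resLeftAct Φ m₃ (n := 2) 0 1 (by decide)) ≫ resLeftAct Φ m₄ 1 2 (by decide)) :=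
  IsLan.mul_whiskerLeft_comp hD hΦ.square₀₁ h₃ h₄ _ _ _ _ _ _

/-- `((F G) H) M` is the left Kan extension along the vertex `3` of the product of the four factors
on `Y_3`. -/
lemma isLan_relMul_resLeftAct {m₁ : HallMul F G FG} {m₂ : HallMul FG H FGH}
    {m₃ : LeftAct Φ FGH M L} (h₁ : D.IsLan (edge X 0 2 (by decide)) m₁)
    (h₂ : D.IsLan (edge X 0 2 (by decide)) m₂) (h₃ : D.IsLan (vertex Y 1) m₃) :
    D.IsLan (vertex Y 3) ((((relMul Φ m₁ (n := 3) 1 2 3 (by decide) (by decide) ▷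
      (relEdge D Φ 0 1 (by decide)).obj H) ≫ relMul Φ m₂ 0 1 3 (by decide) (by decide)) ▷
        (relVertex D Y 0).obj M) ≫ resLeftAct Φ m₃ 0 3 (by decide)) := by
  rw [relMul_eq_pullMul, relMul_eq_pullMul]
  exact IsLan.mul_mul_whiskerRight_comp hD hΦ.square₀₁₂₃ (isLan_resMul_left hD hΦ.base h₁ h₂) h₃
    _ _ _ _ rfl _ _ _

lemma isLan_resLeftAct_unit
    {t : 𝟙_ (D.obj (X _⦋0⦌)) ⟶ (resEdge D X (n := 0) 0 0 le_rfl).obj U} {m : LeftAct Φ U M N}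
    (ht : D.IsLan (edge X (n := 0) 0 0 le_rfl) t) (hm : D.IsLan (vertex Y 1) m) :
    D.IsLan (vertex Y 0) ((relUnit Φ t (n := 0) 0 ▷ (relVertex D Y 0).obj M) ≫
        resLeftAct Φ m 0 0 le_rfl) :=
  IsLan.unit_whiskerRight_comp hD hΦ.square₀₀ ht hm _ _ _ _

end Lan

/-- The left action of the Hall monoidal category on objects. -/
noncomputable def leftAct (F : HallCat D X) (M : D.obj (Y _⦋0⦌)) : D.obj (Y _⦋0⦌) :=
  lanTensor hD (component Φ 1 ⋙ edge X 0 1 (by decide)) (vertex Y (n := 1) 0) (vertex Y 1) F M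

/-- The universal left action map. -/
noncomputable def leftActMul (F : HallCat D X) (M : D.obj (Y _⦋0⦌)) :
    LeftAct Φ F M (leftAct Φ hD F M) :=
  lanMul hD (component Φ 1 ⋙ edge X 0 1 (by decide)) (vertex Y (n := 1) 0) (vertex Y 1) F M

lemma isLan_leftActMul (F : HallCat D X) (M : D.obj (Y _⦋0⦌)) :
    D.IsLan (vertex Y 1) (leftActMul Φ hD F M) :=
  isLan_lanMul hD _ _ _ F M

/-- The left action of the Hall monoidal category on morphisms. -/
noncomputable def leftActMap {F F' : HallCat D X} {M M' : D.obj (Y _⦋0⦌)} (x : F ⟶ F')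
    (y : M ⟶ M') : leftAct Φ hD F M ⟶ leftAct Φ hD F' M' :=
  lanTensorMap hD (component Φ 1 ⋙ edge X 0 1 (by decide)) (vertex Y (n := 1) 0) (vertex Y 1) x y

lemma leftActMul_naturality {F F' : HallCat D X} {M M' : D.obj (Y _⦋0⦌)} (x : F ⟶ F')
    (y : M ⟶ M') :
    ((relEdge D Φ (n := 1) 0 1 (by decide)).map x ⊗ₘ (relVertex D Y 0).map y) ≫
        leftActMul Φ hD F' M' =
      leftActMul Φ hD F M ≫ (relVertex D Y 1).map (leftActMap Φ hD x y) :=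
  lanMul_naturality hD _ _ _ x y

lemma leftActMap_id (F : HallCat D X) (M : D.obj (Y _⦋0⦌)) :
    leftActMap Φ hD (𝟙 F) (𝟙 M) = 𝟙 _ :=
  lanTensorMap_id hD _ _ _ F M

lemma leftActMap_comp {F F' F'' : HallCat D X} {M M' M'' : D.obj (Y _⦋0⦌)} (x : F ⟶ F')
    (y : M ⟶ M') (x' : F' ⟶ F'') (y' : M' ⟶ M'') :
    leftActMap Φ hD (x ≫ x') (y ≫ y') = leftActMap Φ hD x y ≫ leftActMap Φ hD x' y' :=
  lanTensorMap_comp hD _ _ _ x y x' y'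

variable {Φ} (hΦ : IsTwoSegalMorphism Φ) [MonoidalCategory (HallCat D X)] (H : HallStructure D X)

include hΦ

/-- The associator compares two left Kan extensions of the same product on `Y_2`. -/
lemma exists_leftActAssociator (F G : HallCat D X) (M : D.obj (Y _⦋0⦌)) :
    ∃ a : leftAct Φ hD (F ⊗ G) M ≅ leftAct Φ hD F (leftAct Φ hD G M),
      (relMul Φ (H.mul F G) (n := 2) 0 1 2 (by decide) (by decide) ▷
          (relVertex D Y 0).obj M) ≫
        resLeftAct Φ (leftActMul Φ hD (F ⊗ G) M) 0 2 (by decide) ≫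
          (relVertex D Y 2).map a.hom =
      (α_ _ _ _).hom ≫ ((relEdge D Φ 1 2 (by decide)).obj F ◁
          resLeftAct Φ (leftActMul Φ hD G M) (n := 2) 0 1 (by decide)) ≫
          resLeftAct Φ (leftActMul Φ hD F (leftAct Φ hD G M)) 1 2 (by decide) := by
  obtain ⟨a, ha⟩ := (isLan_resLeftAct_left hD hΦ (H.mul_isLan F G)
    (isLan_leftActMul Φ hD (F ⊗ G) M)).exists_iso
    ((isLan_resLeftAct_right hD hΦ (isLan_leftActMul Φ hD G M)
      (isLan_leftActMul Φ hD F (leftAct Φ hD G M))).iso_comp (α_ _ _ _).hom)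
  exact ⟨a, (Category.assoc _ _ _).symm.trans ha⟩

lemma exists_leftActUnitor (M : D.obj (Y _⦋0⦌)) :
    ∃ l : leftAct Φ hD (𝟙_ (HallCat D X)) M ≅ M,
      (relUnit Φ H.unit (n := 0) 0 ▷ (relVertex D Y 0).obj M) ≫
        resLeftAct Φ (leftActMul Φ hD (𝟙_ _) M) 0 0 le_rfl ≫ (relVertex D Y 0).map l.hom =
      (λ_ _).hom := by
  obtain ⟨a, ha⟩ := (isLan_resLeftAct_unit hD hΦ H.unit_isLan
    (isLan_leftActMul Φ hD (𝟙_ _) M)).exists_iso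
      (@isLan_of_isIso D _ _ vertex_zero_eq_id _ _
        (λ_ ((relVertex D Y (n := 0) 0).obj M)).hom (Iso.isIso_hom _))
  exact ⟨a, (Category.assoc _ _ _).symm.trans ha⟩

/-- The associativity isomorphism `(F G) M ≅ F (G M)`. -/
noncomputable def leftActAssociator (F G : HallCat D X) (M : D.obj (Y _⦋0⦌)) :
    leftAct Φ hD (F ⊗ G) M ≅ leftAct Φ hD F (leftAct Φ hD G M) :=
  (exists_leftActAssociator hD hΦ H F G M).choose

/-- The unit isomorphism `𝟙 M ≅ M`. -/
noncomputable def leftActUnitor (M : D.obj (Y _⦋0⦌)) :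
    leftAct Φ hD (𝟙_ (HallCat D X)) M ≅ M :=
  (exists_leftActUnitor hD hΦ H M).choose

lemma leftActAssociator_naturality {F F' G G' : HallCat D X} {M M' : D.obj (Y _⦋0⦌)}
    (x : F ⟶ F') (y : G ⟶ G') (z : M ⟶ M') :
    leftActMap Φ hD (x ⊗ₘ y) z ≫ (leftActAssociator hD hΦ H F' G' M').hom =
      (leftActAssociator hD hΦ H F G M).hom ≫ leftActMap Φ hD x (leftActMap Φ hD y z) := by
  refine (isLan_resLeftAct_left hD hΦ (H.mul_isLan F G)
    (isLan_leftActMul Φ hD (F ⊗ G) M) _).1 ?_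
  have h := associator_naturality_of_mul
    (exists_leftActAssociator hD hΦ H F G M).choose_spec
    (exists_leftActAssociator hD hΦ H F' G' M').choose_spec
    (relMul_naturality Φ (H.mul_naturality x y) _ _ _ _ _)
    (resLeftAct_naturality Φ (leftActMul_naturality Φ hD y z) _ _ _)
    (resLeftAct_naturality Φ (leftActMul_naturality Φ hD (x ⊗ₘ y) z) _ _ _)
    (resLeftAct_naturality Φ (leftActMul_naturality Φ hD x (leftActMap Φ hD y z)) _ _ _)
  simp only [← Functor.map_comp] at h
  exact h

lemma leftActUnitor_naturality {M M' : D.obj (Y _⦋0⦌)} (x : M ⟶ M') :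
    leftActMap Φ hD (𝟙 _) x ≫ (leftActUnitor hD hΦ H M').hom =
      (leftActUnitor hD hΦ H M).hom ≫ x := by
  refine (isLan_resLeftAct_unit hD hΦ H.unit_isLan (isLan_leftActMul Φ hD (𝟙_ _) M) _).1 ?_
  have h := leftUnitor_naturality_of_mul
    (exists_leftActUnitor hD hΦ H M).choose_spec
    (exists_leftActUnitor hD hΦ H M').choose_spec
    (resLeftAct_naturality_right Φ (leftActMul_naturality Φ hD (𝟙 _) x) _ _ _)
  simp only [← Functor.map_comp] at h
  exact h

lemma leftActAssociator_pentagon (F G K : HallCat D X) (M : D.obj (Y _⦋0⦌)) :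
    leftActMap Φ hD (α_ F G K).hom (𝟙 M) ≫ (leftActAssociator hD hΦ H F (G ⊗ K) M).hom ≫
        leftActMap Φ hD (𝟙 F) (leftActAssociator hD hΦ H G K M).hom =
      (leftActAssociator hD hΦ H (F ⊗ G) K M).hom ≫
        (leftActAssociator hD hΦ H F G (leftAct Φ hD K M)).hom := by
  refine (isLan_relMul_resLeftAct hD hΦ (H.mul_isLan F G) (H.mul_isLan (F ⊗ G) K)
    (isLan_leftActMul Φ hD ((F ⊗ G) ⊗ K) M) _).1 ?_
  have h := pentagon_of_mul
    (relMul_associativity Φ (H.mul_assoc F G K) (n := 3) 0 1 2 3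
      (by decide) (by decide) (by decide))
    (resLeftAct_associativity Φ (exists_leftActAssociator hD hΦ H G K M).choose_spec
      (n := 3) 0 1 2 (by decide) (by decide))
    (resLeftAct_associativity Φ (exists_leftActAssociator hD hΦ H F (G ⊗ K) M).choose_spec
      (n := 3) 0 2 3 (by decide) (by decide))
    (resLeftAct_associativity Φ (exists_leftActAssociator hD hΦ H (F ⊗ G) K M).choose_spec
      (n := 3) 0 1 3 (by decide) (by decide))
    (resLeftAct_associativity Φ
      (exists_leftActAssociator hD hΦ H F G (leftAct Φ hD K M)).choose_spec
      (n := 3) 1 2 3 (by decide) (by decide))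
    (resLeftAct_naturality_left Φ (leftActMul_naturality Φ hD _ (𝟙 M)) _ _ _)
    (resLeftAct_naturality_right Φ (leftActMul_naturality Φ hD (𝟙 F) _) _ _ _)
  simp only [← Functor.map_comp] at h
  exact h

lemma leftActAssociator_leftUnitor (F : HallCat D X) (M : D.obj (Y _⦋0⦌)) :
    (leftActAssociator hD hΦ H (𝟙_ _) F M).hom ≫
        (leftActUnitor hD hΦ H (leftAct Φ hD F M)).hom =
      leftActMap Φ hD (λ_ F).hom (𝟙 M) := by
  have hu := relMul_unit_left Φ (H.unit_mul F) (n := 1) 0 1 (by decide)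
  have h := leftUnitor_tensor_of_mul hu
    (resLeftAct_unit Φ (exists_leftActUnitor hD hΦ H (leftAct Φ hD F M)).choose_spec (n := 1) 1)
    (resLeftAct_associativity Φ (exists_leftActAssociator hD hΦ H (𝟙_ _) F M).choose_spec
      (n := 1) 0 1 1 (by decide) (by decide))
    (resLeftAct_naturality_left Φ (leftActMul_naturality Φ hD _ (𝟙 M)) _ _ _)
  -- By the unit equation `hu`, multiplication by the unit map is an isomorphism.
  have := IsIso.of_isIso_fac_right ((Category.assoc _ _ _).trans hu)
  have hL := (isLan_leftActMul Φ hD (𝟙_ _ ⊗ F) M).iso_comp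
    ((relUnit Φ H.unit (n := 1) 1 ▷ (relEdge D Φ 0 1 (by decide)).obj F ≫
      relMul Φ (H.mul (𝟙_ _) F) 0 1 1 (by decide) le_rfl) ▷ (relVertex D Y 0).obj M)
  simp only [← Functor.map_comp, resLeftAct_zero_one] at h
  exact (hL _).1 h

lemma leftActAssociator_rightUnitor (F : HallCat D X) (M : D.obj (Y _⦋0⦌)) :
    (leftActAssociator hD hΦ H F (𝟙_ _) M).hom ≫
        leftActMap Φ hD (𝟙 F) (leftActUnitor hD hΦ H M).hom =
      leftActMap Φ hD (ρ_ F).hom (𝟙 M) := by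
  have hu := relMul_unit_right Φ (H.mul_unit F) (n := 1) 0 1 (by decide)
  have h := triangle_of_mul hu
    (resLeftAct_unit Φ (exists_leftActUnitor hD hΦ H M).choose_spec (n := 1) 0)
    (resLeftAct_associativity Φ (exists_leftActAssociator hD hΦ H F (𝟙_ _) M).choose_spec
      (n := 1) 0 0 1 (by decide) (by decide))
    (resLeftAct_naturality_left Φ (leftActMul_naturality Φ hD _ (𝟙 M)) _ _ _)
    (resLeftAct_naturality_right Φ (leftActMul_naturality Φ hD (𝟙 F) _) _ _ _)
  -- By the unit equation `hu`, multiplication by the unit map is an isomorphism.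
  have := IsIso.of_isIso_fac_right ((Category.assoc _ _ _).trans hu)
  have hL := (isLan_leftActMul Φ hD (F ⊗ 𝟙_ _) M).iso_comp
    ((((relEdge D Φ (n := 1) 0 1 (by decide)).obj F ◁ relUnit Φ H.unit 0) ≫
      relMul Φ (H.mul F (𝟙_ _)) 0 0 1 le_rfl (by decide)) ▷ (relVertex D Y 0).obj M)
  simp only [← Functor.map_comp, resLeftAct_zero_one] at h
  exact (hL _).1 h

/-- The left action of the Hall monoidal category. -/
@[reducible]
noncomputable def hallLeftAction : MonoidalLeftAction (HallCat D X) (D.obj (Y _⦋0⦌)) where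
  actionObj := leftAct Φ hD
  actionHomRight F _ _ y := leftActMap Φ hD (𝟙 F) y
  actionHomLeft x M := leftActMap Φ hD x (𝟙 M)
  actionHom x y := leftActMap Φ hD x y
  actionAssocIso F G M := leftActAssociator hD hΦ H F G M
  actionUnitIso := leftActUnitor hD hΦ H
  actionHom_def x y := by
    rw [← leftActMap_comp, Category.comp_id, Category.id_comp]
  actionHomRight_id F M := leftActMap_id Φ hD F M
  id_actionHomLeft F M := leftActMap_id Φ hD F M
  actionHom_comp x x' y y' := leftActMap_comp Φ hD x y x' y'
  actionAssocIso_hom_naturality x y z := leftActAssociator_naturality hD hΦ H x y z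
  actionUnitIso_hom_naturality x := (leftActUnitor_naturality hD hΦ H x).symm
  whiskerLeft_actionHomLeft F _ _ y M := by
    rw [← Category.assoc, Iso.eq_comp_inv, ← leftActAssociator_naturality, id_tensorHom]
  whiskerRight_actionHomLeft G y M := by
    rw [← Category.assoc, Iso.eq_comp_inv, ← leftActMap_id, ← leftActAssociator_naturality,
      tensorHom_id]
  associator_actionHom F G K M := leftActAssociator_pentagon hD hΦ H F G K M
  leftUnitor_actionHom F M := (leftActAssociator_leftUnitor hD hΦ H F M).symm
  rightUnitor_actionHom F M := (leftActAssociator_rightUnitor hD hΦ H F M).symm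

/-- The structure maps of the left Hall module. -/
noncomputable def hallLeftModule :
    letI := hallLeftAction hD hΦ H
    HallLeftModule Φ H :=
  letI := hallLeftAction hD hΦ H
  { act := leftActMul Φ hD
    act_isLan := isLan_leftActMul Φ hD
    act_naturality := leftActMul_naturality Φ hD
    act_assoc := fun F G M => (exists_leftActAssociator hD hΦ H F G M).choose_spec
    unit_act := fun M => (exists_leftActUnitor hD hΦ H M).choose_spec }

end LeftModule

/-! ### Kan extensions of functors to a cocomplete category -/

section Represented

variable {P A B C : Grpd.{u, u}} {p : P ⥤ A} {q : P ⥤ C} {f : A ⥤ B} {g : C ⥤ B}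
  {α : p ⋙ f ≅ q ⋙ g}

/-- 2-pullback squares of groupoids are exact: the comparison of the comma categories which
compute the left Kan extensions along `q` and `f` is an equivalence. -/
lemma IsTwoPullback.guitartExact (h : IsTwoPullback p q f g α) :
    (TwoSquare.mk p q f g α.hom).GuitartExact := by
  rw [isTwoPullback_iff] at h
  rw [TwoSquare.guitartExact_iff_final]
  intro c
  have h₁ : ((TwoSquare.mk p q f g α.hom).costructuredArrowRightwards c).Faithful := ⟨by
    intro x y k l e
    have e₁ : p.map k.left = p.map l.left := congrArg CommaMorphism.left e
    have e₂ : q.map k.left = q.map l.left := by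
      rw [← cancel_mono y.hom, CostructuredArrow.w, CostructuredArrow.w]
    ext
    exact (h.1 _ _ (p.map l.left) (q.map l.left) (α.hom.naturality l.left)).unique
      ⟨e₁, e₂⟩ ⟨rfl, rfl⟩⟩
  have h₂ : ((TwoSquare.mk p q f g α.hom).costructuredArrowRightwards c).Full := ⟨by
    intro x y a
    have e : f.map a.left ≫ α.hom.app y.left ≫ g.map y.hom =
        α.hom.app x.left ≫ g.map x.hom := CostructuredArrow.w a
    -- Since `C` is a groupoid, compatibility over `c` forces the component of `a` in `C`.
    obtain ⟨k, ⟨hk, hk'⟩, -⟩ := h.1 x.left y.left a.left (x.hom ≫ inv y.hom) (by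
      rw [← cancel_mono (g.map y.hom), Category.assoc, Category.assoc, ← Functor.map_comp,
        Category.assoc, IsIso.inv_hom_id, Category.comp_id]
      exact e)
    refine ⟨CostructuredArrow.homMk k (by rw [hk']; simp), ?_⟩
    ext
    exact hk⟩
  have h₃ : ((TwoSquare.mk p q f g α.hom).costructuredArrowRightwards c).EssSurj := ⟨by
    intro a
    -- Since `B` is a groupoid, the structure morphism of `a` is an isomorphism.
    obtain ⟨x, a', c', e⟩ := h.2 a.left c (asIso a.hom)
    refine ⟨CostructuredArrow.mk c'.hom, ⟨CostructuredArrow.isoMk a' e⟩⟩⟩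
  have : ((TwoSquare.mk p q f g α.hom).costructuredArrowRightwards c).IsEquivalence := {}
  infer_instance

namespace MonoidalPrederivator

variable {V : Type w'} [Category.{z'} V] [MonoidalCategory V]

lemma isLan_functors_iff {f : A ⥤ B} {M : A ⥤ V} {N : B ⥤ V} (η : M ⟶ f ⋙ N) :
    (functors.{w', z', u} V).IsLan f (M := M) (N := N) η ↔ N.IsLeftKanExtension η := by
  constructor
  · intro h
    refine ⟨⟨IsInitial.ofUniqueHom
      (fun G => StructuredArrow.homMk ((h G.right).2 G.hom).choose
        ((h G.right).2 G.hom).choose_spec) fun G m => ?_⟩⟩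
    ext1
    exact (h G.right).1 ((StructuredArrow.w m).trans ((h G.right).2 G.hom).choose_spec.symm)
  · intro h K
    exact (N.homEquivOfIsLeftKanExtension η K).bijective

variable [HasColimitsOfSize.{u, u} V]

/-- Left Kan extensions of functors to a cocomplete category are pointwise. -/
lemma isLan_functors_iff_pointwise {f : A ⥤ B} {M : A ⥤ V} {N : B ⥤ V} (η : M ⟶ f ⋙ N) :
    (functors.{w', z', u} V).IsLan f (M := M) (N := N) η ↔
      Nonempty (Functor.LeftExtension.mk N η).IsPointwiseLeftKanExtension := by
  rw [isLan_functors_iff]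
  refine ⟨fun h => ⟨Functor.isPointwiseLeftKanExtensionOfIsLeftKanExtension _ _⟩,
    fun ⟨h⟩ => h.isLeftKanExtension⟩

lemma exists_isLan_functors (f : A ⥤ B) (M : A ⥤ V) :
    ∃ (N : B ⥤ V) (η : M ⟶ f ⋙ N), (functors.{w', z', u} V).IsLan f (M := M) (N := N) η :=
  ⟨f.leftKanExtension M, f.leftKanExtensionUnit M, (isLan_functors_iff _).2 inferInstance⟩

lemma isLan_functors_baseChange (h : IsTwoPullback p q f g α) {M : A ⥤ V} {N : B ⥤ V}
    (η : M ⟶ f ⋙ N) (hη : (functors.{w', z', u} V).IsLan f (M := M) (N := N) η) :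
    (functors.{w', z', u} V).IsLan q
      ((functors.{w', z', u} V).baseChange p q f g α (M := M) (N := N) η) := by
  obtain ⟨hη⟩ := (isLan_functors_iff_pointwise η).1 hη
  have := h.guitartExact
  have e : (functors.{w', z', u} V).baseChange p q f g α (M := M) (N := N) η =
      ((Functor.LeftExtension.mk N η).compTwoSquare (TwoSquare.mk p q f g α.hom)).hom := rfl
  rw [e]
  exact (isLan_functors_iff_pointwise (f := q) (M := p ⋙ M) (N := g ⋙ N) _).2
    ⟨hη.compTwoSquare (TwoSquare.mk p q f g α.hom)⟩

end MonoidalPrederivator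

end Represented

/-! ### External products of functors to a monoidal category -/

section RepresentedExternal

variable {P A B C A' B' : Grpd.{u, u}}

/-- The functor `f` is the base change of `f × 1` to the fibre over `b`. -/
lemma isTwoPullback_sectL (f : A ⥤ A') (b : B) :
    IsTwoPullback (P := A) (A := Grpd.of (A × B)) (B := Grpd.of (A' × B)) (C := A')
      (Prod.sectL A b) f (MonoidalPrederivator.prodMap f (𝟭 B)) (Prod.sectL A' b)
      (Iso.refl _) := by
  refine isTwoPullback_iff.2 ⟨fun x y a c e => ?_, fun a c i => ?_⟩
  · have e' : (f.map a.1, a.2) = (c, 𝟙 b) :=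
      (Category.comp_id _).symm.trans (e.trans (Category.id_comp _))
    exact ⟨a.1, ⟨Prod.ext rfl (congrArg Prod.snd e').symm, congrArg Prod.fst e'⟩,
      fun k hk => congrArg Prod.fst hk.1⟩
  · refine ⟨a.1, Iso.prod (Iso.refl a.1)
      ((CategoryTheory.Prod.snd A' B).mapIso i).symm, (CategoryTheory.Prod.fst A' B).mapIso i, ?_⟩
    refine Prod.ext ?_ ?_
    · change f.map (𝟙 a.1) ≫ i.hom.1 = 𝟙 _ ≫ i.hom.1
      rw [CategoryTheory.Functor.map_id]
      rfl
    · change i.inv.2 ≫ i.hom.2 = 𝟙 _ ≫ 𝟙 b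
      exact (congrArg Prod.snd i.inv_hom_id).trans (Category.comp_id _).symm

/-- The functor `g` is the base change of `1 × g` to the fibre over `a`. -/
lemma isTwoPullback_sectR (g : B ⥤ B') (a : A) :
    IsTwoPullback (P := B) (A := Grpd.of (A × B)) (B := Grpd.of (A × B')) (C := B')
      (Prod.sectR a B) g (MonoidalPrederivator.prodMap (𝟭 A) g) (Prod.sectR a B')
      (Iso.refl _) := by
  refine isTwoPullback_iff.2 ⟨fun x y k c e => ?_, fun k c i => ?_⟩
  · have e' : (k.1, g.map k.2) = (𝟙 a, c) :=
      (Category.comp_id _).symm.trans (e.trans (Category.id_comp _))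
    exact ⟨k.2, ⟨Prod.ext (congrArg Prod.fst e').symm rfl, congrArg Prod.snd e'⟩,
      fun l hl => congrArg Prod.snd hl.1⟩
  · refine ⟨k.2, Iso.prod ((CategoryTheory.Prod.fst A B').mapIso i).symm (Iso.refl k.2),
      (CategoryTheory.Prod.snd A B').mapIso i, ?_⟩
    refine Prod.ext ?_ ?_
    · change i.inv.1 ≫ i.hom.1 = 𝟙 _ ≫ 𝟙 a
      exact (congrArg Prod.fst i.inv_hom_id).trans (Category.comp_id _).symm
    · change g.map (𝟙 k.2) ≫ i.hom.2 = 𝟙 _ ≫ i.hom.2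
      rw [CategoryTheory.Functor.map_id]
      rfl

namespace MonoidalPrederivator

variable {V : Type w'} [Category.{z'} V] [MonoidalCategory V]

lemma functors_baseChange_app (p : P ⥤ A) (q : P ⥤ C) (f : A ⥤ B) (g : C ⥤ B)
    (α : p ⋙ f ≅ q ⋙ g) {M : A ⥤ V} {N : B ⥤ V} (η : M ⟶ f ⋙ N) (x : P) :
    ((functors.{w', z', u} V).baseChange p q f g α (M := M) (N := N) η).app x =
      η.app (p.obj x) ≫ N.map (α.hom.app x) := by
  change η.app (p.obj x) ≫ 𝟙 _ ≫ N.map (α.hom.app x) ≫ 𝟙 _ = _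
  simp

lemma functors_extMap_app (f : A ⥤ A') (g : B ⥤ B') {M : A ⥤ V} {M' : A' ⥤ V} {N : B ⥤ V}
    {N' : B' ⥤ V} (η : M ⟶ f ⋙ M') (θ : N ⟶ g ⋙ N') (x : Grpd.of (A × B)) :
    ((functors.{w', z', u} V).extMap f g (M := M) (M' := M') (N := N) (N' := N') η θ).app x =
      η.app x.1 ⊗ₘ θ.app x.2 := by
  refine (Category.comp_id _).trans (congrArg₂ (· ⊗ₘ ·)
    ((functors_baseChange_app (P := Grpd.of (A × B)) (C := Grpd.of (A' × B')) _ _ _ _ _ η x).trans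
      ?_)
    ((functors_baseChange_app (P := Grpd.of (A × B)) (C := Grpd.of (A' × B')) _ _ _ _ _ θ x).trans
      ?_))
  · exact (congrArg _ (M'.map_id _)).trans (Category.comp_id _)
  · exact (congrArg _ (N'.map_id _)).trans (Category.comp_id _)

/-- Left Kan extensions are invariant under isomorphism, with a hypothesis that can be checked
objectwise. -/
lemma IsLan.functors_iso {f : A ⥤ B} {L M : A ⥤ V} {N N' : B ⥤ V} {η : M ⟶ f ⋙ N}
    {η' : L ⟶ f ⋙ N'} (hη : (functors.{w', z', u} V).IsLan f (M := M) (N := N) η) (i : L ≅ M)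
    (j : N ≅ N') (e : ∀ a, η'.app a = i.hom.app a ≫ η.app a ≫ j.hom.app (f.obj a)) :
    (functors.{w', z', u} V).IsLan f (M := L) (N := N') η' := by
  have e' : η' = (i.hom ≫ η) ≫ Functor.whiskerLeft f j.hom := by
    ext a
    simp [e]
  subst e'
  have : @IsIso ((functors.{w', z', u} V).obj A) _ L M i.hom := i.isIso_hom
  have : @IsIso ((functors.{w', z', u} V).obj B) _ N N' j.hom := j.isIso_hom
  exact (IsLan.iso_comp (D := functors.{w', z', u} V) hη i.hom).comp_iso j.hom

/-- The restriction of `M ⊠ N` to a fibre of the projection to the second factor. -/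
def sectLExtTensorIso (M : A ⥤ V) (N : B ⥤ V) (b : B) :
    Prod.sectL A b ⋙ (functors.{w', z', u} V).extTensor M N ≅ M ⋙ tensorRight (N.obj b) :=
  NatIso.ofComponents (fun _ => Iso.refl _) (fun {x y} k => by
    change (M.map k ⊗ₘ N.map (𝟙 b)) ≫ 𝟙 _ = 𝟙 _ ≫ (M.map k ▷ N.obj b)
    simp)

/-- The restriction of `M ⊠ N` to a fibre of the projection to the first factor. -/
def sectRExtTensorIso (M : A ⥤ V) (N : B ⥤ V) (a : A) :
    Prod.sectR a B ⋙ (functors.{w', z', u} V).extTensor M N ≅ N ⋙ tensorLeft (M.obj a) :=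
  NatIso.ofComponents (fun _ => Iso.refl _) (fun {x y} k => by
    change (M.map (𝟙 a) ⊗ₘ N.map k) ≫ 𝟙 _ = 𝟙 _ ≫ (M.obj a ◁ N.map k)
    simp)

variable [HasColimitsOfSize.{u, u} V]

/-- Left Kan extensions of functors to `V` may be checked pointwise, after base change along
2-pullback squares. -/
lemma isPointwiseLeftKanExtensionAt_of_baseChange {p : P ⥤ A} {q : P ⥤ C} {f : A ⥤ B} {g : C ⥤ B}
    {α : p ⋙ f ≅ q ⋙ g} (h : IsTwoPullback p q f g α) {M : A ⥤ V} {N : B ⥤ V}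
    (η : M ⟶ f ⋙ N) (hη : (functors.{w', z', u} V).IsLan q
      ((functors.{w', z', u} V).baseChange p q f g α (M := M) (N := N) η)) (c : C) :
    Nonempty ((Functor.LeftExtension.mk N η).IsPointwiseLeftKanExtensionAt (g.obj c)) := by
  have := h.guitartExact
  obtain ⟨H⟩ := (isLan_functors_iff_pointwise (f := q) (M := p ⋙ M) (N := g ⋙ N) _).1 hη
  exact ⟨(Functor.LeftExtension.mk N η).isPointwiseLeftKanExtensionAtCompTwoSquareEquiv
    (TwoSquare.mk p q f g α.hom) c (H c)⟩

/-- Cocontinuous functors preserve left Kan extensions. -/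
lemma IsLan.functors_postcomp {f : A ⥤ B} {M : A ⥤ V} {N : B ⥤ V} {η : M ⟶ f ⋙ N}
    (hη : (functors.{w', z', u} V).IsLan f (M := M) (N := N) η) (T : V ⥤ V)
    [PreservesColimitsOfSize.{u, u} T] :
    (functors.{w', z', u} V).IsLan f (M := M ⋙ T) (N := N ⋙ T)
      (Functor.whiskerRight η T) := by
  obtain ⟨H⟩ := (isLan_functors_iff_pointwise η).1 hη
  have h := (isLan_functors_iff (M := M ⋙ T) (N := N ⋙ T) _).2
    (H.postcompose T).isLeftKanExtension
  have e : ((Functor.LeftExtension.postcompose₂ f M T).obj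
      (Functor.LeftExtension.mk N η)).hom = Functor.whiskerRight η T := by
    ext x
    simp
    rfl
  rwa [e] at h

lemma IsLan.functors_extMap_left {f : A ⥤ A'} {M : A ⥤ V} {M' : A' ⥤ V} {η : M ⟶ f ⋙ M'}
    (hη : (functors.{w', z', u} V).IsLan f (M := M) (N := M') η) (N : B ⥤ V)
    [∀ v : V, PreservesColimitsOfSize.{u, u} (tensorRight v)] :
    (functors.{w', z', u} V).IsLan (prodMap f (𝟭 B))
      ((functors.{w', z', u} V).extMap f (𝟭 B) (M := M) (M' := M') (N := N) (N' := N) η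
        (((functors.{w', z', u} V).pullId B).inv.app N)) := by
  refine (isLan_functors_iff_pointwise _).2 ⟨fun ⟨a, b⟩ => ?_⟩
  -- On the fibre over `b` the external product with `N` is composition with `- ⊗ N b`.
  refine (isPointwiseLeftKanExtensionAt_of_baseChange (isTwoPullback_sectL f b) _ ?_ a).some
  refine (hη.functors_postcomp (tensorRight (N.obj b))).functors_iso
    (L := Prod.sectL A b ⋙ (functors.{w', z', u} V).extTensor M N)
    (N' := Prod.sectL A' b ⋙ (functors.{w', z', u} V).extTensor M' N)
    (sectLExtTensorIso M N b) (sectLExtTensorIso M' N b).symm fun x => ?_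
  refine (functors_baseChange_app (P := A) (A := Grpd.of (A × B)) (B := Grpd.of (A' × B)) (C := A')
    _ _ _ _ _ _ x).trans ?_
  refine (congrArg₂ (· ≫ ·) (functors_extMap_app f (𝟭 B) η
    (((functors.{w', z', u} V).pullId B).inv.app N) (x, b))
    (CategoryTheory.Functor.map_id (C := A' × B) ((functors.{w', z', u} V).extTensor M' N)
      (f.obj x, b))).trans ?_
  change (η.app x ⊗ₘ 𝟙 (N.obj b)) ≫ 𝟙 _ = 𝟙 _ ≫ (η.app x ▷ N.obj b) ≫ 𝟙 _
  simp

lemma IsLan.functors_extMap_right {g : B ⥤ B'} {N : B ⥤ V} {N' : B' ⥤ V} {θ : N ⟶ g ⋙ N'}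
    (hθ : (functors.{w', z', u} V).IsLan g (M := N) (N := N') θ) (M : A ⥤ V)
    [∀ v : V, PreservesColimitsOfSize.{u, u} (tensorLeft v)] :
    (functors.{w', z', u} V).IsLan (prodMap (𝟭 A) g)
      ((functors.{w', z', u} V).extMap (𝟭 A) g (M := M) (M' := M) (N := N) (N' := N')
        (((functors.{w', z', u} V).pullId A).inv.app M) θ) := by
  refine (isLan_functors_iff_pointwise _).2 ⟨fun ⟨a, b⟩ => ?_⟩
  -- On the fibre over `a` the external product with `M` is composition with `M a ⊗ -`.
  refine (isPointwiseLeftKanExtensionAt_of_baseChange (isTwoPullback_sectR g a) _ ?_ b).some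
  refine (hθ.functors_postcomp (tensorLeft (M.obj a))).functors_iso
    (L := Prod.sectR a B ⋙ (functors.{w', z', u} V).extTensor M N)
    (N' := Prod.sectR a B' ⋙ (functors.{w', z', u} V).extTensor M N')
    (sectRExtTensorIso M N a) (sectRExtTensorIso M N' a).symm fun x => ?_
  refine (functors_baseChange_app (P := B) (A := Grpd.of (A × B)) (B := Grpd.of (A × B')) (C := B')
    _ _ _ _ _ _ x).trans ?_
  refine (congrArg₂ (· ≫ ·) (functors_extMap_app (𝟭 A) g
    (((functors.{w', z', u} V).pullId A).inv.app M) θ (a, x))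
    (CategoryTheory.Functor.map_id (C := A × B') ((functors.{w', z', u} V).extTensor M N')
      (a, g.obj x))).trans ?_
  change (𝟙 (M.obj a) ⊗ₘ θ.app x) ≫ 𝟙 _ = 𝟙 _ ≫ (M.obj a ◁ θ.app x) ≫ 𝟙 _
  simp

variable (V) in
/-- A cocomplete monoidal category whose tensor product is cocontinuous in each variable represents
a componentwise cocontinuous left monoidal derivator of groupoids. -/
lemma isCocontinuousLeftDerivator_functors
    [∀ v : V, PreservesColimitsOfSize.{u, u} (tensorLeft v)]
    [∀ v : V, PreservesColimitsOfSize.{u, u} (tensorRight v)] :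
    (functors.{w', z', u} V).IsCocontinuousLeftDerivator where
  exists_lan f M := exists_isLan_functors f M
  isLan_baseChange _ _ _ _ _ h _ _ η hη := isLan_functors_baseChange h η hη
  isLan_ext_left _ _ _ _ hη N := IsLan.functors_extMap_left hη N
  isLan_ext_right _ _ _ _ hθ M := IsLan.functors_extMap_right hθ M

end MonoidalPrederivator

end RepresentedExternal

theorem mainTheorem3 {X Y : SimplicialObject Grpd.{u, u}} (Φ : Y ⟶ X)
    (hΦ : IsTwoSegalMorphism Φ) :
    (∀ D : MonoidalPrederivator.{w, z, u}, D.IsCocontinuousLeftDerivator →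
      (∃ _ : MonoidalCategory (HallCat D X), Nonempty (HallStructure D X)) ∧
      ∀ [MonoidalCategory (HallCat D X)] (H : HallStructure D X),
        (∃ _ : MonoidalRightAction (HallCat D X) (D.obj (Y _⦋0⦌)),
          Nonempty (HallRightModule Φ H)) ∧
        (∃ _ : MonoidalLeftAction (HallCat D X) (D.obj (Y _⦋0⦌)),
          Nonempty (HallLeftModule Φ H))) ∧
    (∀ (V : Type w') [Category.{z'} V] [MonoidalCategory V] [HasColimitsOfSize.{u, u} V]
      [∀ v : V, PreservesColimitsOfSize.{u, u} (tensorLeft v)]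
      [∀ v : V, PreservesColimitsOfSize.{u, u} (tensorRight v)],
      (MonoidalPrederivator.functors.{w', z', u} V).IsCocontinuousLeftDerivator) := by
  exact ⟨fun D hD => ⟨⟨hallMonoidalCategory hD hΦ.base, ⟨hallStructure hD hΦ.base⟩⟩,
    fun H => ⟨⟨hallRightAction hD hΦ H, ⟨hallRightModule hD hΦ H⟩⟩,
      ⟨hallLeftAction hD hΦ H, ⟨hallLeftModule hD hΦ H⟩⟩⟩⟩,
    fun V => MonoidalPrederivator.isCocontinuousLeftDerivator_functors V⟩
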